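/- Manifolds are smooth, finite-dimensional, Hausdorff and second countable. Let $M$ be a connected manifold and let $A\to M$ be a Lie algebroid: a smooth vector bundle of finite rank with a bundle map (the anchor) $a:A\to TM$ and a Lie bracket on its smooth sections such that $[X,fY]=f[X,Y]+(a(X)f)\,Y$ and $a([X,Y])=[a(X),a(Y)]$. It is called transitive if $a$ is surjective. For a Lie groupoid $\Gamma\rightrightarrows M$ with source $s$ and target $t$ (where $gh$ is defined if $s(g)=t(h)$), the Lie algebroid of $\Gamma$ has as fibre at $y$ the kernel of $ds$ at the unit $1_y$, has anchor $dt$, and its bracket is that of the right-invariant vector fields on $\Gamma$ tangent to the source fibres. $A$ is called integrable if it is isomorphic to the Lie algebroid of a Lie groupoid all of whose source fibres are simply connected (in particular path connected). For a principal $G$-bundle $\pi:P\to M$ (with right action of the Lie group $G$), the Atiyah algebroid is the vector bundle $TP/G\to M$, with anchor induced by $d\pi$; its sections are the $G$-invariant vector fields on $P$, with their Lie bracket. **Proposition.** 1. Suppose that $A$ is transitive and isomorphic to the Lie algebroid of a Lie groupoid $\Gamma\rightrightarrows M$ with simply connected source fibres, and let $x\in M$. Then $P=s^{-1}(x)$ is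 an embedded submanifold of $\Gamma$, $G=\Gamma_x^x=s^{-1}(x)\cap t^{-1}(x)$ is an embedded submanifold of $\Gamma$ and a Lie group under the groupoid multiplication, $t|_P:P\to M$ is a principal $G$-bundle for the action of $G$ on $P$ by right multiplication in $\Gamma$, and $A$ is isomorphic to its Atiyah algebroid $TP/G$. 2. Conversely, suppose that $A$ is isomorphic to the Atiyah algebroid $TP/G$ of a principal $G$-bundle $\pi:P\to M$. Then the gauge groupoid $(P\times P)/G\rightrightarrows M$, with the quotient manifold structure, $t([u,v])=\pi(u)$, $s([u,v])=\pi(v)$ and $[u,v][v,w]=[u,w]$, is a Lie groupoid whose Lie algebroid is isomorphic to $A$; and $A$ is integrable, that is, it is also isomorphic to the Lie algebroid of a Lie groupoid with simply connected source fibres. -/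

import Mathlib

open Bundle Manifold VectorField
open scoped Manifold ContDiff Bundle

universe uM uF uA uΓ uP uG

/-! ### Lie algebroids

All manifolds are real, finite-dimensional and smooth, modelled on `EuclideanSpace ℝ (Fin n)`. -/

section LieAlgebroid

variable {n : ℕ} {M : Type uM} [TopologicalSpace M] [ChartedSpace (EuclideanSpace ℝ (Fin n)) M]
  [IsManifold (𝓡 n) ∞ M]
  {F : Type uF} [NormedAddCommGroup F] [NormedSpace ℝ F]
  {A : M → Type uA} [TopologicalSpace (TotalSpace F A)] [∀ x, TopologicalSpace (A x)]
  [∀ x, AddCommGroup (A x)] [∀ x, Module ℝ (A x)] [FiberBundle F A] [VectorBundle ℝ F A]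

/-- The product of a smooth function with a smooth section. -/
noncomputable def smulSection (f : C^∞⟮𝓡 n, M; 𝓘(ℝ, ℝ), ℝ⟯) (X : Cₛ^∞⟮𝓡 n; F, A⟯) : Cₛ^∞⟮𝓡 n; F, A⟯ :=
  ⟨fun x => f x • X x, f.contMDiff.smul_section X.contMDiff⟩

variable (n F A) in
/-- A Lie algebroid structure on the smooth vector bundle `A → M` with typical fibre `F`. -/
structure LieAlgebroid where
  /-- the anchor `A → TM` -/
  anchor : ∀ x : M, A x →ₗ[ℝ] TangentSpace (𝓡 n) x
  contMDiff_anchor : ContMDiff ((𝓡 n).prod 𝓘(ℝ, F)) (𝓡 n).tangent ∞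
    (fun a : TotalSpace F A => (⟨a.proj, anchor a.proj a.2⟩ : TangentBundle (𝓡 n) M))
  /-- the bracket of smooth sections -/
  bracket : Cₛ^∞⟮𝓡 n; F, A⟯ →ₗ[ℝ] Cₛ^∞⟮𝓡 n; F, A⟯ →ₗ[ℝ] Cₛ^∞⟮𝓡 n; F, A⟯
  bracket_self : ∀ X, bracket X X = 0
  jacobi : ∀ X Y Z,
    bracket X (bracket Y Z) = bracket (bracket X Y) Z + bracket Y (bracket X Z)
  leibniz : ∀ (X Y : Cₛ^∞⟮𝓡 n; F, A⟯) (f : C^∞⟮𝓡 n, M; 𝓘(ℝ, ℝ), ℝ⟯) (x : M),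
    bracket X (smulSection f Y) x =
      f x • bracket X Y x + (show ℝ from mfderiv (𝓡 n) 𝓘(ℝ, ℝ) f x (anchor x (X x))) • Y x
  anchor_bracket : ∀ (X Y : Cₛ^∞⟮𝓡 n; F, A⟯) (x : M),
    anchor x (bracket X Y x) =
      mlieBracket (𝓡 n) (fun y => anchor y (X y)) (fun y => anchor y (Y y)) x

/-- The anchor is surjective. -/
def LieAlgebroid.IsTransitive (L : LieAlgebroid n F A) : Prop :=
  ∀ x, Function.Surjective (L.anchor x)

end LieAlgebroid

/-! ### Lie groupoids -/

section LieGroupoid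

variable {n k : ℕ} {M : Type uM} [TopologicalSpace M] [ChartedSpace (EuclideanSpace ℝ (Fin n)) M]
  [IsManifold (𝓡 n) ∞ M]
  {Γ : Type uΓ} [TopologicalSpace Γ] [ChartedSpace (EuclideanSpace ℝ (Fin k)) Γ]
  [IsManifold (𝓡 k) ∞ Γ]

variable (n k M Γ) in
/-- A Lie groupoid `Γ ⇉ M`. The product `mul g h` is only meaningful when `s g = t h`; its values on
other pairs are irrelevant. Smoothness of the product is smoothness on the submanifold of composable
pairs. -/
structure LieGroupoid where
  t2Space : T2Space Γ
  secondCountable : SecondCountableTopology Γ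
  /-- source -/
  s : Γ → M
  /-- target -/
  t : Γ → M
  /-- units -/
  one : M → Γ
  /-- inversion -/
  inv : Γ → Γ
  /-- multiplication -/
  mul : Γ → Γ → Γ
  s_one : ∀ x, s (one x) = x
  t_one : ∀ x, t (one x) = x
  s_inv : ∀ g, s (inv g) = t g
  t_inv : ∀ g, t (inv g) = s g
  s_mul : ∀ g h, s g = t h → s (mul g h) = s h
  t_mul : ∀ g h, s g = t h → t (mul g h) = t g
  mul_assoc : ∀ g h l, s g = t h → s h = t l → mul (mul g h) l = mul g (mul h l)
  one_mul : ∀ g, mul (one (t g)) g = g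
  mul_one : ∀ g, mul g (one (s g)) = g
  inv_mul : ∀ g, mul (inv g) g = one (s g)
  mul_inv : ∀ g, mul g (inv g) = one (t g)
  isSubmersion_s : IsSubmersion (𝓡 k) (𝓡 n) ∞ s
  isSubmersion_t : IsSubmersion (𝓡 k) (𝓡 n) ∞ t
  contMDiff_one : ContMDiff (𝓡 n) (𝓡 k) ∞ one
  contMDiff_inv : ContMDiff (𝓡 k) (𝓡 k) ∞ inv
  contMDiffOn_mul : ContMDiffOn ((𝓡 k).prod (𝓡 k)) (𝓡 k) ∞
    (fun q : Γ × Γ => mul q.1 q.2) {q | s q.1 = t q.2}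

namespace LieGroupoid

variable (𝒢 : LieGroupoid n k M Γ)

/-- The source fibre `s⁻¹(x)`, with the subspace topology. -/
def SourceFiber (x : M) : Type uΓ := {g : Γ // 𝒢.s g = x}

instance (x : M) : TopologicalSpace (𝒢.SourceFiber x) :=
  inferInstanceAs (TopologicalSpace {g : Γ // 𝒢.s g = x})

/-- The isotropy group `s⁻¹(x) ∩ t⁻¹(x)`, with the subspace topology. -/
def Isotropy (x : M) : Type uΓ := {g : Γ // 𝒢.s g = x ∧ 𝒢.t g = x}

instance (x : M) : TopologicalSpace (𝒢.Isotropy x) :=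
  inferInstanceAs (TopologicalSpace {g : Γ // 𝒢.s g = x ∧ 𝒢.t g = x})

/-- The group structure of the isotropy group, given by groupoid multiplication. -/
instance (x : M) : Group (𝒢.Isotropy x) where
  mul g h := ⟨𝒢.mul g.1 h.1, (𝒢.s_mul _ _ (g.2.1.trans h.2.2.symm)).trans h.2.1,
    (𝒢.t_mul _ _ (g.2.1.trans h.2.2.symm)).trans g.2.2⟩
  one := ⟨𝒢.one x, 𝒢.s_one x, 𝒢.t_one x⟩
  inv g := ⟨𝒢.inv g.1, (𝒢.s_inv _).trans g.2.2, (𝒢.t_inv _).trans g.2.1⟩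
  mul_assoc g h l := Subtype.ext
    (𝒢.mul_assoc _ _ _ (g.2.1.trans h.2.2.symm) (h.2.1.trans l.2.2.symm))
  one_mul g := Subtype.ext (by
    have h := 𝒢.one_mul g.1
    rw [g.2.2] at h
    exact h)
  mul_one g := Subtype.ext (by
    have h := 𝒢.mul_one g.1
    rw [g.2.1] at h
    exact h)
  inv_mul_cancel g := Subtype.ext (by
    have h := 𝒢.inv_mul g.1
    rw [g.2.1] at h
    exact h)

/-- Right multiplication `p ↦ p g` of the source fibre at `x` by an element of the isotropy group
at `x`. -/
def sourceFiberMul {x : M} (p : 𝒢.SourceFiber x) (g : 𝒢.Isotropy x) : 𝒢.SourceFiber x :=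
  ⟨𝒢.mul p.1 g.1, (𝒢.s_mul _ _ (p.2.trans g.2.2.symm)).trans g.2.1⟩

/-- All source fibres are (nonempty, path connected and) simply connected. -/
def IsSourceSimplyConnected : Prop := ∀ x, SimplyConnectedSpace (𝒢.SourceFiber x)

/-- The differential at the unit over `t g` of right translation `h ↦ h g`, which maps the source
fibre over `t g` to the one over `s g`. It is only meant for vectors tangent to the source fibre,
that is, in the kernel of `ds`; on these the derivative within the source fibre does not depend on
any choice. Its value lies in the tangent space at `1 g = g`. -/
noncomputable def rightTranslate (g : Γ) (v : TangentSpace (𝓡 k) (𝒢.one (𝒢.t g))) :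
    TangentSpace (𝓡 k) g :=
  mfderivWithin (𝓡 k) (𝓡 k) (fun h => 𝒢.mul h g) {h | 𝒢.s h = 𝒢.t g} (𝒢.one (𝒢.t g)) v

end LieGroupoid

variable {F : Type uF} [NormedAddCommGroup F] [NormedSpace ℝ F]
  {A : M → Type uA} [TopologicalSpace (TotalSpace F A)] [∀ x, TopologicalSpace (A x)]
  [∀ x, AddCommGroup (A x)] [∀ x, Module ℝ (A x)] [FiberBundle F A] [VectorBundle ℝ F A]

/-- An isomorphism of Lie algebroids from `A` to the Lie algebroid of `Γ`, that is, to the vector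
bundle with fibre `ker ds` at the unit over `x`, with anchor `dt`, and with the bracket for which
extension of sections to right-invariant vector fields on `Γ` (tangent to the source fibres)
respects brackets. -/
structure LieAlgebroid.IsoOfGroupoid (L : LieAlgebroid n F A) (𝒢 : LieGroupoid n k M Γ) where
  fiberEquiv : ∀ x, A x ≃ₗ[ℝ]
    LinearMap.ker (mfderiv (𝓡 k) (𝓡 n) 𝒢.s (𝒢.one x)).toLinearMap
  contMDiff_fiberEquiv : ContMDiff ((𝓡 n).prod 𝓘(ℝ, F)) (𝓡 k).tangent ∞
    (fun a : TotalSpace F A =>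
      (⟨𝒢.one a.proj, (fiberEquiv a.proj a.2).1⟩ : TangentBundle (𝓡 k) Γ))
  anchor_eq : ∀ (x : M) (a : A x),
    tangentMap (𝓡 k) (𝓡 n) 𝒢.t ⟨𝒢.one x, (fiberEquiv x a).1⟩ = ⟨x, L.anchor x a⟩
  bracket_eq : ∀ (X Y : Cₛ^∞⟮𝓡 n; F, A⟯) (g : Γ),
    𝒢.rightTranslate g (fiberEquiv (𝒢.t g) (L.bracket X Y (𝒢.t g))).1 =
      mlieBracket (𝓡 k) (fun h => 𝒢.rightTranslate h (fiberEquiv (𝒢.t h) (X (𝒢.t h))).1)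
        (fun h => 𝒢.rightTranslate h (fiberEquiv (𝒢.t h) (Y (𝒢.t h))).1) g

/-- `A` is (isomorphic to) the Lie algebroid of the Lie groupoid `Γ`. -/
def LieAlgebroid.IsAlgebroidOf (L : LieAlgebroid n F A) (𝒢 : LieGroupoid n k M Γ) : Prop :=
  Nonempty (L.IsoOfGroupoid 𝒢)

/-- `A` is integrable: it is the Lie algebroid of a source-simply-connected Lie groupoid. -/
def LieAlgebroid.IsIntegrable (L : LieAlgebroid n F A) : Prop :=
  ∃ (k : ℕ) (Γ : Type uΓ) (_ : TopologicalSpace Γ)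
    (_ : ChartedSpace (EuclideanSpace ℝ (Fin k)) Γ) (_ : IsManifold (𝓡 k) ∞ Γ)
    (𝒢 : LieGroupoid n k M Γ),
    𝒢.IsSourceSimplyConnected ∧ L.IsAlgebroidOf 𝒢

end LieGroupoid

/-! ### Principal bundles -/

section PrincipalBundle

variable {n p d : ℕ} {M : Type uM} [TopologicalSpace M]
  [ChartedSpace (EuclideanSpace ℝ (Fin n)) M]
  [IsManifold (𝓡 n) ∞ M]
  {P : Type uP} [TopologicalSpace P] [ChartedSpace (EuclideanSpace ℝ (Fin p)) P]
  [IsManifold (𝓡 p) ∞ P]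
  {G : Type uG} [TopologicalSpace G] [ChartedSpace (EuclideanSpace ℝ (Fin d)) G] [Group G]

variable (n p d M P G) in
/-- A smooth principal `G`-bundle `P → M`: a right action of the Lie group `G` on the manifold `P`
for which `P → M` is, locally over `M`, equivariantly diffeomorphic to `U × G → U`. -/
structure PrincipalBundle where
  t2Space : T2Space P
  secondCountable : SecondCountableTopology P
  lieGroup : LieGroup (𝓡 d) ∞ G
  /-- the projection -/
  proj : P → M
  /-- the right action -/
  act : P → G → P
  act_one : ∀ u, act u 1 = u
  act_mul : ∀ u g h, act u (g * h) = act (act u g) h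
  proj_act : ∀ u g, proj (act u g) = proj u
  contMDiff_proj : ContMDiff (𝓡 p) (𝓡 n) ∞ proj
  contMDiff_act : ContMDiff ((𝓡 p).prod (𝓡 d)) (𝓡 p) ∞ (fun q : P × G => act q.1 q.2)
  exists_localTriv : ∀ x : M, ∃ (U : Set M) (e : OpenPartialHomeomorph P (M × G)),
    IsOpen U ∧ x ∈ U ∧ e.source = proj ⁻¹' U ∧ e.target = U ×ˢ Set.univ ∧
    ContMDiffOn (𝓡 p) ((𝓡 n).prod (𝓡 d)) ∞ e e.source ∧
    ContMDiffOn ((𝓡 n).prod (𝓡 d)) (𝓡 p) ∞ e.symm e.target ∧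
    (∀ u ∈ e.source, (e u).1 = proj u) ∧
    (∀ u ∈ e.source, ∀ g, e (act u g) = ((e u).1, (e u).2 * g))

namespace PrincipalBundle

variable (B : PrincipalBundle n p d M P G)

/-- The total space `TP/G`: the orbits of the action of `G` on `TP` by the differentials of
`u ↦ u g`. -/
def TangentQuotient : Type uP :=
  Quot (fun v w : TangentBundle (𝓡 p) P =>
    ∃ g : G, w = tangentMap (𝓡 p) (𝓡 p) (fun u => B.act u g) v)

/-- The class in `TP/G` of a tangent vector of `P`. -/
def tangentMk (v : TangentBundle (𝓡 p) P) : B.TangentQuotient := Quot.mk _ v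

/-- The space of arrows `(P × P)/G` of the gauge groupoid, with the quotient topology. -/
def Gauge : Type uP :=
  Quot (fun a b : P × P => ∃ g : G, b = (B.act a.1 g, B.act a.2 g))

instance : TopologicalSpace B.Gauge :=
  inferInstanceAs (TopologicalSpace
    (Quot (fun a b : P × P => ∃ g : G, b = (B.act a.1 g, B.act a.2 g))))

/-- The class `[u, v]` in `(P × P)/G`. -/
def gaugeMk (a : P × P) : B.Gauge := Quot.mk _ a

/-- `𝒢` is the gauge groupoid of the principal bundle: its space of arrows is the quotient manifold
`(P × P)/G` (the smooth structure is the one for which `P × P → (P × P)/G` is a submersion), and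
`t [u, v] = π u`, `s [u, v] = π v`, `[u, v] [v, w] = [u, w]`. -/
structure IsGaugeGroupoid {k : ℕ} [ChartedSpace (EuclideanSpace ℝ (Fin k)) B.Gauge]
    [IsManifold (𝓡 k) ∞ B.Gauge]
    (𝒢 : LieGroupoid n k M B.Gauge) : Prop where
  isSubmersion_mk : IsSubmersion ((𝓡 p).prod (𝓡 p)) (𝓡 k) ∞ B.gaugeMk
  t_mk : ∀ u v, 𝒢.t (B.gaugeMk (u, v)) = B.proj u
  s_mk : ∀ u v, 𝒢.s (B.gaugeMk (u, v)) = B.proj v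
  mul_mk : ∀ u v w, 𝒢.mul (B.gaugeMk (u, v)) (B.gaugeMk (v, w)) = B.gaugeMk (u, w)

end PrincipalBundle

variable {F : Type uF} [NormedAddCommGroup F] [NormedSpace ℝ F]
  {A : M → Type uA} [TopologicalSpace (TotalSpace F A)] [∀ x, TopologicalSpace (A x)]
  [∀ x, AddCommGroup (A x)] [∀ x, Module ℝ (A x)] [FiberBundle F A] [VectorBundle ℝ F A]

/-- An isomorphism of Lie algebroids from the Atiyah algebroid `TP/G` to `A`. It is a bijection
`TP/G ≃ A` over `M` whose composition with `TP → TP/G` is smooth and restricts to linear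
isomorphisms of the fibres `T_u P → A_{π u}`, such that the anchor of `A` corresponds to `dπ` and the
bracket of sections of `A` corresponds to the Lie bracket of `G`-invariant vector fields on `P`; the
invariant vector field of a section `X` has the value `(fiberEquiv u)⁻¹ (X (π u))` at `u`. -/
structure LieAlgebroid.AtiyahIso (L : LieAlgebroid n F A) (B : PrincipalBundle n p d M P G) where
  toEquiv : B.TangentQuotient ≃ TotalSpace F A
  fiberEquiv : ∀ u : P, TangentSpace (𝓡 p) u ≃ₗ[ℝ] A (B.proj u)
  toEquiv_mk : ∀ (u : P) (v : TangentSpace (𝓡 p) u),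
    toEquiv (B.tangentMk ⟨u, v⟩) = ⟨B.proj u, fiberEquiv u v⟩
  contMDiff_toEquiv_mk : ContMDiff (𝓡 p).tangent ((𝓡 n).prod 𝓘(ℝ, F)) ∞
    (fun v : TangentBundle (𝓡 p) P => toEquiv (B.tangentMk v))
  anchor_eq : ∀ (u : P) (v : TangentSpace (𝓡 p) u),
    L.anchor (B.proj u) (fiberEquiv u v) = mfderiv (𝓡 p) (𝓡 n) B.proj u v
  bracket_eq : ∀ (X Y : Cₛ^∞⟮𝓡 n; F, A⟯) (u : P),
    (fiberEquiv u).symm (L.bracket X Y (B.proj u)) =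
      mlieBracket (𝓡 p) (fun w => (fiberEquiv w).symm (X (B.proj w)))
        (fun w => (fiberEquiv w).symm (Y (B.proj w))) u

/-- `A` is (isomorphic to) the Atiyah algebroid `TP/G` of the principal bundle `P → M`. -/
def LieAlgebroid.IsAtiyahAlgebroidOf (L : LieAlgebroid n F A)
    (B : PrincipalBundle n p d M P G) : Prop :=
  Nonempty (L.AtiyahIso B)

end PrincipalBundle

/-! Everything rests on right translation. In a Lie groupoid, `h ↦ h g` carries `ker ds` at the unit
over `t g` isomorphically onto `ker ds` at `g`. Along `P = s⁻¹(x)` this identifies `A` at `t u` with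
the tangent space of `P` at `u`, and the right-invariant field of a section restricts to a vector
field on `P` invariant under the isotropy group `G`.

If `A` is transitive, right translation spreads the surjectivity of the anchor from the units to all
arrows, so that `(s, t)` and the restriction of `t` to `P` are submersions. Hence `G` and `P` are
embedded and the orbits in `M` are open. The complement of an orbit is a union of orbits, so
connectedness of `M` leaves a single one and `t` maps `P` onto `M` (`IsTransitive.exists_t_eq`). A
local section `σ` of `t` on `P` gives the trivialization `u ↦ (t u, σ(t u)⁻¹ u)`. The fibres of `TP
→ A` are exactly the orbits of `G` (`tangentToAlgebroid_eq_iff`), and the brackets agree because the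
fields on `P` and on `Γ` are related by the inclusion (`mfderiv_mlieBracket_of_related`).

Conversely, a local section `σ` of `P → M` writes every arrow of the gauge groupoid with source `y`
in its domain uniquely as `[u, σ y]`. This gives charts with values in `M × P` and local sections of
`P × P → (P × P)/G`, through which all smoothness is checked. The map `w ↦ [w, v]` immerses `P` with
a source fibre as image, and `[z, w][w, v] = [z, v]` says that it carries the invariant fields on
`P` to right-invariant fields; so the gauge groupoid integrates `A` (`isoOfGauge`).

These source fibres are copies of `P`, which need not be simply connected. Therefore pairs of points
are replaced by homotopy classes of paths in `P`, modulo `G`, with concatenation as product. The end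
point map on path classes is a separated local homeomorphism. It descends to a local homeomorphism
and groupoid morphism to the gauge groupoid, along which the smooth structure and the Lie algebroid
are pulled back (`EtaleCover.lieGroupoid`, `isoOfEtaleCover`). Since `G` acts freely, prescribing
the starting point of a path selects one representative in each class: a source fibre is the space
of classes of paths from a fixed point of `P`, a universal cover of a component of `P`, and is
simply connected (`simplyConnectedSpace_startingAt`). -/

section LocalModels

open Set Filter Topology

/-! ### Local diffeomorphisms between manifolds. -/

section SmoothLocalEquiv

variable {E : Type*} [NormedAddCommGroup E] [NormedSpace ℝ E] {H : Type*} [TopologicalSpace H]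
  {I : ModelWithCorners ℝ E H} {M : Type*} [TopologicalSpace M] [ChartedSpace H M]
  {E' : Type*} [NormedAddCommGroup E'] [NormedSpace ℝ E'] {H' : Type*} [TopologicalSpace H']
  {J : ModelWithCorners ℝ E' H'} {N : Type*} [TopologicalSpace N] [ChartedSpace H' N]
  {E'' : Type*} [NormedAddCommGroup E''] [NormedSpace ℝ E''] {H'' : Type*} [TopologicalSpace H'']
  {K : ModelWithCorners ℝ E'' H''} {Q : Type*} [TopologicalSpace Q] [ChartedSpace H'' Q]

variable (I J) in
/-- A homeomorphism between open subsets that is smooth together with its inverse. -/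
def IsSmoothLocalEquiv (Φ : OpenPartialHomeomorph M N) : Prop :=
  ContMDiffOn I J ∞ Φ Φ.source ∧ ContMDiffOn J I ∞ Φ.symm Φ.target

namespace IsSmoothLocalEquiv

variable {Φ : OpenPartialHomeomorph M N} {Ψ : OpenPartialHomeomorph N Q}

theorem symm (h : IsSmoothLocalEquiv I J Φ) : IsSmoothLocalEquiv J I Φ.symm :=
  ⟨h.2, h.1⟩

theorem contMDiffAt (h : IsSmoothLocalEquiv I J Φ) {x : M} (hx : x ∈ Φ.source) :
    ContMDiffAt I J ∞ Φ x :=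
  h.1.contMDiffAt (Φ.open_source.mem_nhds hx)

theorem contMDiffAt_symm (h : IsSmoothLocalEquiv I J Φ) {y : N} (hy : y ∈ Φ.target) :
    ContMDiffAt J I ∞ Φ.symm y :=
  h.2.contMDiffAt (Φ.open_target.mem_nhds hy)

theorem trans (h : IsSmoothLocalEquiv I J Φ) (h' : IsSmoothLocalEquiv J K Ψ) :
    IsSmoothLocalEquiv I K (Φ ≫ₕ Ψ) := by
  refine ⟨fun x hx => ?_, fun x hx => ?_⟩
  · rw [OpenPartialHomeomorph.trans_source] at hx
    exact ((h'.contMDiffAt hx.2).comp x (h.contMDiffAt hx.1)).contMDiffWithinAt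
  · rw [OpenPartialHomeomorph.trans_target] at hx
    exact ((h.contMDiffAt_symm hx.2).comp x (h'.contMDiffAt_symm hx.1)).contMDiffWithinAt

theorem mem_maximalAtlas [IsManifold I ∞ M] {φ : OpenPartialHomeomorph M H}
    (h : IsSmoothLocalEquiv I I φ) : φ ∈ IsManifold.maximalAtlas I ∞ M :=
  φ.mem_maximalAtlas_of_contMDiffOn h.1 h.2

theorem of_mem_maximalAtlas {φ : OpenPartialHomeomorph M H}
    (h : φ ∈ IsManifold.maximalAtlas I ∞ M) : IsSmoothLocalEquiv I I φ :=
  ⟨contMDiffOn_of_mem_maximalAtlas h, contMDiffOn_symm_of_mem_maximalAtlas h⟩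

theorem mfderiv_symm_comp (h : IsSmoothLocalEquiv I J Φ) {x : M} (hx : x ∈ Φ.source)
    (v : TangentSpace I x) :
    mfderiv J I Φ.symm (Φ x) (mfderiv I J Φ x v) = v := by
  have h1 : MDifferentiableAt I J Φ x := (h.contMDiffAt hx).mdifferentiableAt (by simp)
  have h2 : MDifferentiableAt J I Φ.symm (Φ x) :=
    (h.contMDiffAt_symm (Φ.map_source hx)).mdifferentiableAt (by simp)
  have h3 := mfderiv_comp x h2 h1
  have h4 : Φ.symm ∘ Φ =ᶠ[𝓝 x] id := by
    filter_upwards [Φ.open_source.mem_nhds hx] with y hy using Φ.left_inv hy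
  rw [h4.mfderiv_eq, mfderiv_id] at h3
  exact (congrArg (fun (f : E →L[ℝ] E) => f v) h3).symm

theorem mfderiv_comp_symm (h : IsSmoothLocalEquiv I J Φ) {x : M} (hx : x ∈ Φ.source)
    (w : TangentSpace J (Φ x)) :
    mfderiv I J Φ x (mfderiv J I Φ.symm (Φ x) w) = w := by
  have h1 : MDifferentiableAt I J Φ (Φ.symm (Φ x)) := by
    rw [Φ.left_inv hx]; exact (h.contMDiffAt hx).mdifferentiableAt (by simp)
  have h2 : MDifferentiableAt J I Φ.symm (Φ x) :=
    (h.contMDiffAt_symm (Φ.map_source hx)).mdifferentiableAt (by simp)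
  have h3 := mfderiv_comp (Φ x) h1 h2
  have h4 : Φ ∘ Φ.symm =ᶠ[𝓝 (Φ x)] id := by
    filter_upwards [Φ.open_target.mem_nhds (Φ.map_source hx)] with y hy using Φ.right_inv hy
  rw [h4.mfderiv_eq, mfderiv_id, Φ.left_inv hx] at h3
  exact (congrArg (fun (f : E' →L[ℝ] E') => f w) h3).symm

end IsSmoothLocalEquiv

theorem ContinuousLinearEquiv.isSmoothLocalEquiv (L : E ≃L[ℝ] E') :
    IsSmoothLocalEquiv 𝓘(ℝ, E) 𝓘(ℝ, E') L.toHomeomorph.toOpenPartialHomeomorph :=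
  ⟨(L.contDiff.contMDiff).contMDiffOn, (L.symm.contDiff.contMDiff).contMDiffOn⟩

/-- Turns a chart of the base of a local product decomposition into a chart of the product with
values in the model space of the total space; the charts of submersions and of their fibres are
assembled from it. -/
theorem IsSmoothLocalEquiv.prodVector {d : OpenPartialHomeomorph N E'}
    (hd : IsSmoothLocalEquiv J 𝓘(ℝ, E') d) (L : (E' × E'') ≃L[ℝ] E) :
    IsSmoothLocalEquiv (J.prod 𝓘(ℝ, E'')) 𝓘(ℝ, E)
      (d.prod (OpenPartialHomeomorph.refl E'') ≫ₕ L.toHomeomorph.toOpenPartialHomeomorph) := by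
  refine ⟨fun x hx => ?_, fun e he => ?_⟩
  · have hx1 : x.1 ∈ d.source := by
      simp only [OpenPartialHomeomorph.trans_source] at hx
      exact hx.1.1
    have h1 : ContMDiffAt (J.prod 𝓘(ℝ, E'')) 𝓘(ℝ, E' × E'') ∞
        (fun q : N × E'' => (d q.1, q.2)) x :=
      ((hd.contMDiffAt hx1).comp x contMDiffAt_fst).prodMk_space contMDiffAt_snd
    exact (L.contDiff.contMDiff.contMDiffAt.comp x h1).contMDiffWithinAt
  · have he1 : (L.symm e).1 ∈ d.target := by
      simp only [OpenPartialHomeomorph.trans_target] at he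
      exact he.2.1
    have h1 : ContMDiffAt 𝓘(ℝ, E) 𝓘(ℝ, E') ∞ (fun e => (L.symm e).1) e :=
      (contDiff_fst.comp L.symm.contDiff).contMDiff.contMDiffAt
    have h2 : ContMDiffAt 𝓘(ℝ, E) 𝓘(ℝ, E'') ∞ (fun e => (L.symm e).2) e :=
      (contDiff_snd.comp L.symm.contDiff).contMDiff.contMDiffAt
    exact (((hd.contMDiffAt_symm he1).comp e h1).prodMk h2).contMDiffWithinAt

variable (I) in
/-- The preferred chart at a point, with values in the model vector space. -/
noncomputable def vectorChart [I.Boundaryless] (x : M) : OpenPartialHomeomorph M E :=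
  chartAt H x ≫ₕ I.toHomeomorph.toOpenPartialHomeomorph

theorem vectorChart_isSmoothLocalEquiv [I.Boundaryless] [IsManifold I ∞ M] (x : M) :
    IsSmoothLocalEquiv I 𝓘(ℝ, E) (vectorChart I x) := by
  refine (IsSmoothLocalEquiv.of_mem_maximalAtlas (IsManifold.chart_mem_maximalAtlas x)).trans
    ⟨I.contMDiff.contMDiffOn, ?_⟩
  refine I.contMDiffOn_symm.mono ?_
  rw [I.range_eq_univ]
  exact subset_univ _

theorem mem_vectorChart_source [I.Boundaryless] (x : M) : x ∈ (vectorChart I x).source := by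
  simp [vectorChart]

end SmoothLocalEquiv

/-! ### Manifold structures defined by local homeomorphisms to a given manifold. -/

section Atlas

variable {E : Type*} [NormedAddCommGroup E] [NormedSpace ℝ E] {H : Type*} [TopologicalSpace H]
  {J : ModelWithCorners ℝ E H} [J.Boundaryless] {N : Type*} [TopologicalSpace N] [ChartedSpace H N]
  [IsManifold J ∞ N]
  {E' : Type*} [NormedAddCommGroup E'] [NormedSpace ℝ E'] (L : E ≃L[ℝ] E')
  {X : Type*} [TopologicalSpace X] (Θ : X → OpenPartialHomeomorph X N)

variable (J) in
/-- The chart at `x` obtained from a local homeomorphism to a manifold. -/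
noncomputable def chartOfLocal (x : X) : OpenPartialHomeomorph X E' :=
  Θ x ≫ₕ vectorChart J (Θ x x) ≫ₕ L.toHomeomorph.toOpenPartialHomeomorph

variable (J) in
/-- The charted space structure given by local homeomorphisms to a manifold. -/
@[reducible] noncomputable def chartedSpaceOfLocal (hΘ : ∀ x, x ∈ (Θ x).source) :
    ChartedSpace E' X where
  atlas := range (chartOfLocal J L Θ)
  chartAt := chartOfLocal J L Θ
  mem_chart_source x := by
    simp only [chartOfLocal, OpenPartialHomeomorph.trans_source]
    exact ⟨hΘ x, mem_vectorChart_source _, trivial⟩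
  chart_mem_atlas x := mem_range_self x

variable {L Θ}

/-- The transition map is that of the local homeomorphisms `Θ`, conjugated by charts of `N`. -/
theorem chartOfLocal_contMDiffOn
    (h : ∀ x y, ContMDiffOn J J ∞ (Θ y ∘ (Θ x).symm) ((Θ x).symm ≫ₕ Θ y).source) (x y : X) :
    ContMDiffOn 𝓘(ℝ, E') 𝓘(ℝ, E') ∞ (chartOfLocal J L Θ y ∘ (chartOfLocal J L Θ x).symm)
      ((chartOfLocal J L Θ x).symm ≫ₕ chartOfLocal J L Θ y).source := by
  intro z hz
  set c := vectorChart J (Θ x x) ≫ₕ L.toHomeomorph.toOpenPartialHomeomorph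
  set d := vectorChart J (Θ y y) ≫ₕ L.toHomeomorph.toOpenPartialHomeomorph
  have hc : IsSmoothLocalEquiv J 𝓘(ℝ, E') c :=
    (vectorChart_isSmoothLocalEquiv _).trans L.isSmoothLocalEquiv
  have hd : IsSmoothLocalEquiv J 𝓘(ℝ, E') d :=
    (vectorChart_isSmoothLocalEquiv _).trans L.isSmoothLocalEquiv
  change z ∈ ((Θ x ≫ₕ c).symm ≫ₕ (Θ y ≫ₕ d)).source at hz
  simp only [OpenPartialHomeomorph.trans_source, OpenPartialHomeomorph.trans_symm_eq_symm_trans_symm,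
    OpenPartialHomeomorph.symm_source, mem_inter_iff, mem_preimage,
    OpenPartialHomeomorph.coe_trans, Function.comp_apply] at hz
  have h1 : ContMDiffAt J J ∞ (Θ y ∘ (Θ x).symm) (c.symm z) :=
    (h x y).contMDiffAt (((Θ x).symm ≫ₕ Θ y).open_source.mem_nhds (by
      simp only [OpenPartialHomeomorph.trans_source, OpenPartialHomeomorph.symm_source]
      exact ⟨hz.1.2, hz.2.1⟩))
  exact ((hd.contMDiffAt (x := (Θ y ∘ (Θ x).symm) (c.symm z)) hz.2.2).comp z
    (h1.comp z (hc.contMDiffAt_symm hz.1.1))).contMDiffWithinAt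

theorem isManifold_chartedSpaceOfLocal (hΘ : ∀ x, x ∈ (Θ x).source)
    (h : ∀ x y, ContMDiffOn J J ∞ (Θ y ∘ (Θ x).symm) ((Θ x).symm ≫ₕ Θ y).source) :
    letI := chartedSpaceOfLocal J L Θ hΘ
    IsManifold 𝓘(ℝ, E') ∞ X := by
  let _ := chartedSpaceOfLocal J L Θ hΘ
  apply isManifold_of_contDiffOn
  rintro _ _ ⟨x, rfl⟩ ⟨y, rfl⟩
  have := (chartOfLocal_contMDiffOn (L := L) h x y).contDiffOn
  simpa using this

/-- Near a point `z`, the map `Θ x` is the chart at `z`, followed by the inverse of a chart of `N`,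
followed by the smooth transition `Θ x ∘ (Θ z)⁻¹`. The inverse of `Θ x` is treated in the same way.
-/
theorem isSmoothLocalEquiv_chartedSpaceOfLocal (hΘ : ∀ x, x ∈ (Θ x).source)
    (h : ∀ x y, ContMDiffOn J J ∞ (Θ y ∘ (Θ x).symm) ((Θ x).symm ≫ₕ Θ y).source) (x : X) :
    letI := chartedSpaceOfLocal J L Θ hΘ
    IsSmoothLocalEquiv 𝓘(ℝ, E') J (Θ x) := by
  let _ := chartedSpaceOfLocal J L Θ hΘ
  have : IsManifold 𝓘(ℝ, E') ∞ X := isManifold_chartedSpaceOfLocal hΘ h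
  have key : ∀ z, ∃ c : OpenPartialHomeomorph N E', IsSmoothLocalEquiv J 𝓘(ℝ, E') c ∧
      IsSmoothLocalEquiv 𝓘(ℝ, E') 𝓘(ℝ, E') (Θ z ≫ₕ c) ∧ Θ z z ∈ c.source := fun z =>
    ⟨vectorChart J (Θ z z) ≫ₕ L.toHomeomorph.toOpenPartialHomeomorph,
      (vectorChart_isSmoothLocalEquiv _).trans L.isSmoothLocalEquiv,
      IsSmoothLocalEquiv.of_mem_maximalAtlas (IsManifold.chart_mem_maximalAtlas z), by
        simp only [OpenPartialHomeomorph.trans_source]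
        exact ⟨mem_vectorChart_source _, trivial⟩⟩
  refine ⟨fun z hz => ?_, fun w hw => ?_⟩
  · obtain ⟨c, hc, hc', hcz⟩ := key z
    have hzs : z ∈ (Θ z ≫ₕ c).source := by
      rw [OpenPartialHomeomorph.trans_source]; exact ⟨hΘ z, hcz⟩
    have h1 := hc'.contMDiffAt hzs
    have h2 := hc.contMDiffAt_symm (y := (Θ z ≫ₕ c) z) (c.map_source hcz)
    have h3 : ContMDiffAt J J ∞ (Θ x ∘ (Θ z).symm) (c.symm ((Θ z ≫ₕ c) z)) := by
      refine (h z x).contMDiffAt (((Θ z).symm ≫ₕ Θ x).open_source.mem_nhds ?_)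
      simp only [OpenPartialHomeomorph.trans_source, OpenPartialHomeomorph.symm_source,
        OpenPartialHomeomorph.coe_trans, Function.comp_apply, c.left_inv hcz, mem_inter_iff,
        mem_preimage, (Θ z).left_inv (hΘ z)]
      exact ⟨(Θ z).map_source (hΘ z), hz⟩
    refine ContMDiffAt.contMDiffWithinAt ((h3.comp z (h2.comp z h1)).congr_of_eventuallyEq ?_)
    filter_upwards [(Θ z ≫ₕ c).open_source.mem_nhds hzs] with y hy
    rw [OpenPartialHomeomorph.trans_source] at hy
    simp only [Function.comp_apply, OpenPartialHomeomorph.coe_trans]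
    rw [c.left_inv hy.2, (Θ z).left_inv hy.1]
  · set z := (Θ x).symm w
    have hz : z ∈ (Θ x).source := (Θ x).map_target hw
    obtain ⟨c, hc, hc', hcz⟩ := key z
    have hxw : Θ x z = w := (Θ x).right_inv hw
    have h3 : ContMDiffAt J J ∞ (Θ z ∘ (Θ x).symm) w := by
      refine (h x z).contMDiffAt (((Θ x).symm ≫ₕ Θ z).open_source.mem_nhds ?_)
      simp only [OpenPartialHomeomorph.trans_source, OpenPartialHomeomorph.symm_source]
      exact ⟨hw, hΘ z⟩
    have h4 := hc.contMDiffAt (x := (Θ z ∘ (Θ x).symm) w) hcz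
    have h5 := hc'.contMDiffAt_symm (y := c ((Θ z ∘ (Θ x).symm) w)) (by
      rw [OpenPartialHomeomorph.trans_target]
      refine ⟨c.map_source hcz, ?_⟩
      simp only [mem_preimage]
      rw [show c.symm (c ((Θ z ∘ (Θ x).symm) w)) = Θ z z from c.left_inv hcz]
      exact (Θ z).map_source (hΘ z))
    refine ContMDiffAt.contMDiffWithinAt ((h5.comp w (h4.comp w h3)).congr_of_eventuallyEq ?_)
    have hc1 : ContinuousAt (Θ x).symm w := (Θ x).continuousAt_symm hw
    have hc2 : ContinuousAt (Θ z ∘ (Θ x).symm) w := ((Θ z).continuousAt (hΘ z)).comp hc1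
    filter_upwards [hc1.preimage_mem_nhds ((Θ z).open_source.mem_nhds (hΘ z)),
      hc2.preimage_mem_nhds (c.open_source.mem_nhds hcz)] with y hy hy'
    simp only [Function.comp_apply, OpenPartialHomeomorph.trans_symm_eq_symm_trans_symm,
      OpenPartialHomeomorph.coe_trans]
    rw [show c.symm (c (Θ z ((Θ x).symm y))) = Θ z ((Θ x).symm y) from c.left_inv hy',
      (Θ z).left_inv hy]

end Atlas

end LocalModels

/-! ### Submersions: the inverse function theorem, product charts, and a criterion by local
sections. -/

section Submersions

open Set Filter Topology Module

set_option linter.unusedSectionVars false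

section InverseFunction

variable {E : Type*} [NormedAddCommGroup E] [NormedSpace ℝ E] {H : Type*} [TopologicalSpace H]
  {I : ModelWithCorners ℝ E H} {M : Type*} [TopologicalSpace M] [ChartedSpace H M]
  {E' : Type*} [NormedAddCommGroup E'] [NormedSpace ℝ E'] {H' : Type*} [TopologicalSpace H']
  {J : ModelWithCorners ℝ E' H'} {N : Type*} [TopologicalSpace N] [ChartedSpace H' N]

theorem exists_isSmoothLocalEquiv_of_hasFDerivAt [CompleteSpace E] {f : E → E'} {U : Set E}
    (hU : IsOpen U) (hf : ContDiffOn ℝ ∞ f U) {x : E} (hx : x ∈ U) {f' : E ≃L[ℝ] E'}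
    (hf' : HasFDerivAt f (f' : E →L[ℝ] E') x) :
    ∃ Φ : OpenPartialHomeomorph E E', x ∈ Φ.source ∧ Φ.source ⊆ U ∧ (∀ y, Φ y = f y) ∧
      IsSmoothLocalEquiv 𝓘(ℝ, E) 𝓘(ℝ, E') Φ := by
  have hfx : ContDiffAt ℝ ∞ f x := hf.contDiffAt (hU.mem_nhds hx)
  -- The inverse function theorem only makes the inverse smooth at the image of `x`. Shrinking to
  -- the open set where the derivative is invertible makes it smooth at every point of the target.
  have hW : IsOpen (U ∩ fderiv ℝ f ⁻¹' range ((↑) : (E ≃L[ℝ] E') → E →L[ℝ] E')) :=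
    (hf.continuousOn_fderiv_of_isOpen hU (by simp)).isOpen_inter_preimage hU
      (ContinuousLinearEquiv.isOpen)
  set Φ₀ := hfx.toOpenPartialHomeomorph f hf' (by simp)
  set W := U ∩ fderiv ℝ f ⁻¹' range ((↑) : (E ≃L[ℝ] E') → E →L[ℝ] E')
  have hsrc : (Φ₀.restr W).source = Φ₀.source ∩ W := Φ₀.restr_source' W hW
  refine ⟨Φ₀.restr W, ?_, ?_, fun y => rfl, ?_, ?_⟩
  · rw [hsrc]
    exact ⟨hfx.mem_toOpenPartialHomeomorph_source hf' (by simp), hx, f', hf'.fderiv.symm⟩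
  · rw [hsrc]; exact fun y hy => hy.2.1
  · rw [hsrc]
    exact (hf.mono fun y hy => hy.2.1).contMDiffOn
  · intro y hy
    have hy' := (Φ₀.restr W).map_target hy
    rw [hsrc] at hy'
    obtain ⟨f₁, hf₁⟩ := hy'.2.2
    refine ContMDiffAt.contMDiffWithinAt (ContDiffAt.contMDiffAt ?_)
    have hfy : ContDiffAt ℝ ∞ f ((Φ₀.restr W).symm y) := hf.contDiffAt (hU.mem_nhds hy'.2.1)
    refine (Φ₀.restr W).contDiffAt_symm hy (f₀' := f₁) ?_ hfy
    rw [hf₁]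
    exact (hfy.differentiableAt (by simp)).hasFDerivAt

/-- The vector space version, applied to `f` read in the charts at `x` and `f x`. -/
theorem exists_isSmoothLocalEquiv_of_bijective_mfderiv [CompleteSpace E] [CompleteSpace E']
    [I.Boundaryless] [J.Boundaryless] [IsManifold I ∞ M] [IsManifold J ∞ N] {f : M → N}
    {U : Set M} (hU : IsOpen U) (hf : ContMDiffOn I J ∞ f U) {x : M} (hx : x ∈ U)
    (hbij : Function.Bijective (mfderiv I J f x)) :
    ∃ Φ : OpenPartialHomeomorph M N, x ∈ Φ.source ∧ Φ.source ⊆ U ∧ EqOn Φ f Φ.source ∧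
      IsSmoothLocalEquiv I J Φ := by
  set c := vectorChart I x
  set d := vectorChart J (f x)
  have hc : IsSmoothLocalEquiv I 𝓘(ℝ, E) c := vectorChart_isSmoothLocalEquiv x
  have hd : IsSmoothLocalEquiv J 𝓘(ℝ, E') d := vectorChart_isSmoothLocalEquiv (f x)
  have hxc : x ∈ c.source := mem_vectorChart_source x
  have hxd : f x ∈ d.source := mem_vectorChart_source (f x)
  have hU' : IsOpen (U ∩ f ⁻¹' d.source) := hf.continuousOn.isOpen_inter_preimage hU d.open_source
  have hO : IsOpen (c.symm.source ∩ c.symm ⁻¹' (U ∩ f ⁻¹' d.source)) :=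
    c.symm.isOpen_inter_preimage hU'
  set O := c.symm.source ∩ c.symm ⁻¹' (U ∩ f ⁻¹' d.source)
  have hg : ContDiffOn ℝ ∞ (d ∘ f ∘ c.symm) O := by
    rw [← contMDiffOn_iff_contDiffOn]
    intro y hy
    have h1 := hc.contMDiffAt_symm hy.1
    have h2 : ContMDiffAt I J ∞ f (c.symm y) := hf.contMDiffAt (hU.mem_nhds hy.2.1)
    exact ((hd.contMDiffAt hy.2.2).comp y (h2.comp y h1)).contMDiffWithinAt
  have hxO : c x ∈ O := by
    refine ⟨c.map_source hxc, ?_, ?_⟩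
    · rwa [c.left_inv hxc]
    · change f (c.symm (c x)) ∈ d.source; rwa [c.left_inv hxc]
  have hder : HasMFDerivAt 𝓘(ℝ, E) 𝓘(ℝ, E') (d ∘ f ∘ c.symm) (c x)
      ((mfderiv J 𝓘(ℝ, E') d (f x)).comp ((mfderiv I J f x).comp
        (mfderiv 𝓘(ℝ, E) I c.symm (c x)))) := by
    have h1 : MDifferentiableAt 𝓘(ℝ, E) I c.symm (c x) :=
      (hc.contMDiffAt_symm (c.map_source hxc)).mdifferentiableAt (by simp)
    have h2 : MDifferentiableAt I J f (c.symm (c x)) := by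
      rw [c.left_inv hxc]
      exact (hf.contMDiffAt (hU.mem_nhds hx)).mdifferentiableAt (by simp)
    have h3 : MDifferentiableAt J 𝓘(ℝ, E') d (f (c.symm (c x))) := by
      rw [c.left_inv hxc]
      exact (hd.contMDiffAt hxd).mdifferentiableAt (by simp)
    have := h3.hasMFDerivAt.comp (c x) (h2.hasMFDerivAt.comp (c x) h1.hasMFDerivAt)
    rwa [c.left_inv hxc] at this
  set D : E →L[ℝ] E' := ((mfderiv J 𝓘(ℝ, E') d (f x)).comp ((mfderiv I J f x).comp
        (mfderiv 𝓘(ℝ, E) I c.symm (c x))))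
  have hbc : Function.Bijective (mfderiv 𝓘(ℝ, E) I c.symm (c x)) := by
    refine ⟨Function.LeftInverse.injective (g := mfderiv I 𝓘(ℝ, E) c x) fun w =>
      hc.mfderiv_comp_symm hxc w, Function.RightInverse.surjective
      (g := mfderiv I 𝓘(ℝ, E) c x) fun v => hc.mfderiv_symm_comp hxc v⟩
  have hbd : Function.Bijective (mfderiv J 𝓘(ℝ, E') d (f x)) := by
    refine ⟨Function.LeftInverse.injective (g := mfderiv 𝓘(ℝ, E') J d.symm (d (f x))) fun w =>
      hd.mfderiv_symm_comp hxd w, Function.RightInverse.surjective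
      (g := mfderiv 𝓘(ℝ, E') J d.symm (d (f x))) fun v => hd.mfderiv_comp_symm hxd v⟩
  have hD : Function.Bijective D := hbd.comp (hbij.comp hbc)
  obtain ⟨Ψ, h1, h2, h3, h4⟩ := exists_isSmoothLocalEquiv_of_hasFDerivAt hO hg hxO
    (f' := ContinuousLinearEquiv.ofBijective D (LinearMap.ker_eq_bot.2 hD.1)
      (LinearMap.range_eq_top.2 hD.2)) (by
        rw [ContinuousLinearEquiv.coe_ofBijective]
        exact hder.hasFDerivAt)
  have hsrc : ∀ y ∈ (c ≫ₕ Ψ ≫ₕ d.symm).source, y ∈ c.source ∧ c y ∈ O := fun y hy => by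
    simp only [OpenPartialHomeomorph.trans_source] at hy
    exact ⟨hy.1, h2 hy.2.1⟩
  refine ⟨c ≫ₕ Ψ ≫ₕ d.symm, ?_, ?_, ?_, hc.trans (h4.trans hd.symm)⟩
  · simp only [OpenPartialHomeomorph.trans_source]
    refine ⟨hxc, h1, ?_⟩
    simp only [mem_preimage, h3, Function.comp_apply, c.left_inv hxc]
    exact d.map_source hxd
  · intro y hy
    have := (hsrc y hy).2.2.1
    rwa [c.left_inv (hsrc y hy).1] at this
  · intro y hy
    have := (hsrc y hy).2.2.2
    simp only [mem_preimage, c.left_inv (hsrc y hy).1] at this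
    simp only [OpenPartialHomeomorph.coe_trans, Function.comp_apply, h3, c.left_inv (hsrc y hy).1]
    exact d.left_inv this

end InverseFunction

section Submersion

variable {E : Type*} [NormedAddCommGroup E] [NormedSpace ℝ E] [FiniteDimensional ℝ E]
  {H : Type*} [TopologicalSpace H]
  {I : ModelWithCorners ℝ E H} [I.Boundaryless] {M : Type*} [TopologicalSpace M]
  [ChartedSpace H M] [IsManifold I ∞ M]
  {E' : Type*} [NormedAddCommGroup E'] [NormedSpace ℝ E'] [FiniteDimensional ℝ E']
  {H' : Type*} [TopologicalSpace H']
  {J : ModelWithCorners ℝ E' H'} [J.Boundaryless] {N : Type*} [TopologicalSpace N]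
  [ChartedSpace H' N] [IsManifold J ∞ N]

variable (I J) in
/-- A local product decomposition exhibiting `f` as a projection near `x`. -/
structure SubmersionChart (f : M → N) (x : M) where
  /-- the local diffeomorphism to the product -/
  toProd : OpenPartialHomeomorph M (N × EuclideanSpace ℝ (Fin (finrank ℝ E - finrank ℝ E')))
  mem_source : x ∈ toProd.source
  fst_eq : ∀ m ∈ toProd.source, (toProd m).1 = f m
  smooth : IsSmoothLocalEquiv I
    (J.prod 𝓘(ℝ, EuclideanSpace ℝ (Fin (finrank ℝ E - finrank ℝ E')))) toProd
  le : finrank ℝ E' ≤ finrank ℝ E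

/-- The normal form of a submersion lives in charts of both manifolds. Undoing the chart of `N` on
the first factor leaves a decomposition over `N` itself; by a dimension count the abstract
complement may be taken to be a Euclidean space. -/
theorem Manifold.IsSubmersionAt.nonempty_submersionChart {f : M → N} {x : M}
    (hf : IsSubmersionAt I J ∞ f x) : Nonempty (SubmersionChart I J f x) := by
  let A := hf.equiv
  have : FiniteDimensional ℝ hf.complement :=
    FiniteDimensional.of_injective ((A.symm : E' × hf.complement →ₗ[ℝ] E) ∘ₗ LinearMap.inr ℝ _ _)
      (A.symm.injective.comp (Prod.mk_right_injective 0))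
  have hd : finrank ℝ E = finrank ℝ E' + finrank ℝ hf.complement := by
    rw [A.toLinearEquiv.finrank_eq, finrank_prod]
  let B : hf.complement ≃L[ℝ] EuclideanSpace ℝ (Fin (finrank ℝ E - finrank ℝ E')) :=
    ContinuousLinearEquiv.ofFinrankEq (by simp [hd])
  let c : OpenPartialHomeomorph M E := hf.domChart ≫ₕ I.toHomeomorph.toOpenPartialHomeomorph
  let d : OpenPartialHomeomorph N E' := hf.codChart ≫ₕ J.toHomeomorph.toOpenPartialHomeomorph
  have hc : IsSmoothLocalEquiv I 𝓘(ℝ, E) c :=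
    (IsSmoothLocalEquiv.of_mem_maximalAtlas hf.domChart_mem_maximalAtlas).trans
      ⟨I.contMDiff.contMDiffOn, I.contMDiffOn_symm.mono (by rw [I.range_eq_univ]; simp)⟩
  have hd' : IsSmoothLocalEquiv J 𝓘(ℝ, E') d :=
    (IsSmoothLocalEquiv.of_mem_maximalAtlas hf.codChart_mem_maximalAtlas).trans
      ⟨J.contMDiff.contMDiffOn, J.contMDiffOn_symm.mono (by rw [J.range_eq_univ]; simp)⟩
  let L : (E' × EuclideanSpace ℝ (Fin (finrank ℝ E - finrank ℝ E'))) ≃L[ℝ] E :=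
    (A.trans ((ContinuousLinearEquiv.refl ℝ E').prodCongr B)).symm
  have hL := hd'.prodVector L
  have key : ∀ m ∈ hf.domChart.source, (A (c m)).1 = d (f m) := fun m hm => by
    have h1 := hf.writtenInCharts (hf.domChart.extend I |>.map_source (x := m) (by simpa using hm))
    rw [Function.comp_apply, Function.comp_apply,
      (hf.domChart.extend I).left_inv (by simpa using hm)] at h1
    exact h1.symm
  have hcs : ∀ m, m ∈ c.source ↔ m ∈ hf.domChart.source := fun m => by simp [c]
  have hds : ∀ m, m ∈ d.source ↔ m ∈ hf.codChart.source := fun m => by simp [d]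
  refine ⟨⟨c ≫ₕ (d.prod (OpenPartialHomeomorph.refl _) ≫ₕ
    L.toHomeomorph.toOpenPartialHomeomorph).symm, ?_, ?_, hc.trans hL.symm, by omega⟩⟩
  · simp only [OpenPartialHomeomorph.trans_source]
    refine ⟨(hcs x).2 hf.mem_domChart_source, trivial, ?_⟩
    refine ⟨?_, trivial⟩
    change (A (c x)).1 ∈ d.target
    rw [key x hf.mem_domChart_source]
    exact d.map_source ((hds _).2 hf.mem_codChart_source)
  · intro m hm
    simp only [OpenPartialHomeomorph.trans_source] at hm
    have hm' := (hcs m).1 hm.1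
    change d.symm (A (c m)).1 = f m
    rw [key m hm']
    exact d.left_inv ((hds _).2 (hf.source_subset_preimage_source hm'))

theorem SubmersionChart.isSubmersionAtOfComplement {f : M → N} {x : M}
    (S : SubmersionChart I J f x) :
    IsSubmersionAtOfComplement (EuclideanSpace ℝ (Fin (finrank ℝ E - finrank ℝ E'))) I J ∞ f x := by
  let L : (E' × EuclideanSpace ℝ (Fin (finrank ℝ E - finrank ℝ E'))) ≃L[ℝ] E :=
    ContinuousLinearEquiv.ofFinrankEq (by have := S.le; simp; omega)
  let d := vectorChart J (f x)
  have hd : IsSmoothLocalEquiv J 𝓘(ℝ, E') d := vectorChart_isSmoothLocalEquiv (f x)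
  have hL := hd.prodVector L
  have hI : IsSmoothLocalEquiv 𝓘(ℝ, E) I I.toHomeomorph.toOpenPartialHomeomorph.symm :=
    IsSmoothLocalEquiv.symm ⟨I.contMDiff.contMDiffOn,
      I.contMDiffOn_symm.mono (by rw [I.range_eq_univ]; simp)⟩
  let c : OpenPartialHomeomorph M H := S.toProd ≫ₕ (d.prod (OpenPartialHomeomorph.refl _) ≫ₕ
    L.toHomeomorph.toOpenPartialHomeomorph) ≫ₕ I.toHomeomorph.toOpenPartialHomeomorph.symm
  have hc : IsSmoothLocalEquiv I I c := S.smooth.trans (hL.trans hI)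
  have hcs : ∀ m ∈ c.source, m ∈ S.toProd.source ∧ f m ∈ d.source := fun m hm => by
    simp only [c, OpenPartialHomeomorph.trans_source] at hm
    refine ⟨hm.1, ?_⟩
    rw [← S.fst_eq m hm.1]
    exact hm.2.1.1.1
  refine IsSubmersionAtOfComplement.mk_of_charts L.symm c (chartAt H' (f x)) ?_
    (mem_chart_source H' (f x)) hc.mem_maximalAtlas (IsManifold.chart_mem_maximalAtlas _) ?_ ?_
  · simp only [c, OpenPartialHomeomorph.trans_source]
    refine ⟨S.mem_source, ⟨⟨?_, trivial⟩, trivial⟩, trivial⟩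
    rw [S.fst_eq x S.mem_source]
    exact mem_vectorChart_source _
  · intro m hm
    have := (hcs m hm).2
    simpa [d, vectorChart] using this
  · intro e he
    set m := (c.extend I).symm e with hm
    have hms : m ∈ c.source := by
      have := (c.extend I).map_target he
      rwa [c.extend_source] at this
    have hem : c.extend I m = e := (c.extend I).right_inv he
    have h1 : c.extend I m = L (d (S.toProd m).1, (S.toProd m).2) := by
      change I (I.symm _) = _
      rw [I.right_inv (by rw [I.range_eq_univ]; trivial)]
      rfl
    rw [h1, S.fst_eq m (hcs m hms).1] at hem
    simp only [Function.comp_apply, ← hm]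
    rw [← hem, L.symm_apply_apply]
    rfl

theorem SubmersionChart.surjective_mfderiv {f : M → N} {x : M} (S : SubmersionChart I J f x) :
    Function.Surjective (mfderiv I J f x) := by
  intro w
  set K := 𝓘(ℝ, EuclideanSpace ℝ (Fin (finrank ℝ E - finrank ℝ E')))
  have h1 : f =ᶠ[𝓝 x] Prod.fst ∘ S.toProd := by
    filter_upwards [S.toProd.open_source.mem_nhds S.mem_source] with y hy using (S.fst_eq y hy).symm
  have h2 : MDifferentiableAt I (J.prod K) S.toProd x :=
    (S.smooth.contMDiffAt S.mem_source).mdifferentiableAt (by simp)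
  have h3 := S.smooth.mfderiv_comp_symm S.mem_source
    ((w, (0 : EuclideanSpace ℝ (Fin (finrank ℝ E - finrank ℝ E')))) :
      E' × EuclideanSpace ℝ (Fin (finrank ℝ E - finrank ℝ E')))
  refine ⟨mfderiv (J.prod K) I S.toProd.symm (S.toProd x)
    ((w, (0 : EuclideanSpace ℝ (Fin (finrank ℝ E - finrank ℝ E')))) :
      E' × EuclideanSpace ℝ (Fin (finrank ℝ E - finrank ℝ E'))), ?_⟩
  rw [h1.mfderiv_eq, mfderiv_comp x mdifferentiableAt_fst h2, mfderiv_fst]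
  exact congrArg Prod.fst h3

theorem Manifold.IsSubmersionAt.surjective_mfderiv {f : M → N} {x : M}
    (hf : IsSubmersionAt I J ∞ f x) : Function.Surjective (mfderiv I J f x) :=
  hf.nonempty_submersionChart.some.surjective_mfderiv

/-- `B` is a linear projection onto `ker T` in coordinates: a vector killed by `T` and by `B` lies
in `ker T` and is its own projection, hence zero. Injectivity suffices by dimension. -/
theorem exists_complement_of_surjective (T : E →L[ℝ] E') (hT : Function.Surjective T) :
    finrank ℝ E' ≤ finrank ℝ E ∧
    ∃ B : E →L[ℝ] EuclideanSpace ℝ (Fin (finrank ℝ E - finrank ℝ E')),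
      Function.Bijective (T.prod B) := by
  have h1 : finrank ℝ E = finrank ℝ E' + finrank ℝ (LinearMap.ker T.toLinearMap) := by
    have := LinearMap.finrank_range_add_finrank_ker T.toLinearMap
    rw [LinearMap.range_eq_top.2 hT, finrank_top] at this
    exact this.symm
  have : FiniteDimensional ℝ E' := FiniteDimensional.of_surjective T.toLinearMap hT
  obtain ⟨q, hq⟩ := LinearMap.exists_leftInverse_of_injective
    (LinearMap.ker T.toLinearMap).subtype (Submodule.ker_subtype _)
  let e : LinearMap.ker T.toLinearMap ≃ₗ[ℝ] EuclideanSpace ℝ (Fin (finrank ℝ E - finrank ℝ E')) :=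
    LinearEquiv.ofFinrankEq _ _ (by simp [h1])
  refine ⟨by omega, LinearMap.toContinuousLinearMap (e.toLinearMap ∘ₗ q), ?_⟩
  have hinj : Function.Injective (T.prod (LinearMap.toContinuousLinearMap (e.toLinearMap ∘ₗ q))) := by
    rw [injective_iff_map_eq_zero]
    intro v hv
    have hv1 : T v = 0 := congrArg Prod.fst hv
    have hv2 : e (q v) = 0 := congrArg Prod.snd hv
    have hv3 : q v = 0 := by simpa using hv2
    have h4 := LinearMap.congr_fun hq ⟨v, hv1⟩
    have h5 : q v = ⟨v, hv1⟩ := h4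
    rw [hv3] at h5
    exact (congrArg Subtype.val h5).symm
  exact ⟨hinj, (LinearMap.injective_iff_surjective_of_finrank_eq_finrank
    (f := (T.prod (LinearMap.toContinuousLinearMap (e.toLinearMap ∘ₗ q))).toLinearMap)
    (by simp; omega)).1 hinj⟩

/-- Complete `f` by a linear function of a chart that is injective on the kernel of the
differential; the pair has bijective differential, and the inverse function theorem applies. -/
theorem nonempty_submersionChart_of_surjective_mfderiv {f : M → N} {U : Set M} (hU : IsOpen U)
    (hf : ContMDiffOn I J ∞ f U) {x : M} (hx : x ∈ U)
    (hs : Function.Surjective (mfderiv I J f x)) : Nonempty (SubmersionChart I J f x) := by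
  obtain ⟨hle, B, hB⟩ := exists_complement_of_surjective (E := E) (E' := E') (mfderiv I J f x) hs
  set K := 𝓘(ℝ, EuclideanSpace ℝ (Fin (finrank ℝ E - finrank ℝ E')))
  set c := vectorChart I x
  have hc : IsSmoothLocalEquiv I 𝓘(ℝ, E) c := vectorChart_isSmoothLocalEquiv x
  have hxc : x ∈ c.source := mem_vectorChart_source x
  -- Corrected by the differential of the inverse chart, so that `B' ∘ c` has differential exactly
  -- `B` at `x`.
  let B' : E →L[ℝ] EuclideanSpace ℝ (Fin (finrank ℝ E - finrank ℝ E')) :=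
    B.comp (mfderiv 𝓘(ℝ, E) I c.symm (c x))
  have hB' : ContMDiffOn I K ∞ (fun m => B' (c m)) c.source :=
    B'.contMDiff.comp_contMDiffOn hc.1
  have hh : ContMDiffOn I (J.prod K) ∞ (fun m => (f m, B' (c m))) (U ∩ c.source) :=
    (hf.mono inter_subset_left).prodMk (hB'.mono inter_subset_right)
  have hfx : MDifferentiableAt I J f x :=
    (hf.contMDiffAt (hU.mem_nhds hx)).mdifferentiableAt (by simp)
  have hcx : MDifferentiableAt I 𝓘(ℝ, E) c x := (hc.contMDiffAt hxc).mdifferentiableAt (by simp)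
  have hBx : HasMFDerivAt I K (fun m => B' (c m)) x (B'.comp (mfderiv I 𝓘(ℝ, E) c x)) :=
    (B'.hasMFDerivAt (x := c x)).comp x hcx.hasMFDerivAt
  have hBeq : B'.comp (mfderiv I 𝓘(ℝ, E) c x) = B := by
    ext1 v
    exact congrArg B (hc.mfderiv_symm_comp hxc v)
  have hder := hfx.hasMFDerivAt.prodMk hBx
  obtain ⟨Φ, h1, h2, h3, h4⟩ := exists_isSmoothLocalEquiv_of_bijective_mfderiv
    (J := J.prod K) (hU.inter c.open_source) hh ⟨hx, hxc⟩ (by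
      rw [hder.mfderiv, hBeq]
      exact hB)
  exact ⟨⟨Φ, h1, fun m hm => by rw [h3 hm], h4, hle⟩⟩

theorem isSubmersion_of_surjective_mfderiv {f : M → N} (hf : ContMDiff I J ∞ f)
    (hs : ∀ x, Function.Surjective (mfderiv I J f x)) : IsSubmersion I J ∞ f :=
  IsSubmersionOfComplement.isSubmersion fun x =>
    (nonempty_submersionChart_of_surjective_mfderiv isOpen_univ hf.contMDiffOn (mem_univ x)
      (hs x)).some.isSubmersionAtOfComplement

theorem surjective_mfderiv_of_section {f : M → N} {x : M} (hf : MDifferentiableAt I J f x)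
    {σ : N → M} (hσ : MDifferentiableAt J I σ (f x)) (hx : σ (f x) = x)
    (h : ∀ᶠ y in 𝓝 (f x), f (σ y) = y) : Function.Surjective (mfderiv I J f x) := by
  intro w
  refine ⟨mfderiv J I σ (f x) w, ?_⟩
  have h1 : MDifferentiableAt I J f (σ (f x)) := by rwa [hx]
  have h2 := mfderiv_comp (f x) h1 hσ
  have h3 : f ∘ σ =ᶠ[𝓝 (f x)] id := h
  rw [h3.mfderiv_eq, mfderiv_id, hx] at h2
  exact (congrArg (fun (T : E' →L[ℝ] E') => T w) h2).symm

/-- The chain rule makes the differential of a section through `x` a right inverse of that of `f`.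
The structure maps of the gauge groupoid are recognised as submersions in this way. -/
theorem isSubmersion_of_sections {f : M → N} (hf : ContMDiff I J ∞ f)
    (h : ∀ x, ∃ σ : N → M, MDifferentiableAt J I σ (f x) ∧ σ (f x) = x ∧
      ∀ᶠ y in 𝓝 (f x), f (σ y) = y) : IsSubmersion I J ∞ f :=
  isSubmersion_of_surjective_mfderiv hf fun x => by
    obtain ⟨σ, h1, h2, h3⟩ := h x
    exact surjective_mfderiv_of_section ((hf x).mdifferentiableAt (by simp)) h1 h2 h3

end Submersion

end Submersions

/-! ### Fibres of submersions as embedded submanifolds. -/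

section Fibers

open Set Filter Topology Module

set_option linter.unusedSectionVars false

section Immersion

variable {E : Type*} [NormedAddCommGroup E] [NormedSpace ℝ E] {H : Type*} [TopologicalSpace H]
  {I : ModelWithCorners ℝ E H} [I.Boundaryless] {X : Type*} [TopologicalSpace X] [ChartedSpace H X]
  {E' : Type*} [NormedAddCommGroup E'] [NormedSpace ℝ E'] {H' : Type*} [TopologicalSpace H']
  {J : ModelWithCorners ℝ E' H'} [J.Boundaryless] {M : Type*} [TopologicalSpace M]
  [ChartedSpace H' M]
  {E'' : Type*} [NormedAddCommGroup E''] [NormedSpace ℝ E''] {H'' : Type*} [TopologicalSpace H'']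
  {K : ModelWithCorners ℝ E'' H''} {Z : Type*} [TopologicalSpace Z] [ChartedSpace H'' Z]

/-- In suitable charts the immersion is `v ↦ (v, 0)`, and the projection to the first factor is a
left inverse. -/
theorem Manifold.IsImmersionAt.exists_retraction {ι : X → M} {x : X} (h : IsImmersionAt I J ∞ ι x) :
    ∃ ρ : M → X, ContMDiffAt J I ∞ ρ (ι x) ∧ ∀ᶠ x' in 𝓝 x, ρ (ι x') = x' := by
  let c : OpenPartialHomeomorph X E := h.domChart ≫ₕ I.toHomeomorph.toOpenPartialHomeomorph
  let d : OpenPartialHomeomorph M E' := h.codChart ≫ₕ J.toHomeomorph.toOpenPartialHomeomorph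
  have hc : IsSmoothLocalEquiv I 𝓘(ℝ, E) c :=
    (IsSmoothLocalEquiv.of_mem_maximalAtlas h.domChart_mem_maximalAtlas).trans
      ⟨I.contMDiff.contMDiffOn, I.contMDiffOn_symm.mono (by rw [I.range_eq_univ]; simp)⟩
  have hd : IsSmoothLocalEquiv J 𝓘(ℝ, E') d :=
    (IsSmoothLocalEquiv.of_mem_maximalAtlas h.codChart_mem_maximalAtlas).trans
      ⟨J.contMDiff.contMDiffOn, J.contMDiffOn_symm.mono (by rw [J.range_eq_univ]; simp)⟩
  have hcs : ∀ m, m ∈ c.source ↔ m ∈ h.domChart.source := fun m => by simp [c]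
  have hds : ∀ m, m ∈ d.source ↔ m ∈ h.codChart.source := fun m => by simp [d]
  have key : ∀ m ∈ h.domChart.source, d (ι m) = h.equiv (c m, 0) := fun m hm => by
    have h1 := h.writtenInCharts (h.domChart.extend I |>.map_source (x := m) (by simpa using hm))
    rw [Function.comp_apply, Function.comp_apply,
      (h.domChart.extend I).left_inv (by simpa using hm)] at h1
    exact h1
  have hmem := h.mem_domChart_source
  have hx : x ∈ c.source := (hcs x).2 hmem
  have heq : ∀ m ∈ h.domChart.source, (h.equiv.symm (d (ι m))).1 = c m := fun m hm => by
    rw [key m hm, ContinuousLinearEquiv.symm_apply_apply]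
  refine ⟨fun m => c.symm (h.equiv.symm (d m)).1, ?_, ?_⟩
  · have h1 : ContMDiffAt 𝓘(ℝ, E') 𝓘(ℝ, E) ∞ (fun e => (h.equiv.symm e).1) (d (ι x)) :=
      (contDiff_fst.comp h.equiv.symm.contDiff).contMDiff.contMDiffAt
    have h2 := h1.comp (ι x) (hd.contMDiffAt ((hds _).2 h.mem_codChart_source))
    refine ContMDiffAt.comp (ι x) (g := c.symm) (f := fun m => (h.equiv.symm (d m)).1) ?_ h2
    rw [heq x hmem]
    exact hc.contMDiffAt_symm (c.map_source hx)
  · filter_upwards [h.domChart.open_source.mem_nhds hmem] with m hm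
    rw [heq m hm]
    exact c.left_inv ((hcs m).2 hm)

theorem Manifold.IsImmersionAt.injective_mfderiv {ι : X → M} {x : X}
    (h : IsImmersionAt I J ∞ ι x) : Function.Injective (mfderiv I J ι x) := by
  obtain ⟨ρ, h1, h2⟩ := h.exists_retraction
  have h3 : MDifferentiableAt I J ι x := h.contMDiffAt.mdifferentiableAt (by simp)
  have h4 := mfderiv_comp x (h1.mdifferentiableAt (by simp)) h3
  have h5 : ρ ∘ ι =ᶠ[𝓝 x] id := h2
  have h6 : ρ (ι x) = x := h2.self_of_nhds
  rw [h5.mfderiv_eq, mfderiv_id] at h4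
  exact Function.LeftInverse.injective (g := mfderiv J I ρ (ι x)) fun v =>
    (congrArg (fun (T : E →L[ℝ] E) => T v) h4).symm

/-- The topological embedding makes `f` continuous, so that near `z` it takes values where a local
retraction `ρ` is a left inverse of `ι`; there `f = ρ ∘ ι ∘ f`. -/
theorem Manifold.IsSmoothEmbedding.contMDiffAt_of_comp {ι : X → M} (h : IsSmoothEmbedding I J ∞ ι)
    {f : Z → X} {z : Z} (hf : ContMDiffAt K J ∞ (fun z => ι (f z)) z) : ContMDiffAt K I ∞ f z := by
  have hcont : ContinuousAt f z := (h.isEmbedding.continuousAt_iff).2 hf.continuousAt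
  obtain ⟨ρ, h1, h2⟩ := (h.isImmersion.isImmersionAt (f z)).exists_retraction
  refine (ContMDiffAt.comp z (g := ρ) (f := fun z => ι (f z)) h1 hf).congr_of_eventuallyEq ?_
  filter_upwards [hcont.eventually h2] with w hw
  exact hw.symm

theorem Manifold.IsSmoothEmbedding.contMDiff_of_comp {ι : X → M} (h : IsSmoothEmbedding I J ∞ ι)
    {f : Z → X} (hf : ContMDiff K J ∞ (fun z => ι (f z))) : ContMDiff K I ∞ f :=
  fun z => h.contMDiffAt_of_comp (hf z)

end Immersion

section Fiber

variable {E : Type*} [NormedAddCommGroup E] [NormedSpace ℝ E] [FiniteDimensional ℝ E]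
  {H : Type*} [TopologicalSpace H]
  {I : ModelWithCorners ℝ E H} [I.Boundaryless] {M : Type*} [TopologicalSpace M]
  [ChartedSpace H M] [IsManifold I ∞ M]
  {E' : Type*} [NormedAddCommGroup E'] [NormedSpace ℝ E'] [FiniteDimensional ℝ E']
  {H' : Type*} [TopologicalSpace H']
  {J : ModelWithCorners ℝ E' H'} [J.Boundaryless] {N : Type*} [TopologicalSpace N]
  [ChartedSpace H' N] [IsManifold J ∞ N]
  {X : Type*} [TopologicalSpace X] {ι : X → M} {f : M → N} {y : N}

/-- The chart of the fibre of a submersion induced by a local product decomposition. -/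
noncomputable def fiberChart (hι : IsEmbedding ι) (hr : range ι = f ⁻¹' {y}) (x : X)
    (S : SubmersionChart I J f (ι x)) :
    OpenPartialHomeomorph X (EuclideanSpace ℝ (Fin (finrank ℝ E - finrank ℝ E'))) :=
  haveI : Nonempty X := ⟨x⟩
  have hinv : ∀ c, (y, c) ∈ S.toProd.target →
      ι (Function.invFun ι (S.toProd.symm (y, c))) = S.toProd.symm (y, c) := fun c hc =>
    Function.invFun_eq (show S.toProd.symm (y, c) ∈ range ι by
      rw [hr, mem_preimage, ← S.fst_eq _ (S.toProd.map_target hc), S.toProd.right_inv hc]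
      rfl)
  have hfst : ∀ x', ι x' ∈ S.toProd.source → S.toProd (ι x') = (y, (S.toProd (ι x')).2) :=
    fun x' hx' => Prod.ext ((S.fst_eq _ hx').trans
      (show ι x' ∈ f ⁻¹' {y} from hr ▸ mem_range_self x')) rfl
  { toFun := fun x' => (S.toProd (ι x')).2
    invFun := fun c => Function.invFun ι (S.toProd.symm (y, c))
    source := ι ⁻¹' S.toProd.source
    target := {c | (y, c) ∈ S.toProd.target}
    map_source' := fun x' hx' => by
      have := S.toProd.map_source hx'
      rw [hfst x' hx'] at this
      exact this
    map_target' := fun c hc => by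
      simp only [mem_preimage, hinv c hc]
      exact S.toProd.map_target hc
    left_inv' := fun x' hx' => by
      rw [← hfst x' hx', S.toProd.left_inv hx', Function.leftInverse_invFun hι.injective]
    right_inv' := fun c hc => by
      rw [hinv c hc, S.toProd.right_inv hc]
    open_source := S.toProd.open_source.preimage hι.continuous
    open_target := S.toProd.open_target.preimage (Continuous.prodMk_right y)
    continuousOn_toFun := (continuous_snd.comp_continuousOn S.toProd.continuousOn).comp
      hι.continuous.continuousOn fun _ h => h
    continuousOn_invFun := by
      rw [hι.isInducing.continuousOn_iff]
      refine ContinuousOn.congr (f := fun c => S.toProd.symm (y, c)) ?_ fun c hc => hinv c hc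
      exact S.toProd.continuousOn_symm.comp (Continuous.prodMk_right y).continuousOn fun _ h => h }

theorem fiberChart_symm_comp (hι : IsEmbedding ι) (hr : range ι = f ⁻¹' {y}) (x : X)
    (S : SubmersionChart I J f (ι x)) {c : EuclideanSpace ℝ (Fin (finrank ℝ E - finrank ℝ E'))}
    (hc : c ∈ (fiberChart hι hr x S).target) :
    ι ((fiberChart hι hr x S).symm c) = S.toProd.symm (y, c) :=
  haveI : Nonempty X := ⟨x⟩
  Function.invFun_eq (show S.toProd.symm (y, c) ∈ range ι by
      rw [hr, mem_preimage, ← S.fst_eq _ (S.toProd.map_target hc), S.toProd.right_inv hc]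
      rfl)

variable (hι : IsEmbedding ι) (hr : range ι = f ⁻¹' {y})
  (S : ∀ x : X, SubmersionChart I J f (ι x))

/-- On the slice over `y`, a transition map is the second component of the transition between the
two product decompositions, restricted to `{y}` times the model space. -/
theorem fiberChart_compatible (x x' : X) :
    ContMDiffOn 𝓘(ℝ, EuclideanSpace ℝ (Fin (finrank ℝ E - finrank ℝ E')))
      𝓘(ℝ, EuclideanSpace ℝ (Fin (finrank ℝ E - finrank ℝ E'))) ∞
      (fiberChart hι hr x' (S x') ∘ (fiberChart hι hr x (S x)).symm)
      ((fiberChart hι hr x (S x)).symm ≫ₕ fiberChart hι hr x' (S x')).source := by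
  have key : ∀ c ∈ ((fiberChart hι hr x (S x)).symm ≫ₕ fiberChart hι hr x' (S x')).source,
      c ∈ (fiberChart hι hr x (S x)).target ∧ (S x).toProd.symm (y, c) ∈ (S x').toProd.source :=
    fun c hc => by
      simp only [OpenPartialHomeomorph.trans_source, OpenPartialHomeomorph.symm_source] at hc
      refine ⟨hc.1, ?_⟩
      rw [← fiberChart_symm_comp hι hr x (S x) hc.1]
      exact hc.2
  have h : ContMDiffOn 𝓘(ℝ, EuclideanSpace ℝ (Fin (finrank ℝ E - finrank ℝ E')))
      𝓘(ℝ, EuclideanSpace ℝ (Fin (finrank ℝ E - finrank ℝ E'))) ∞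
      (fun c => ((S x').toProd ((S x).toProd.symm (y, c))).2)
      ((fiberChart hι hr x (S x)).symm ≫ₕ fiberChart hι hr x' (S x')).source := by
    intro c hc
    obtain ⟨h1, h2⟩ := key c hc
    have h3 : ContMDiffAt 𝓘(ℝ, EuclideanSpace ℝ (Fin (finrank ℝ E - finrank ℝ E')))
        (J.prod 𝓘(ℝ, EuclideanSpace ℝ (Fin (finrank ℝ E - finrank ℝ E')))) ∞ (fun c => (y, c)) c :=
      contMDiffAt_const.prodMk contMDiffAt_id
    have h4 := ((S x).smooth.contMDiffAt_symm h1).comp c h3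
    exact (contMDiffAt_snd.comp c (((S x').smooth.contMDiffAt h2).comp c h4)).contMDiffWithinAt
  refine h.congr fun c hc => ?_
  change ((S x').toProd (ι ((fiberChart hι hr x (S x)).symm c))).2 = _
  rw [fiberChart_symm_comp hι hr x (S x) (key c hc).1]

theorem mem_fiberChart_source (x : X) : x ∈ (fiberChart hι hr x (S x)).source :=
  (S x).mem_source

/-- The charted space structure on a fibre of a submersion. -/
@[reducible] noncomputable def fiberChartedSpace :
    ChartedSpace (EuclideanSpace ℝ (Fin (finrank ℝ E - finrank ℝ E'))) X :=
  chartedSpaceOfLocal 𝓘(ℝ, EuclideanSpace ℝ (Fin (finrank ℝ E - finrank ℝ E')))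
    (ContinuousLinearEquiv.refl ℝ _) (fun x => fiberChart hι hr x (S x))
    (mem_fiberChart_source hι hr S)

theorem fiber_isManifold :
    letI := fiberChartedSpace hι hr S
    IsManifold 𝓘(ℝ, EuclideanSpace ℝ (Fin (finrank ℝ E - finrank ℝ E'))) ∞ X :=
  isManifold_chartedSpaceOfLocal _ (fiberChart_compatible hι hr S)

theorem fiber_isSmoothEmbedding :
    letI := fiberChartedSpace hι hr S
    IsSmoothEmbedding 𝓘(ℝ, EuclideanSpace ℝ (Fin (finrank ℝ E - finrank ℝ E'))) I ∞ ι := by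
  let _ := fiberChartedSpace hι hr S
  have hX := fiber_isManifold hι hr S
  refine ⟨IsImmersionOfComplement.isImmersion (F := E') fun x => ?_, hι⟩
  let L : (E' × EuclideanSpace ℝ (Fin (finrank ℝ E - finrank ℝ E'))) ≃L[ℝ] E :=
    ContinuousLinearEquiv.ofFinrankEq (by have := (S x).le; simp; omega)
  have hy : f (ι x) = y := show ι x ∈ f ⁻¹' {y} from hr ▸ mem_range_self x
  let d₀ := vectorChart J y
  -- The normal form of an immersion is `e ↦ (e, 0)`, so the chart of `N` is translated to vanish at
  -- `y`.
  let τ : OpenPartialHomeomorph E' E' :=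
    (Homeomorph.addRight (-(d₀ y))).toOpenPartialHomeomorph
  have hτ : IsSmoothLocalEquiv 𝓘(ℝ, E') 𝓘(ℝ, E') τ :=
    ⟨(contDiff_id.add contDiff_const).contMDiff.contMDiffOn,
      (contDiff_id.add contDiff_const).contMDiff.contMDiffOn⟩
  let d := d₀ ≫ₕ τ
  have hd : IsSmoothLocalEquiv J 𝓘(ℝ, E') d := (vectorChart_isSmoothLocalEquiv y).trans hτ
  have hdy : d y = 0 := by
    change d₀ y + -(d₀ y) = 0
    simp
  have hys : y ∈ d.source := ⟨mem_vectorChart_source y, trivial⟩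
  have hL := hd.prodVector L
  have hI : IsSmoothLocalEquiv 𝓘(ℝ, E) I I.toHomeomorph.toOpenPartialHomeomorph.symm :=
    IsSmoothLocalEquiv.symm ⟨I.contMDiff.contMDiffOn,
      I.contMDiffOn_symm.mono (by rw [I.range_eq_univ]; simp)⟩
  let c : OpenPartialHomeomorph M H := (S x).toProd ≫ₕ (d.prod (OpenPartialHomeomorph.refl _) ≫ₕ
    L.toHomeomorph.toOpenPartialHomeomorph) ≫ₕ I.toHomeomorph.toOpenPartialHomeomorph.symm
  have hc : IsSmoothLocalEquiv I I c := (S x).smooth.trans (hL.trans hI)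
  have hφ := isSmoothLocalEquiv_chartedSpaceOfLocal (L := ContinuousLinearEquiv.refl ℝ _)
    (mem_fiberChart_source hι hr S) (fiberChart_compatible hι hr S) x
  have hfst : ∀ m : X, ι m ∈ (S x).toProd.source → ((S x).toProd (ι m)).1 = y := fun m hm =>
    ((S x).fst_eq _ hm).trans (show ι m ∈ f ⁻¹' {y} from hr ▸ mem_range_self m)
  have hcs : ∀ m : X, ι m ∈ (S x).toProd.source → ι m ∈ c.source := fun m hm => by
    simp only [c, OpenPartialHomeomorph.trans_source]
    refine ⟨hm, ⟨⟨?_, trivial⟩, trivial⟩, trivial⟩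
    rw [hfst m hm]
    exact hys
  refine IsImmersionAtOfComplement.mk_of_charts
    ((ContinuousLinearEquiv.prodComm ℝ _ _).trans L) (fiberChart hι hr x (S x)) c
    (mem_fiberChart_source hι hr S x) (hcs x (S x).mem_source) hφ.mem_maximalAtlas
    hc.mem_maximalAtlas (fun m hm => hcs m hm) ?_
  intro e he
  set m := ((fiberChart hι hr x (S x)).extend
    𝓘(ℝ, EuclideanSpace ℝ (Fin (finrank ℝ E - finrank ℝ E')))).symm e with hm
  have hms : ι m ∈ (S x).toProd.source := by
    have := ((fiberChart hι hr x (S x)).extend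
      𝓘(ℝ, EuclideanSpace ℝ (Fin (finrank ℝ E - finrank ℝ E')))).map_target he
    rwa [OpenPartialHomeomorph.extend_source] at this
  have hem : ((S x).toProd (ι m)).2 = e := ((fiberChart hι hr x (S x)).extend
      𝓘(ℝ, EuclideanSpace ℝ (Fin (finrank ℝ E - finrank ℝ E')))).right_inv he
  have h1 : c.extend I (ι m) = L (d ((S x).toProd (ι m)).1, ((S x).toProd (ι m)).2) := by
    change I (I.symm _) = _
    rw [I.right_inv (by rw [I.range_eq_univ]; trivial)]
    rfl
  simp only [Function.comp_apply, ← hm]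
  rw [h1, hfst m hms, hdy, hem]
  rfl

end Fiber

section FiberTangent

variable {E : Type*} [NormedAddCommGroup E] [NormedSpace ℝ E] [FiniteDimensional ℝ E]
  {H : Type*} [TopologicalSpace H]
  {I : ModelWithCorners ℝ E H} [I.Boundaryless] {X : Type*} [TopologicalSpace X] [ChartedSpace H X]
  {E' : Type*} [NormedAddCommGroup E'] [NormedSpace ℝ E'] [FiniteDimensional ℝ E']
  {H' : Type*} [TopologicalSpace H']
  {J : ModelWithCorners ℝ E' H'} [J.Boundaryless] {M : Type*} [TopologicalSpace M]
  [ChartedSpace H' M]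
  {E'' : Type*} [NormedAddCommGroup E''] [NormedSpace ℝ E''] {H'' : Type*} [TopologicalSpace H'']
  {K : ModelWithCorners ℝ E'' H''} {N : Type*} [TopologicalSpace N] [ChartedSpace H'' N]

/-- The tangent space of a fibre of a submersion is the kernel of the differential. -/
theorem range_mfderiv_eq_ker {ι : X → M} {f : M → N} {x : X} (hι : IsImmersionAt I J ∞ ι x)
    (hf : MDifferentiableAt J K f (ι x)) (hs : Function.Surjective (mfderiv J K f (ι x)))
    {y : N} (hfι : ∀ x, f (ι x) = y) (hd : finrank ℝ E' = finrank ℝ E + finrank ℝ E'') :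
    LinearMap.range (mfderiv I J ι x).toLinearMap =
      LinearMap.ker (mfderiv J K f (ι x)).toLinearMap := by
  have hι' : MDifferentiableAt I J ι x := hι.contMDiffAt.mdifferentiableAt (by simp)
  let A : E →ₗ[ℝ] E' := (mfderiv I J ι x).toLinearMap
  let B : E' →ₗ[ℝ] E'' := (mfderiv J K f (ι x)).toLinearMap
  have hle : LinearMap.range A ≤ LinearMap.ker B := by
    rintro _ ⟨v, rfl⟩
    have h1 := mfderiv_comp x hf hι'
    have h2 : f ∘ ι = fun _ => y := funext hfι
    rw [h2, mfderiv_const] at h1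
    exact (congrArg (fun (T : E →L[ℝ] E'') => T v) h1).symm
  have h1 := LinearMap.finrank_range_add_finrank_ker B
  rw [show LinearMap.range B = ⊤ from LinearMap.range_eq_top.2 hs, finrank_top] at h1
  have h2 : finrank ℝ (LinearMap.range A) = finrank ℝ E :=
    LinearMap.finrank_range_of_inj hι.injective_mfderiv
  change LinearMap.range A = LinearMap.ker B
  exact Submodule.eq_of_le_of_finrank_eq hle (by omega)

end FiberTangent

end Fibers

/-! ### Brackets of related vector fields; smoothness through injective bundle maps. -/

section VectorFieldsAndBundles

open Set Filter Topology Module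

set_option linter.unusedSectionVars false

section Related

variable {E : Type*} [NormedAddCommGroup E] [NormedSpace ℝ E] [CompleteSpace E]
  {H : Type*} [TopologicalSpace H]
  {I : ModelWithCorners ℝ E H} [I.Boundaryless] {M : Type*} [TopologicalSpace M]
  [ChartedSpace H M] [IsManifold I ∞ M]
  {E' : Type*} [NormedAddCommGroup E'] [NormedSpace ℝ E'] [CompleteSpace E']
  {H' : Type*} [TopologicalSpace H']
  {J : ModelWithCorners ℝ E' H'} [J.Boundaryless] {N : Type*} [TopologicalSpace N]
  [ChartedSpace H' N] [IsManifold J ∞ N]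

/-- By symmetry of the second derivative, `Df [V, W]` is obtained by differentiating `Df W` along
`V` and `Df V` along `W` and subtracting. Near `x` these two functions are `W' ∘ f` and `V' ∘ f`,
and the chain rule gives the bracket of `V'` and `W'`. -/
theorem fderiv_lieBracket_of_related {f : E → E'} {x : E} (hf : ContDiffAt ℝ ∞ f x) {V W : E → E}
    {V' W' : E' → E'} (hV : DifferentiableAt ℝ V x) (hW : DifferentiableAt ℝ W x)
    (hV' : DifferentiableAt ℝ V' (f x)) (hW' : DifferentiableAt ℝ W' (f x))
    (hVV' : ∀ᶠ y in 𝓝 x, fderiv ℝ f y (V y) = V' (f y))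
    (hWW' : ∀ᶠ y in 𝓝 x, fderiv ℝ f y (W y) = W' (f y)) :
    fderiv ℝ f x (lieBracket ℝ V W x) = lieBracket ℝ V' W' (f x) := by
  have hfx : DifferentiableAt ℝ f x := hf.differentiableAt (by simp)
  have h1 : (fun y => fderiv ℝ f y (V y)) =ᶠ[𝓝 x] V' ∘ f := hVV'
  have h2 : (fun y => fderiv ℝ f y (W y)) =ᶠ[𝓝 x] W' ∘ f := hWW'
  rw [fderiv_apply_lieBracket hf (by simpa using WithTop.coe_le_coe.2 (le_top (a := (2 : ℕ∞)))) hW hV, h1.fderiv_eq, h2.fderiv_eq,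
    fderiv_comp x hV' hfx, fderiv_comp x hW' hfx]
  simp only [ContinuousLinearMap.comp_apply, lieBracket, hVV'.self_of_nhds, hWW'.self_of_nhds]

/-- The expression of a vector field in the chart at `x`. -/
noncomputable def chartField (V : ∀ x : M, TangentSpace I x) (x : M) : E → E :=
  mpullback 𝓘(ℝ, E) I (vectorChart I x).symm V

theorem mfderiv_mlieBracket_chart (V W : ∀ x : M, TangentSpace I x) (x : M) :
    mfderiv I 𝓘(ℝ, E) (vectorChart I x) x (mlieBracket I V W x) =
      (lieBracket ℝ (chartField V x : E → E) (chartField W x : E → E) (vectorChart I x x) : E) := by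
  have h : mlieBracket I V W x = (mfderiv I 𝓘(ℝ, E) (vectorChart I x) x).inverse
      (lieBracket ℝ (chartField V x : E → E) (chartField W x : E → E) (vectorChart I x x) : E) := by
    rw [← mlieBracketWithin_univ, mlieBracketWithin_apply, I.range_eq_univ, preimage_univ,
      inter_univ, mpullbackWithin_univ, mpullbackWithin_univ]
    have h0 : lieBracketWithin ℝ (chartField V x : E → E) (chartField W x : E → E) univ =
      lieBracket ℝ (chartField V x : E → E) (chartField W x : E → E) := lieBracketWithin_univ
    rw [← h0]
    rfl
  have hinv : (mfderiv I 𝓘(ℝ, E) (vectorChart I x) x).IsInvertible :=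
    isInvertible_mfderiv_extChartAt (mem_extChartAt_source x)
  rw [h]
  exact hinv.self_apply_inverse _

theorem mfderiv_vectorChart_symm_chartField (V : ∀ x : M, TangentSpace I x) (x : M) {y : M}
    (hy : y ∈ (vectorChart I x).source) :
    mfderiv 𝓘(ℝ, E) I (vectorChart I x).symm (vectorChart I x y)
      (chartField V x (vectorChart I x y) : E) = V y := by
  have hc : IsSmoothLocalEquiv I 𝓘(ℝ, E) (vectorChart I x) := vectorChart_isSmoothLocalEquiv x
  have hinv : (mfderiv 𝓘(ℝ, E) I (vectorChart I x).symm (vectorChart I x y)).IsInvertible := by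
    refine ⟨ContinuousLinearEquiv.equivOfInverse
      (mfderiv 𝓘(ℝ, E) I (vectorChart I x).symm (vectorChart I x y))
      (mfderiv I 𝓘(ℝ, E) (vectorChart I x) ((vectorChart I x).symm (vectorChart I x y)))
      (fun w => ?_) (fun v => ?_), rfl⟩
    · rw [(vectorChart I x).left_inv hy]
      exact hc.mfderiv_comp_symm hy w
    · have h := hc.mfderiv_symm_comp ((vectorChart I x).map_target
        ((vectorChart I x).map_source hy)) v
      rwa [(vectorChart I x).right_inv ((vectorChart I x).map_source hy)] at h
  have h : chartField V x (vectorChart I x y) =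
      (mfderiv 𝓘(ℝ, E) I (vectorChart I x).symm (vectorChart I x y)).inverse
        (V ((vectorChart I x).symm (vectorChart I x y))) := rfl
  have h2 := hinv.self_apply_inverse (V ((vectorChart I x).symm (vectorChart I x y)))
  rw [← h] at h2
  rw [(vectorChart I x).left_inv hy] at h2
  exact h2

theorem differentiableAt_chartField {V : ∀ x : M, TangentSpace I x} {x : M}
    (hV : MDifferentiableAt I I.tangent (fun y => (⟨y, V y⟩ : TangentBundle I M)) x) :
    DifferentiableAt ℝ (chartField V x) (vectorChart I x x) := by
  rw [← mdifferentiableWithinAt_univ] at hV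
  have h := hV.differentiableWithinAt_mpullbackWithin_vectorField
  rw [I.range_eq_univ, preimage_univ, inter_univ, mpullbackWithin_univ] at h
  have h2 : DifferentiableWithinAt ℝ (chartField V x) univ (vectorChart I x x) := h
  exact differentiableWithinAt_univ.1 h2

/-- The brackets of `f`-related vector fields are `f`-related. -/
theorem mfderiv_mlieBracket_of_related {f : M → N} {x : M} (hf : ContMDiffAt I J ∞ f x)
    {V W : ∀ x : M, TangentSpace I x} {V' W' : ∀ y : N, TangentSpace J y}
    (hV : MDifferentiableAt I I.tangent (fun y => (⟨y, V y⟩ : TangentBundle I M)) x)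
    (hW : MDifferentiableAt I I.tangent (fun y => (⟨y, W y⟩ : TangentBundle I M)) x)
    (hV' : MDifferentiableAt J J.tangent (fun y => (⟨y, V' y⟩ : TangentBundle J N)) (f x))
    (hW' : MDifferentiableAt J J.tangent (fun y => (⟨y, W' y⟩ : TangentBundle J N)) (f x))
    (hVV' : ∀ᶠ y in 𝓝 x, mfderiv I J f y (V y) = V' (f y))
    (hWW' : ∀ᶠ y in 𝓝 x, mfderiv I J f y (W y) = W' (f y)) :
    mfderiv I J f x (mlieBracket I V W x) = mlieBracket J V' W' (f x) := by
  set c := vectorChart I x with hcdef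
  set d := vectorChart J (f x) with hddef
  have hc : IsSmoothLocalEquiv I 𝓘(ℝ, E) c := vectorChart_isSmoothLocalEquiv x
  have hd : IsSmoothLocalEquiv J 𝓘(ℝ, E') d := vectorChart_isSmoothLocalEquiv (f x)
  have hxc : x ∈ c.source := mem_vectorChart_source x
  have hxd : f x ∈ d.source := mem_vectorChart_source (f x)
  have hcx : c.symm (c x) = x := c.left_inv hxc
  have hfe : ∀ᶠ y in 𝓝 x, MDifferentiableAt I J f y := by
    obtain ⟨u, hu, hfu⟩ := (contMDiffAt_iff_contMDiffOn_nhds (n := 1) (by simp)).1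
      (hf.of_le (by simp))
    filter_upwards [eventually_mem_nhds_iff.2 hu] with y hy
    exact (hfu.contMDiffAt hy).mdifferentiableAt (by simp)
  have hg : ContDiffAt ℝ ∞ (d ∘ f ∘ c.symm) (c x) := by
    rw [← contMDiffAt_iff_contDiffAt]
    have h1 := hc.contMDiffAt_symm (c.map_source hxc)
    have h2 : ContMDiffAt I J ∞ f (c.symm (c x)) := by rwa [hcx]
    have h3 : ContMDiffAt J 𝓘(ℝ, E') ∞ d (f (c.symm (c x))) := by
      rw [hcx]; exact hd.contMDiffAt hxd
    exact h3.comp (c x) (h2.comp (c x) h1)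
  have hder : ∀ y ∈ c.source, f y ∈ d.source → MDifferentiableAt I J f y → ∀ w : E,
      fderiv ℝ (d ∘ f ∘ c.symm) (c y) w = mfderiv J 𝓘(ℝ, E') d (f y)
        (mfderiv I J f y (mfderiv 𝓘(ℝ, E) I c.symm (c y) w)) := by
    intro y hy hfy hfdy w
    have h1 : MDifferentiableAt 𝓘(ℝ, E) I c.symm (c y) :=
      (hc.contMDiffAt_symm (c.map_source hy)).mdifferentiableAt (by simp)
    have h2 : MDifferentiableAt I J f (c.symm (c y)) := by rwa [c.left_inv hy]
    have h3 : MDifferentiableAt J 𝓘(ℝ, E') d (f (c.symm (c y))) := by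
      rw [c.left_inv hy]
      exact (hd.contMDiffAt hfy).mdifferentiableAt (by simp)
    have := h3.hasMFDerivAt.comp (c y) (h2.hasMFDerivAt.comp (c y) h1.hasMFDerivAt)
    rw [c.left_inv hy] at this
    exact DFunLike.congr_fun (mfderiv_eq_fderiv.symm.trans this.mfderiv) w
  have hfc : ContinuousAt f x := hf.continuousAt
  -- Relatedness under `f` passes to the coordinate expressions, which reduces the claim to vector
  -- spaces.
  have hrel : ∀ (U : ∀ x : M, TangentSpace I x) (U' : ∀ y : N, TangentSpace J y),
      (∀ᶠ y in 𝓝 x, mfderiv I J f y (U y) = U' (f y)) →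
      ∀ᶠ e in 𝓝 (c x), fderiv ℝ (d ∘ f ∘ c.symm) e (chartField U x e) =
        chartField U' (f x) ((d ∘ f ∘ c.symm) e) := by
    intro U U' hUU'
    have h1 : ∀ᶠ y in 𝓝 x, y ∈ c.source ∧ f y ∈ d.source ∧ MDifferentiableAt I J f y ∧
        mfderiv I J f y (U y) = U' (f y) :=
      (c.open_source.eventually_mem hxc).and
        ((hfc.eventually (d.open_source.eventually_mem hxd)).and (hfe.and hUU'))
    have h2 : Tendsto c.symm (𝓝 (c x)) (𝓝 x) := by
      have := c.continuousAt_symm (c.map_source hxc)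
      rwa [ContinuousAt, hcx] at this
    filter_upwards [h2.eventually h1, c.open_target.mem_nhds (c.map_source hxc)] with e he het
    obtain ⟨y, hy, rfl⟩ : ∃ y ∈ c.source, c y = e := ⟨c.symm e, c.map_target het, c.right_inv het⟩
    rw [c.left_inv hy] at he
    rw [hder y hy he.2.1 he.2.2.1, mfderiv_vectorChart_symm_chartField U x hy, he.2.2.2]
    simp only [Function.comp_apply, c.left_inv hy]
    have h3 := mfderiv_vectorChart_symm_chartField U' (f x) he.2.1
    have h4 := hd.mfderiv_comp_symm he.2.1 (chartField U' (f x) (d (f y)) : E')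
    rw [← hddef] at h3
    rw [h3] at h4
    exact h4
  have hgx : (d ∘ f ∘ c.symm) (c x) = d (f x) := by simp [hcx]
  have hV2 := differentiableAt_chartField hV'
  have hW2 := differentiableAt_chartField hW'
  rw [← hddef, ← hgx] at hV2 hW2
  have key := fderiv_lieBracket_of_related hg (differentiableAt_chartField hV)
    (differentiableAt_chartField hW) hV2 hW2 (hrel V V' hVV') (hrel W W' hWW')
  have hb := mfderiv_mlieBracket_chart V W x
  have hb' := mfderiv_mlieBracket_chart V' W' (f x)
  rw [← hddef] at hb'
  rw [← hcdef] at hb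
  rw [hgx, ← hb', hder x hxc hxd hfe.self_of_nhds, ← hb] at key
  have h5 : mfderiv 𝓘(ℝ, E) I c.symm (c x) (mfderiv I 𝓘(ℝ, E) c x (mlieBracket I V W x)) =
    mlieBracket I V W x := hc.mfderiv_symm_comp hxc _
  rw [h5] at key
  have := congrArg (mfderiv 𝓘(ℝ, E') J d.symm (d (f x))) key
  have h6 := hd.mfderiv_symm_comp hxd (mfderiv I J f x (mlieBracket I V W x))
  have h7 := hd.mfderiv_symm_comp hxd (mlieBracket J V' W' (f x))
  exact h6.symm.trans (this.trans h7)

end Related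

section BundleMap

variable {EZ : Type*} [NormedAddCommGroup EZ] [NormedSpace ℝ EZ] {HZ : Type*} [TopologicalSpace HZ]
  {IZ : ModelWithCorners ℝ EZ HZ} {Z : Type*} [TopologicalSpace Z] [ChartedSpace HZ Z]
  {EB : Type*} [NormedAddCommGroup EB] [NormedSpace ℝ EB] {HB : Type*} [TopologicalSpace HB]
  {IB : ModelWithCorners ℝ EB HB} {B : Type*} [TopologicalSpace B] [ChartedSpace HB B]
  {EB' : Type*} [NormedAddCommGroup EB'] [NormedSpace ℝ EB'] {HB' : Type*} [TopologicalSpace HB']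
  {IB' : ModelWithCorners ℝ EB' HB'} {B' : Type*} [TopologicalSpace B'] [ChartedSpace HB' B']
  {F : Type*} [NormedAddCommGroup F] [NormedSpace ℝ F] [FiniteDimensional ℝ F]
  {A : B → Type*} [TopologicalSpace (TotalSpace F A)] [∀ x, TopologicalSpace (A x)]
  [∀ x, AddCommGroup (A x)] [∀ x, Module ℝ (A x)] [FiberBundle F A] [VectorBundle ℝ F A]
  {F' : Type*} [NormedAddCommGroup F'] [NormedSpace ℝ F'] [FiniteDimensional ℝ F']
  {A' : B' → Type*} [TopologicalSpace (TotalSpace F' A')] [∀ x, TopologicalSpace (A' x)]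
  [∀ x, AddCommGroup (A' x)] [∀ x, Module ℝ (A' x)] [FiberBundle F' A'] [VectorBundle ℝ F' A']

/-- In finite dimension an operator is a finite sum of rank one operators built from its values on a
basis, and each summand depends smoothly on those values. -/
theorem contMDiffAt_clm_of_apply {T : Z → F →L[ℝ] F'} {z : Z}
    (h : ∀ v, ContMDiffAt IZ 𝓘(ℝ, F') ∞ (fun z => T z v) z) :
    ContMDiffAt IZ 𝓘(ℝ, F →L[ℝ] F') ∞ T z := by
  let b := finBasis ℝ F
  have hT : T = fun z => ∑ i, ContinuousLinearMap.smulRightL ℝ F F'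
      (LinearMap.toContinuousLinearMap (b.coord i)) (T z (b i)) := by
    funext z
    ext v
    conv_lhs => rw [← b.sum_repr v, map_sum]
    simp
  rw [hT]
  refine contMDiffAt_finsetSum fun i _ => ?_
  exact (ContinuousLinearMap.contDiff _).contMDiff.contMDiffAt.comp z (h (b i))

/-- If the image of a (possibly discontinuous) section under a smooth fibrewise injective family
of linear maps is smooth, then so is the section. -/
theorem contMDiffAt_of_injective_bundleMap {b : Z → B} {b' : Z → B'} {z₀ : Z}
    (hb : ContMDiffAt IZ IB ∞ b z₀) (φ : ∀ z, A (b z) →ₗ[ℝ] A' (b' z))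
    (hφ : ∀ v : F, ContMDiffAt IZ (IB'.prod 𝓘(ℝ, F')) ∞ (fun z => (⟨b' z,
      φ z ((trivializationAt F A (b z₀)).symm (b z) v)⟩ : TotalSpace F' A')) z₀)
    (hinj : Function.Injective (φ z₀)) {σ : ∀ z, A (b z)}
    (hσ : ContMDiffAt IZ (IB'.prod 𝓘(ℝ, F')) ∞
      (fun z => (⟨b' z, φ z (σ z)⟩ : TotalSpace F' A')) z₀) :
    ContMDiffAt IZ (IB.prod 𝓘(ℝ, F)) ∞ (fun z => (⟨b z, σ z⟩ : TotalSpace F A)) z₀ := by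
  rw [contMDiffAt_totalSpace]
  refine ⟨hb, ?_⟩
  rw [contMDiffAt_totalSpace] at hσ
  obtain ⟨hb', hσ'⟩ := hσ
  set e := trivializationAt F A (b z₀)
  set e' := trivializationAt F' A' (b' z₀)
  have he : ∀ᶠ z in 𝓝 z₀, b z ∈ e.baseSet := hb.continuousAt.preimage_mem_nhds
    (e.open_baseSet.mem_nhds (FiberBundle.mem_baseSet_trivializationAt' (b z₀)))
  have he' : ∀ᶠ z in 𝓝 z₀, b' z ∈ e'.baseSet := hb'.continuousAt.preimage_mem_nhds
    (e'.open_baseSet.mem_nhds (FiberBundle.mem_baseSet_trivializationAt' (b' z₀)))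
  let T : Z → F →L[ℝ] F' := fun z => LinearMap.toContinuousLinearMap
    (e'.linearMapAt ℝ (b' z) ∘ₗ φ z ∘ₗ e.symmₗ ℝ (b z))
  have hTv : ∀ z, b z ∈ e.baseSet → b' z ∈ e'.baseSet → ∀ v,
      T z v = (e' ⟨b' z, φ z (e.symm (b z) v)⟩).2 := fun z hz₁ hz v => by
    have h : T z v = e'.linearMapAt ℝ (b' z) (φ z (e.symmₗ ℝ (b z) v)) := rfl
    rw [h, e'.coe_linearMapAt_of_mem hz, e.coe_symmₗ hz₁]
  have hT : ContMDiffAt IZ 𝓘(ℝ, F →L[ℝ] F') ∞ T z₀ := contMDiffAt_clm_of_apply fun v => by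
    have h1 := (contMDiffAt_totalSpace.1 (hφ v)).2
    refine h1.congr_of_eventuallyEq ?_
    filter_upwards [he, he'] with z hz hz' using hTv z hz hz' v
  have hTinj : Function.Injective (T z₀) := by
    intro v w hvw
    rw [hTv z₀ he.self_of_nhds he'.self_of_nhds, hTv z₀ he.self_of_nhds he'.self_of_nhds] at hvw
    have h1 := (e'.linearEquivAt ℝ (b' z₀) he'.self_of_nhds).injective hvw
    have h2 := hinj h1
    exact (e.linearEquivAt ℝ (b z₀) he.self_of_nhds).symm.injective h2
  -- With `S` a left inverse of `T z₀`, the endomorphism `S ∘ T z` is the identity at `z₀`, hence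
  -- invertible nearby with smooth inverse. Therefore `(S ∘ T z)⁻¹ ∘ S` recovers the section
  -- smoothly from its image.
  obtain ⟨S₀, hS₀⟩ := LinearMap.exists_leftInverse_of_injective (T z₀).toLinearMap
    (LinearMap.ker_eq_bot.2 hTinj)
  let S : F' →L[ℝ] F := LinearMap.toContinuousLinearMap S₀
  have hS : S.comp (T z₀) = ContinuousLinearMap.id ℝ F := by
    ext v
    exact LinearMap.congr_fun hS₀ v
  have hG : ContMDiffAt IZ 𝓘(ℝ, F →L[ℝ] F) ∞ (fun z => S.comp (T z)) z₀ :=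
    contMDiffAt_const.clm_comp hT
  have hinv : ContMDiffAt IZ 𝓘(ℝ, F →L[ℝ] F) ∞ (fun z => (S.comp (T z)).inverse) z₀ := by
    have h1 : ContDiffAt ℝ ∞ ContinuousLinearMap.inverse (S.comp (T z₀)) := by
      rw [hS]
      exact contDiffAt_map_inverse (ContinuousLinearEquiv.refl ℝ F)
    exact h1.contMDiffAt.comp z₀ hG
  have hmem : ∀ᶠ z in 𝓝 z₀, S.comp (T z) ∈ range ((↑) : (F ≃L[ℝ] F) → F →L[ℝ] F) :=
    hG.continuousAt.preimage_mem_nhds ((ContinuousLinearEquiv.isOpen).mem_nhds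
      ⟨ContinuousLinearEquiv.refl ℝ F, by rw [hS]; rfl⟩)
  have hfin : ContMDiffAt IZ 𝓘(ℝ, F) ∞ (fun z => (S.comp (T z)).inverse
      (S (e' ⟨b' z, φ z (σ z)⟩).2)) z₀ :=
    hinv.clm_apply (S.contDiff.contMDiff.contMDiffAt.comp z₀ hσ')
  refine hfin.congr_of_eventuallyEq ?_
  filter_upwards [he, he', hmem] with z hz hz' ⟨G, hG⟩
  have h1 : T z (e ⟨b z, σ z⟩).2 = (e' ⟨b' z, φ z (σ z)⟩).2 := by
    rw [hTv z hz hz', e.symm_apply_apply_mk hz]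
  rw [← h1, ← ContinuousLinearMap.comp_apply S, ← hG, ContinuousLinearMap.inverse_equiv]
  exact (G.symm_apply_apply _).symm

end BundleMap

end VectorFieldsAndBundles

/-! ### Right translation in a Lie groupoid and its smooth dependence on the arrow. -/

section RightTranslation

open Set Filter Topology Module

set_option linter.unusedSectionVars false

section Tangent

variable {EZ : Type*} [NormedAddCommGroup EZ] [NormedSpace ℝ EZ] {HZ : Type*} [TopologicalSpace HZ]
  {IZ : ModelWithCorners ℝ EZ HZ} {Z : Type*} [TopologicalSpace Z] [ChartedSpace HZ Z]
  [IsManifold IZ ∞ Z]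
  {E : Type*} [NormedAddCommGroup E] [NormedSpace ℝ E] {H : Type*} [TopologicalSpace H]
  {I : ModelWithCorners ℝ E H} {X : Type*} [TopologicalSpace X] [ChartedSpace H X]
  [IsManifold I ∞ X]
  {E' : Type*} [NormedAddCommGroup E'] [NormedSpace ℝ E'] {H' : Type*} [TopologicalSpace H']
  {J : ModelWithCorners ℝ E' H'} {Y : Type*} [TopologicalSpace Y] [ChartedSpace H' Y]
  [IsManifold J ∞ Y]

/-- Applying the differential of a parametrized family of maps to a family of tangent vectors. -/
theorem contMDiffAt_mfderiv_apply {f : Z → X → Y} {z₀ : Z} {g : Z → X}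
    {v : ∀ z, TangentSpace I (g z)}
    (hf : ContMDiffAt (IZ.prod I) J ∞ (Function.uncurry f) (z₀, g z₀))
    (hv : ContMDiffAt IZ I.tangent ∞ (fun z => (⟨g z, v z⟩ : TangentBundle I X)) z₀) :
    ContMDiffAt IZ J.tangent ∞
      (fun z => (⟨f z (g z), mfderiv I J (f z) (g z) (v z)⟩ : TangentBundle J Y)) z₀ := by
  have hg : ContMDiffAt IZ I ∞ g z₀ := (contMDiffAt_totalSpace.1 hv).1
  have hfg : ContMDiffAt IZ J ∞ (fun z => f z (g z)) z₀ :=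
    ContMDiffAt.comp z₀ (g := Function.uncurry f) (f := fun z => (z, g z)) hf
      (contMDiffAt_id.prodMk hg)
  have h := ContMDiffAt.mfderiv (m := ∞) f g hf hg (by simp)
  exact ContMDiffAt.clm_apply_of_inCoordinates (F₁ := E) (E₁ := fun x : X => TangentSpace I x)
    (F₂ := E') (E₂ := fun y : Y => TangentSpace J y) (b₁ := g) (b₂ := fun z => f z (g z))
    (ϕ := fun z => mfderiv I J (f z) (g z)) (v := v) h hv hfg

theorem contMDiffAt_mfderiv_apply_const {f : X → Y} {z₀ : Z} {g : Z → X}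
    {v : ∀ z, TangentSpace I (g z)} (hf : ContMDiffAt I J ∞ f (g z₀))
    (hv : ContMDiffAt IZ I.tangent ∞ (fun z => (⟨g z, v z⟩ : TangentBundle I X)) z₀) :
    ContMDiffAt IZ J.tangent ∞
      (fun z => (⟨f (g z), mfderiv I J f (g z) (v z)⟩ : TangentBundle J Y)) z₀ :=
  contMDiffAt_mfderiv_apply (f := fun _ => f) (ContMDiffAt.comp (z₀, g z₀) hf contMDiffAt_snd) hv

end Tangent

namespace LieGroupoid

variable {n k : ℕ} {M : Type uM} [TopologicalSpace M] [ChartedSpace (EuclideanSpace ℝ (Fin n)) M]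
  [IsManifold (𝓡 n) ∞ M]
  {Γ : Type uΓ} [TopologicalSpace Γ] [ChartedSpace (EuclideanSpace ℝ (Fin k)) Γ]
  [IsManifold (𝓡 k) ∞ Γ] (𝒢 : LieGroupoid n k M Γ)
  {EZ : Type*} [NormedAddCommGroup EZ] [NormedSpace ℝ EZ] {HZ : Type*} [TopologicalSpace HZ]
  {IZ : ModelWithCorners ℝ EZ HZ} {Z : Type*} [TopologicalSpace Z] [ChartedSpace HZ Z]

theorem contMDiff_s : ContMDiff (𝓡 k) (𝓡 n) ∞ 𝒢.s := 𝒢.isSubmersion_s.contMDiff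

theorem contMDiff_t : ContMDiff (𝓡 k) (𝓡 n) ∞ 𝒢.t := 𝒢.isSubmersion_t.contMDiff

theorem mul_inv_cancel_right {g h : Γ} (hgh : 𝒢.s g = 𝒢.t h) : 𝒢.mul (𝒢.mul g h) (𝒢.inv h) = g := by
  rw [𝒢.mul_assoc _ _ _ hgh (𝒢.t_inv h).symm, 𝒢.mul_inv, ← hgh, 𝒢.mul_one]

theorem inv_mul_cancel_left {g h : Γ} (hgh : 𝒢.s g = 𝒢.t h) : 𝒢.mul (𝒢.inv g) (𝒢.mul g h) = h := by
  rw [← 𝒢.mul_assoc _ _ _ (𝒢.s_inv g) hgh, 𝒢.inv_mul, hgh, 𝒢.one_mul]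

/-- The product is only smooth within the composable pairs; since `(f, g)` remains composable near
`z`, this is enough for smoothness at `z` in the ordinary sense. -/
theorem contMDiffAt_mul {f g : Z → Γ} {z : Z} (hf : ContMDiffAt IZ (𝓡 k) ∞ f z)
    (hg : ContMDiffAt IZ (𝓡 k) ∞ g z) (h : ∀ᶠ z in 𝓝 z, 𝒢.s (f z) = 𝒢.t (g z)) :
    ContMDiffAt IZ (𝓡 k) ∞ (fun z => 𝒢.mul (f z) (g z)) z := by
  have h1 := 𝒢.contMDiffOn_mul (f z, g z) h.self_of_nhds
  have h2 : ContMDiffWithinAt IZ (𝓡 k) ∞ (fun z => 𝒢.mul (f z) (g z))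
      {z | 𝒢.s (f z) = 𝒢.t (g z)} z :=
    ContMDiffWithinAt.comp (g := fun q : Γ × Γ => 𝒢.mul q.1 q.2) (f := fun z => (f z, g z)) z h1
      (hf.prodMk hg).contMDiffWithinAt fun z hz => hz
  exact h2.contMDiffAt h

theorem mdifferentiableWithinAt_mul_right (g : Γ) :
    MDifferentiableWithinAt (𝓡 k) (𝓡 k) (fun h => 𝒢.mul h g) {h | 𝒢.s h = 𝒢.t g}
      (𝒢.one (𝒢.t g)) := by
  have h1 := 𝒢.contMDiffOn_mul (𝒢.one (𝒢.t g), g) (𝒢.s_one _)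
  have h2 : ContMDiffWithinAt (𝓡 k) (𝓡 k) ∞ (fun h => 𝒢.mul h g) {h | 𝒢.s h = 𝒢.t g}
      (𝒢.one (𝒢.t g)) :=
    ContMDiffWithinAt.comp (g := fun q : Γ × Γ => 𝒢.mul q.1 q.2) (f := fun h => (h, g)) _ h1
      (contMDiffAt_id.prodMk contMDiffAt_const).contMDiffWithinAt fun z hz => hz
  exact h2.mdifferentiableWithinAt (by simp)

/-- Right translation of the velocity of a curve in a source fibre through a unit. -/
theorem rightTranslate_mfderiv {γ : Z → Γ} {z : Z} {g : Γ} (hγ : MDifferentiableAt IZ (𝓡 k) γ z)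
    (hz : γ z = 𝒢.one (𝒢.t g)) (hs : ∀ᶠ z' in 𝓝 z, 𝒢.s (γ z') = 𝒢.t g)
    (w : TangentSpace IZ z) :
    𝒢.rightTranslate g (mfderiv IZ (𝓡 k) γ z w) =
      mfderiv IZ (𝓡 k) (fun z' => 𝒢.mul (γ z') g) z w := by
  -- The derivative within the source fibre is not unique in transverse directions. Any choice gives
  -- the same result after composition with a map that stays in the fibre.
  have h1 : HasMFDerivWithinAt (𝓡 k) (𝓡 k) (fun h => 𝒢.mul h g) {h | 𝒢.s h = 𝒢.t g} (γ z)
      (mfderivWithin (𝓡 k) (𝓡 k) (fun h => 𝒢.mul h g) {h | 𝒢.s h = 𝒢.t g} (𝒢.one (𝒢.t g))) := by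
    rw [hz]
    exact (𝒢.mdifferentiableWithinAt_mul_right g).hasMFDerivWithinAt
  have h2 := h1.comp z (hγ.hasMFDerivAt.hasMFDerivWithinAt (s := {z' | 𝒢.s (γ z') = 𝒢.t g}))
    fun z hz => hz
  have h3 := (h2.hasMFDerivAt hs).mfderiv
  exact (DFunLike.congr_fun h3 w).symm

/-- A product decomposition of the source map near an arrow. -/
noncomputable def sourceChart (g : Γ) : SubmersionChart (𝓡 k) (𝓡 n) 𝒢.s g :=
  (𝒢.isSubmersion_s.isSubmersionAt g).nonempty_submersionChart.some

variable {𝒢} in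
/-- Right translation depends smoothly on the arrow and on the vector. -/
theorem contMDiffAt_rightTranslate [IsManifold IZ ∞ Z] {g : Z → Γ} {z₀ : Z}
    (hg : ContMDiffAt IZ (𝓡 k) ∞ g z₀) {v : ∀ z, TangentSpace (𝓡 k) (𝒢.one (𝒢.t (g z)))}
    (hv : ContMDiffAt IZ (𝓡 k).tangent ∞
      (fun z => (⟨𝒢.one (𝒢.t (g z)), v z⟩ : TangentBundle (𝓡 k) Γ)) z₀)
    (hker : ∀ z, mfderiv (𝓡 k) (𝓡 n) 𝒢.s (𝒢.one (𝒢.t (g z))) (v z) = 0) :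
    ContMDiffAt IZ (𝓡 k).tangent ∞
      (fun z => (⟨g z, 𝒢.rightTranslate (g z) (v z)⟩ : TangentBundle (𝓡 k) Γ)) z₀ := by
  set S := 𝒢.sourceChart (𝒢.one (𝒢.t (g z₀)))
  set Θ := S.toProd
  let V := EuclideanSpace ℝ (Fin (finrank ℝ (EuclideanSpace ℝ (Fin k)) -
    finrank ℝ (EuclideanSpace ℝ (Fin n))))
  have ht : ContMDiffAt IZ (𝓡 n) ∞ (fun z => 𝒢.t (g z)) z₀ :=
    𝒢.contMDiff_t.contMDiffAt.comp z₀ hg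
  have hu : ContMDiffAt IZ (𝓡 k) ∞ (fun z => 𝒢.one (𝒢.t (g z))) z₀ :=
    𝒢.contMDiff_one.contMDiffAt.comp z₀ ht
  have hmem : ∀ᶠ z in 𝓝 z₀, 𝒢.one (𝒢.t (g z)) ∈ Θ.source :=
    hu.continuousAt.eventually (Θ.open_source.eventually_mem S.mem_source)
  let pr : Γ → V := fun h => (Θ h).2
  have hpr : ∀ h ∈ Θ.source, ContMDiffAt (𝓡 k) 𝓘(ℝ, V) ∞ pr h := fun h hh =>
    contMDiffAt_snd.comp h (S.smooth.contMDiffAt hh)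
  let c : Z → V := fun z => pr (𝒢.one (𝒢.t (g z)))
  let w : Z → V := fun z => mfderiv (𝓡 k) 𝓘(ℝ, V) pr (𝒢.one (𝒢.t (g z))) (v z)
  have hcw : ContMDiffAt IZ 𝓘(ℝ, V).tangent ∞
      (fun z => (⟨c z, w z⟩ : TangentBundle 𝓘(ℝ, V) V)) z₀ :=
    contMDiffAt_mfderiv_apply_const (f := pr) (hpr _ S.mem_source) hv
  have hΘ1 : ∀ z, 𝒢.one (𝒢.t (g z)) ∈ Θ.source → Θ (𝒢.one (𝒢.t (g z))) = (𝒢.t (g z), c z) :=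
    fun z hz => Prod.ext ((S.fst_eq _ hz).trans (𝒢.s_one _)) rfl
  -- In a product chart of `s` at the unit, the source fibre over `t (g z)` is the slice `a ↦ Θ⁻¹ (t
  -- (g z), a)`, and a vector in `ker ds` is a vector `w z` along it. Right translation becomes the
  -- partial derivative in `a` of a map smooth in `(z, a)`.
  let m : Z → V → Γ := fun z a => 𝒢.mul (Θ.symm (𝒢.t (g z), a)) (g z)
  have hs : ∀ q ∈ Θ.target, 𝒢.s (Θ.symm q) = q.1 := fun q hq => by
    rw [← S.fst_eq _ (Θ.map_target hq), Θ.right_inv hq]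
  have hin : ContMDiffAt (IZ.prod 𝓘(ℝ, V)) ((𝓡 n).prod 𝓘(ℝ, V)) ∞
      (fun q : Z × V => (𝒢.t (g q.1), q.2)) (z₀, c z₀) :=
    (ContMDiffAt.comp (z₀, c z₀) (g := fun z => 𝒢.t (g z)) ht contMDiffAt_fst).prodMk
      contMDiffAt_snd
  have htar : (𝒢.t (g z₀), c z₀) ∈ Θ.target := by
    rw [← hΘ1 z₀ S.mem_source]; exact Θ.map_source S.mem_source
  have hm : ContMDiffAt (IZ.prod 𝓘(ℝ, V)) (𝓡 k) ∞ (Function.uncurry m) (z₀, c z₀) := by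
    refine 𝒢.contMDiffAt_mul (f := fun q : Z × V => Θ.symm (𝒢.t (g q.1), q.2))
      (g := fun q : Z × V => g q.1) ?_ (hg.comp (z₀, c z₀) contMDiffAt_fst) ?_
    · exact ContMDiffAt.comp (z₀, c z₀) (g := Θ.symm) (S.smooth.contMDiffAt_symm htar) hin
    · filter_upwards [hin.continuousAt.eventually (Θ.open_target.eventually_mem htar)] with q hq
      exact hs _ hq
  have key := contMDiffAt_mfderiv_apply (f := m) (g := c) (v := w) hm hcw
  refine key.congr_of_eventuallyEq ?_
  filter_upwards [hmem] with z hz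
  have hzt : (𝒢.t (g z), c z) ∈ Θ.target := by rw [← hΘ1 z hz]; exact Θ.map_source hz
  have hΨ : Θ.symm (𝒢.t (g z), c z) = 𝒢.one (𝒢.t (g z)) := by
    rw [← hΘ1 z hz, Θ.left_inv hz]
  have hline : ContMDiffAt 𝓘(ℝ, V) ((𝓡 n).prod 𝓘(ℝ, V)) ∞ (fun a : V => (𝒢.t (g z), a)) (c z) :=
    contMDiffAt_const.prodMk contMDiffAt_id
  have hγ : ContMDiffAt 𝓘(ℝ, V) (𝓡 k) ∞ (fun a => Θ.symm (𝒢.t (g z), a)) (c z) :=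
    ContMDiffAt.comp (c z) (g := Θ.symm) (S.smooth.contMDiffAt_symm hzt) hline
  have hR := 𝒢.rightTranslate_mfderiv (hγ.mdifferentiableAt (by simp)) hΨ
    ((hline.continuousAt.eventually (Θ.open_target.eventually_mem hzt)).mono fun a ha => hs _ ha)
    (w z)
  -- As `v z` lies in `ker ds`, its image under `dΘ` is `(0, w z)`; the slice through the unit
  -- therefore has velocity `v z`.
  have hvz : mfderiv 𝓘(ℝ, V) (𝓡 k) (fun a => Θ.symm (𝒢.t (g z), a)) (c z) (w z) = v z := by
    have h1 : mfderiv (𝓡 k) ((𝓡 n).prod 𝓘(ℝ, V)) Θ (𝒢.one (𝒢.t (g z))) (v z) = (0, w z) := by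
      have he : Θ =ᶠ[𝓝 (𝒢.one (𝒢.t (g z)))] fun h => (𝒢.s h, pr h) := by
        filter_upwards [Θ.open_source.mem_nhds hz] with h hh
        exact Prod.ext (S.fst_eq h hh) rfl
      rw [he.mfderiv_eq, mfderiv_prodMk (𝒢.contMDiff_s.contMDiffAt.mdifferentiableAt (by simp))
        ((hpr _ hz).mdifferentiableAt (by simp))]
      exact Prod.ext (hker z) rfl
    have h2 := mfderiv_comp (c z) (g := Θ.symm) (f := fun a : V => (𝒢.t (g z), a))
      ((S.smooth.contMDiffAt_symm hzt).mdifferentiableAt (by simp))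
      (hline.mdifferentiableAt (by simp))
    have h3 : mfderiv 𝓘(ℝ, V) ((𝓡 n).prod 𝓘(ℝ, V)) (fun a : V => (𝒢.t (g z), a)) (c z) (w z) =
        (0, w z) :=
      DFunLike.congr_fun (mfderiv_prod_right (I := 𝓡 n) (I' := 𝓘(ℝ, V)) (x₀ := 𝒢.t (g z))
        (y₀ := c z)) (w z)
    have h4 := S.smooth.mfderiv_symm_comp hz (v z)
    refine (DFunLike.congr_fun h2 (w z)).trans ?_
    refine (congrArg (mfderiv ((𝓡 n).prod 𝓘(ℝ, V)) (𝓡 k) Θ.symm (𝒢.t (g z), c z)) h3).trans ?_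
    rw [h1] at h4
    rw [← hΘ1 z hz]
    exact h4
  have hone : m z (c z) = g z := by
    change 𝒢.mul (Θ.symm (𝒢.t (g z), c z)) (g z) = g z
    rw [hΨ, 𝒢.one_mul]
  rw [← hvz, hR]
  exact (TotalSpace.ext hone (by rfl)).symm

end LieGroupoid

end RightTranslation

/-! ### Source fibres as manifolds and their tangent spaces. -/

section SourceFibers

open Set Filter Topology Module

set_option linter.unusedSectionVars false

section LocalFrame

variable {EZ : Type*} [NormedAddCommGroup EZ] [NormedSpace ℝ EZ] {HZ : Type*} [TopologicalSpace HZ]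
  {IZ : ModelWithCorners ℝ EZ HZ} {Z : Type*} [TopologicalSpace Z] [ChartedSpace HZ Z]
  {EB : Type*} [NormedAddCommGroup EB] [NormedSpace ℝ EB] {HB : Type*} [TopologicalSpace HB]
  {IB : ModelWithCorners ℝ EB HB} {B : Type*} [TopologicalSpace B] [ChartedSpace HB B]
  {F : Type*} [NormedAddCommGroup F] [NormedSpace ℝ F]
  {A : B → Type*} [TopologicalSpace (TotalSpace F A)] [∀ x, TopologicalSpace (A x)]
  [∀ x, AddCommGroup (A x)] [∀ x, Module ℝ (A x)] [FiberBundle F A] [VectorBundle ℝ F A]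
  [ContMDiffVectorBundle ∞ F A IB]

/-- Local frames pulled back along `b`; they supply the test sections required by
`contMDiffAt_of_injective_bundleMap`. -/
theorem contMDiffAt_trivializationAt_symm {b : Z → B} {z₀ : Z} (hb : ContMDiffAt IZ IB ∞ b z₀)
    (v : F) : ContMDiffAt IZ (IB.prod 𝓘(ℝ, F)) ∞
      (fun z => (⟨b z, (trivializationAt F A (b z₀)).symm (b z) v⟩ : TotalSpace F A)) z₀ := by
  set e := trivializationAt F A (b z₀)
  have h0 : b z₀ ∈ e.baseSet := FiberBundle.mem_baseSet_trivializationAt' (b z₀)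
  have h1 : (b z₀, v) ∈ e.target := e.mem_target.2 h0
  have h2 := (e.contMDiffOn_symm (n := ∞) (IB := IB)).contMDiffAt (e.open_target.mem_nhds h1)
  have h3 : ContMDiffAt IZ (IB.prod 𝓘(ℝ, F)) ∞
      (fun z => e.toOpenPartialHomeomorph.symm (b z, v)) z₀ :=
    ContMDiffAt.comp z₀ (g := e.toOpenPartialHomeomorph.symm) (f := fun z => (b z, v)) h2
      (hb.prodMk contMDiffAt_const)
  refine h3.congr_of_eventuallyEq ?_
  filter_upwards [hb.continuousAt.eventually (e.open_baseSet.eventually_mem h0)] with z hz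
  exact e.mk_symm hz v

end LocalFrame

/-- The differential of an immersion is an injective bundle map, so a family of tangent vectors is
smooth as soon as its image is. -/
theorem contMDiffAt_of_isImmersionAt_mfderiv
    {E : Type*} [NormedAddCommGroup E] [NormedSpace ℝ E] [FiniteDimensional ℝ E]
    {H : Type*} [TopologicalSpace H] {I : ModelWithCorners ℝ E H} [I.Boundaryless]
    {X : Type*} [TopologicalSpace X] [ChartedSpace H X] [IsManifold I ∞ X]
    {E' : Type*} [NormedAddCommGroup E'] [NormedSpace ℝ E'] [FiniteDimensional ℝ E']
    {H' : Type*} [TopologicalSpace H']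
    {J : ModelWithCorners ℝ E' H'} [J.Boundaryless] {Y : Type*} [TopologicalSpace Y]
    [ChartedSpace H' Y] [IsManifold J ∞ Y]
    {EZ : Type*} [NormedAddCommGroup EZ] [NormedSpace ℝ EZ] {HZ : Type*} [TopologicalSpace HZ]
    {IZ : ModelWithCorners ℝ EZ HZ} {Z : Type*} [TopologicalSpace Z] [ChartedSpace HZ Z]
    [IsManifold IZ ∞ Z] {ι : X → Y} {z₀ : Z} {b : Z → X}
    (hι : IsImmersionAt I J ∞ ι (b z₀)) (hb : ContMDiffAt IZ I ∞ b z₀)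
    {σ : ∀ z, TangentSpace I (b z)}
    (hσ : ContMDiffAt IZ J.tangent ∞
      (fun z => (⟨ι (b z), mfderiv I J ι (b z) (σ z)⟩ : TangentBundle J Y)) z₀) :
    ContMDiffAt IZ I.tangent ∞ (fun z => (⟨b z, σ z⟩ : TangentBundle I X)) z₀ := by
  refine contMDiffAt_of_injective_bundleMap (A := fun x : X => TangentSpace I x)
    (A' := fun y : Y => TangentSpace J y) (b' := fun z => ι (b z)) hb
    (fun z => (mfderiv I J ι (b z)).toLinearMap) (fun v => ?_) hι.injective_mfderiv hσ
  refine contMDiffAt_mfderiv_apply_const hι.contMDiffAt ?_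
  exact contMDiffAt_trivializationAt_symm hb v

namespace LieGroupoid

variable {n k : ℕ} {M : Type uM} [TopologicalSpace M] [ChartedSpace (EuclideanSpace ℝ (Fin n)) M]
  [IsManifold (𝓡 n) ∞ M]
  {Γ : Type uΓ} [TopologicalSpace Γ] [ChartedSpace (EuclideanSpace ℝ (Fin k)) Γ]
  [IsManifold (𝓡 k) ∞ Γ] (𝒢 : LieGroupoid n k M Γ)
  {EZ : Type*} [NormedAddCommGroup EZ] [NormedSpace ℝ EZ] {HZ : Type*} [TopologicalSpace HZ]
  {IZ : ModelWithCorners ℝ EZ HZ} {Z : Type*} [TopologicalSpace Z] [ChartedSpace HZ Z]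

variable (n k) in
/-- The dimension of the source fibres. -/
noncomputable abbrev sourceFiberDim : ℕ :=
  finrank ℝ (EuclideanSpace ℝ (Fin k)) - finrank ℝ (EuclideanSpace ℝ (Fin n))

theorem isEmbedding_sourceFiber (x : M) : IsEmbedding (fun u : 𝒢.SourceFiber x => u.1) :=
  IsEmbedding.subtypeVal

theorem range_sourceFiber (x : M) : range (fun u : 𝒢.SourceFiber x => u.1) = 𝒢.s ⁻¹' {x} :=
  Subtype.range_val

/-- The manifold structure of a source fibre. -/
@[reducible] noncomputable def sourceFiberChartedSpace (x : M) :
    ChartedSpace (EuclideanSpace ℝ (Fin (sourceFiberDim n k))) (𝒢.SourceFiber x) :=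
  fiberChartedSpace (𝒢.isEmbedding_sourceFiber x) (𝒢.range_sourceFiber x)
    (fun u => 𝒢.sourceChart u.1)

attribute [local instance] sourceFiberChartedSpace

theorem isManifold_sourceFiber (x : M) :
    IsManifold (𝓡 (sourceFiberDim n k)) ∞ (𝒢.SourceFiber x) :=
  fiber_isManifold (𝒢.isEmbedding_sourceFiber x) (𝒢.range_sourceFiber x)
    (fun u => 𝒢.sourceChart u.1)

attribute [local instance] isManifold_sourceFiber

theorem isSmoothEmbedding_sourceFiber (x : M) :
    IsSmoothEmbedding (𝓡 (sourceFiberDim n k)) (𝓡 k) ∞ (fun u : 𝒢.SourceFiber x => u.1) :=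
  fiber_isSmoothEmbedding (𝒢.isEmbedding_sourceFiber x) (𝒢.range_sourceFiber x)
    (fun u => 𝒢.sourceChart u.1)

theorem surjective_mfderiv_s (g : Γ) : Function.Surjective (mfderiv (𝓡 k) (𝓡 n) 𝒢.s g) :=
  (𝒢.sourceChart g).surjective_mfderiv

theorem contMDiff_sourceFiber_val (x : M) :
    ContMDiff (𝓡 (sourceFiberDim n k)) (𝓡 k) ∞ (fun u : 𝒢.SourceFiber x => u.1) :=
  (𝒢.isSmoothEmbedding_sourceFiber x).contMDiff

/-- The differential of the inclusion of a source fibre, onto the kernel of `ds`. -/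
noncomputable def sourceFiberTangentEquiv {x : M} (u : 𝒢.SourceFiber x) :
    TangentSpace (𝓡 (sourceFiberDim n k)) u ≃ₗ[ℝ]
      LinearMap.ker (mfderiv (𝓡 k) (𝓡 n) 𝒢.s u.1).toLinearMap :=
  (LinearEquiv.ofInjective
    (mfderiv (𝓡 (sourceFiberDim n k)) (𝓡 k) (fun u : 𝒢.SourceFiber x => u.1) u).toLinearMap
    ((𝒢.isSmoothEmbedding_sourceFiber x).isImmersion.isImmersionAt u).injective_mfderiv).trans
  (LinearEquiv.ofEq _ _ (range_mfderiv_eq_ker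
    ((𝒢.isSmoothEmbedding_sourceFiber x).isImmersion.isImmersionAt u)
    (𝒢.contMDiff_s.contMDiffAt.mdifferentiableAt (by simp)) (𝒢.surjective_mfderiv_s u.1)
    (fun u => u.2) (by
      have := (𝒢.sourceChart u.1).le
      simp only [sourceFiberDim, finrank_euclideanSpace, Fintype.card_fin] at this ⊢
      omega)))

theorem sourceFiberTangentEquiv_apply {x : M} (u : 𝒢.SourceFiber x)
    (v : TangentSpace (𝓡 (sourceFiberDim n k)) u) :
    (𝒢.sourceFiberTangentEquiv u v).1 =
      mfderiv (𝓡 (sourceFiberDim n k)) (𝓡 k) (fun u : 𝒢.SourceFiber x => u.1) u v := rfl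

/-- The unit at `y`, in the source fibre. -/
def fiberOne (y : M) : 𝒢.SourceFiber y := ⟨𝒢.one y, 𝒢.s_one y⟩

variable {𝒢} in
/-- Right translation between source fibres. -/
def fiberRightMul {x y : M} (u : 𝒢.SourceFiber x) (h : 𝒢.t u.1 = y) (w : 𝒢.SourceFiber y) :
    𝒢.SourceFiber x :=
  ⟨𝒢.mul w.1 u.1, (𝒢.s_mul _ _ (w.2.trans h.symm)).trans u.2⟩

theorem contMDiff_fiberRightMul {x y : M} (u : 𝒢.SourceFiber x) (h : 𝒢.t u.1 = y) :
    ContMDiff (𝓡 (sourceFiberDim n k)) (𝓡 (sourceFiberDim n k)) ∞ (fiberRightMul u h) := by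
  refine (𝒢.isSmoothEmbedding_sourceFiber x).contMDiff_of_comp fun w => ?_
  exact 𝒢.contMDiffAt_mul (𝒢.contMDiff_sourceFiber_val y).contMDiffAt contMDiffAt_const
    (Eventually.of_forall fun w => w.2.trans h.symm)

theorem fiberRightMul_one {x y : M} (u : 𝒢.SourceFiber x) (h : 𝒢.t u.1 = y) :
    fiberRightMul u h (𝒢.fiberOne y) = u :=
  Subtype.ext (by subst h; exact 𝒢.one_mul _)

/-- A tangent vector of the source fibre at a unit that represents a vector in the kernel of
`ds`. -/
theorem exists_fiber_tangent {y : M} {v : TangentSpace (𝓡 k) (𝒢.one y)}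
    (hv : mfderiv (𝓡 k) (𝓡 n) 𝒢.s (𝒢.one y) v = 0) :
    ∃ w : TangentSpace (𝓡 (sourceFiberDim n k)) (𝒢.fiberOne y),
      mfderiv (𝓡 (sourceFiberDim n k)) (𝓡 k) (fun u : 𝒢.SourceFiber y => u.1) (𝒢.fiberOne y) w
        = v := by
  obtain ⟨w, hw⟩ := (𝒢.sourceFiberTangentEquiv (𝒢.fiberOne y)).surjective ⟨v, hv⟩
  exact ⟨w, congrArg Subtype.val hw⟩

theorem rightTranslate_fiber (g : Γ) (w : TangentSpace (𝓡 (sourceFiberDim n k))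
    (𝒢.fiberOne (𝒢.t g))) :
    𝒢.rightTranslate g (mfderiv (𝓡 (sourceFiberDim n k)) (𝓡 k)
      (fun u : 𝒢.SourceFiber (𝒢.t g) => u.1) (𝒢.fiberOne (𝒢.t g)) w) =
    mfderiv (𝓡 (sourceFiberDim n k)) (𝓡 k) (fun u : 𝒢.SourceFiber (𝒢.t g) => 𝒢.mul u.1 g)
      (𝒢.fiberOne (𝒢.t g)) w :=
  𝒢.rightTranslate_mfderiv
    ((𝒢.contMDiff_sourceFiber_val _).contMDiffAt.mdifferentiableAt (by simp)) rfl
    (Eventually.of_forall fun u => u.2) w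

theorem contMDiff_fiber_mul (g : Γ) : ContMDiff (𝓡 (sourceFiberDim n k)) (𝓡 k) ∞
    (fun u : 𝒢.SourceFiber (𝒢.t g) => 𝒢.mul u.1 g) := fun _ =>
  𝒢.contMDiffAt_mul (𝒢.contMDiff_sourceFiber_val _).contMDiffAt contMDiffAt_const
    (Eventually.of_forall fun w => w.2)

/-- The chain rule, with the outer derivative based at `g` rather than at the product of the unit
with `g`; the two points agree only propositionally. -/
theorem mfderiv_comp_fiber_mul {E' : Type*} [NormedAddCommGroup E'] [NormedSpace ℝ E']
    {H' : Type*} [TopologicalSpace H'] {J : ModelWithCorners ℝ E' H'} {Y : Type*}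
    [TopologicalSpace Y] [ChartedSpace H' Y] {f : Γ → Y} (g : Γ)
    (hf : MDifferentiableAt (𝓡 k) J f g) (w : TangentSpace (𝓡 (sourceFiberDim n k))
    (𝒢.fiberOne (𝒢.t g))) :
    mfderiv (𝓡 k) J f g (mfderiv (𝓡 (sourceFiberDim n k)) (𝓡 k)
      (fun u : 𝒢.SourceFiber (𝒢.t g) => 𝒢.mul u.1 g) (𝒢.fiberOne (𝒢.t g)) w) =
    mfderiv (𝓡 (sourceFiberDim n k)) J (fun u : 𝒢.SourceFiber (𝒢.t g) => f (𝒢.mul u.1 g))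
      (𝒢.fiberOne (𝒢.t g)) w := by
  have h1 : 𝒢.mul (𝒢.fiberOne (𝒢.t g)).1 g = g := 𝒢.one_mul g
  have h2 : HasMFDerivAt (𝓡 k) J f (𝒢.mul (𝒢.fiberOne (𝒢.t g)).1 g) (mfderiv (𝓡 k) J f g) := by
    rw [h1]; exact hf.hasMFDerivAt
  have h3 := h2.comp (𝒢.fiberOne (𝒢.t g))
    ((𝒢.contMDiff_fiber_mul g).contMDiffAt.mdifferentiableAt (by simp)).hasMFDerivAt
  exact (DFunLike.congr_fun h3.mfderiv w).symm

/-- The source of `u g` does not depend on `u`. -/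
theorem mfderiv_s_rightTranslate {g : Γ} {v : TangentSpace (𝓡 k) (𝒢.one (𝒢.t g))}
    (hv : mfderiv (𝓡 k) (𝓡 n) 𝒢.s (𝒢.one (𝒢.t g)) v = 0) :
    mfderiv (𝓡 k) (𝓡 n) 𝒢.s g (𝒢.rightTranslate g v) = 0 := by
  obtain ⟨w, rfl⟩ := 𝒢.exists_fiber_tangent hv
  rw [rightTranslate_fiber,
    𝒢.mfderiv_comp_fiber_mul g (𝒢.contMDiff_s.contMDiffAt.mdifferentiableAt (by simp))]
  have h : (fun u : 𝒢.SourceFiber (𝒢.t g) => 𝒢.s (𝒢.mul u.1 g)) = fun _ => 𝒢.s g :=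
    funext fun u => 𝒢.s_mul _ _ u.2
  rw [h, mfderiv_const]
  rfl

/-- `t (u g) = t u`, so right translation leaves the anchor unchanged. -/
theorem mfderiv_t_rightTranslate {g : Γ} {v : TangentSpace (𝓡 k) (𝒢.one (𝒢.t g))}
    (hv : mfderiv (𝓡 k) (𝓡 n) 𝒢.s (𝒢.one (𝒢.t g)) v = 0) :
    mfderiv (𝓡 k) (𝓡 n) 𝒢.t g (𝒢.rightTranslate g v) =
      mfderiv (𝓡 k) (𝓡 n) 𝒢.t (𝒢.one (𝒢.t g)) v := by
  obtain ⟨w, rfl⟩ := 𝒢.exists_fiber_tangent hv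
  rw [rightTranslate_fiber,
    𝒢.mfderiv_comp_fiber_mul g (𝒢.contMDiff_t.contMDiffAt.mdifferentiableAt (by simp))]
  have h : (fun u : 𝒢.SourceFiber (𝒢.t g) => 𝒢.t (𝒢.mul u.1 g)) =
      𝒢.t ∘ (fun u : 𝒢.SourceFiber (𝒢.t g) => u.1) :=
    funext fun u => 𝒢.t_mul _ _ u.2
  rw [h, mfderiv_comp (𝒢.fiberOne (𝒢.t g))
    (𝒢.contMDiff_t.contMDiffAt.mdifferentiableAt (by simp))
    ((𝒢.contMDiff_sourceFiber_val _).contMDiffAt.mdifferentiableAt (by simp))]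
  rfl

/-- Right multiplication by `g⁻¹` undoes right multiplication by `g` on the source fibre. It is only
differentiable within a source fibre, which contains the image of the first map. -/
theorem rightTranslate_injective {g : Γ} {v : TangentSpace (𝓡 k) (𝒢.one (𝒢.t g))}
    (hv : mfderiv (𝓡 k) (𝓡 n) 𝒢.s (𝒢.one (𝒢.t g)) v = 0) (h0 : 𝒢.rightTranslate g v = 0) :
    v = 0 := by
  obtain ⟨w, rfl⟩ := 𝒢.exists_fiber_tangent hv
  rw [rightTranslate_fiber] at h0
  have h1 : 𝒢.mul (𝒢.fiberOne (𝒢.t g)).1 g = g := 𝒢.one_mul g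
  have h2 : MDifferentiableWithinAt (𝓡 k) (𝓡 k) (fun h => 𝒢.mul h (𝒢.inv g))
      {h | 𝒢.s h = 𝒢.s g} g := by
    have h1 := 𝒢.contMDiffOn_mul (g, 𝒢.inv g) (𝒢.t_inv g).symm
    have h2 : ContMDiffWithinAt (𝓡 k) (𝓡 k) ∞ (fun h => 𝒢.mul h (𝒢.inv g))
        {h | 𝒢.s h = 𝒢.s g} g :=
      ContMDiffWithinAt.comp (g := fun q : Γ × Γ => 𝒢.mul q.1 q.2) (f := fun h => (h, 𝒢.inv g)) _
        h1 (contMDiffAt_id.prodMk contMDiffAt_const).contMDiffWithinAt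
        fun z hz => hz.trans (𝒢.t_inv g).symm
    exact h2.mdifferentiableWithinAt (by simp)
  have h2' : ∀ g', g' = g → MDifferentiableWithinAt (𝓡 k) (𝓡 k) (fun h => 𝒢.mul h (𝒢.inv g))
      {h | 𝒢.s h = 𝒢.s g} g' := fun _ hg' => hg' ▸ h2
  have h3 := (h2' _ h1).hasMFDerivWithinAt.comp (𝒢.fiberOne (𝒢.t g))
    ((𝒢.contMDiff_fiber_mul g).contMDiffAt.mdifferentiableAt
      (by simp)).hasMFDerivAt.hasMFDerivWithinAt (s := univ) fun u _ => by
      exact 𝒢.s_mul _ _ u.2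
  have h4 : ((fun h => 𝒢.mul h (𝒢.inv g)) ∘ fun u : 𝒢.SourceFiber (𝒢.t g) => 𝒢.mul u.1 g) =
      fun u : 𝒢.SourceFiber (𝒢.t g) => u.1 := funext fun u => 𝒢.mul_inv_cancel_right u.2
  rw [h4] at h3
  refine (DFunLike.congr_fun (h3.hasMFDerivAt univ_mem).mfderiv w).trans ?_
  exact (congrArg (mfderivWithin (𝓡 k) (𝓡 k) (fun h => 𝒢.mul h (𝒢.inv g)) {h | 𝒢.s h = 𝒢.s g}
    (𝒢.mul (𝒢.fiberOne (𝒢.t g)).1 g)) h0).trans (map_zero _)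

theorem finrank_ker_mfderiv_s (g : Γ) :
    finrank ℝ (LinearMap.ker (mfderiv (𝓡 k) (𝓡 n) 𝒢.s g).toLinearMap) = sourceFiberDim n k := by
  have : FiniteDimensional ℝ (TangentSpace (𝓡 k) g) :=
    inferInstanceAs (FiniteDimensional ℝ (EuclideanSpace ℝ (Fin k)))
  have h := (mfderiv (𝓡 k) (𝓡 n) 𝒢.s g).toLinearMap.finrank_range_add_finrank_ker
  rw [LinearMap.range_eq_top.2 (𝒢.surjective_mfderiv_s g), finrank_top] at h
  exact (Nat.sub_eq_of_eq_add' h.symm).symm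

/-- Right translation, as a linear isomorphism of the kernels of `ds`. -/
noncomputable def rightTranslateEquiv (g : Γ) :
    LinearMap.ker (mfderiv (𝓡 k) (𝓡 n) 𝒢.s (𝒢.one (𝒢.t g))).toLinearMap ≃ₗ[ℝ]
      LinearMap.ker (mfderiv (𝓡 k) (𝓡 n) 𝒢.s g).toLinearMap :=
  haveI : FiniteDimensional ℝ (TangentSpace (𝓡 k) (𝒢.one (𝒢.t g))) :=
    inferInstanceAs (FiniteDimensional ℝ (EuclideanSpace ℝ (Fin k)))
  haveI : FiniteDimensional ℝ (TangentSpace (𝓡 k) g) :=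
    inferInstanceAs (FiniteDimensional ℝ (EuclideanSpace ℝ (Fin k)))
  LinearMap.linearEquivOfInjective
    (LinearMap.restrict (p := LinearMap.ker (mfderiv (𝓡 k) (𝓡 n) 𝒢.s (𝒢.one (𝒢.t g))).toLinearMap)
      (q := LinearMap.ker (mfderiv (𝓡 k) (𝓡 n) 𝒢.s g).toLinearMap)
      ((mfderivWithin (𝓡 k) (𝓡 k) (fun h => 𝒢.mul h g) {h | 𝒢.s h = 𝒢.t g} (𝒢.one (𝒢.t g)) :
        TangentSpace (𝓡 k) (𝒢.one (𝒢.t g)) →L[ℝ] TangentSpace (𝓡 k) g).toLinearMap)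
      fun _ hv => 𝒢.mfderiv_s_rightTranslate hv)
    ((injective_iff_map_eq_zero _).2 fun v hv =>
      Subtype.ext (𝒢.rightTranslate_injective v.2 (congrArg Subtype.val hv)))
    ((𝒢.finrank_ker_mfderiv_s _).trans (𝒢.finrank_ker_mfderiv_s g).symm)

end LieGroupoid

end SourceFibers

/-! ### Transitive groupoids: isotropy groups and the source fibre as a principal bundle. -/

section TransitiveGroupoids

open Set Filter Topology Module

set_option linter.unusedSectionVars false

namespace LieGroupoid

variable {n k : ℕ} {M : Type uM} [TopologicalSpace M] [ChartedSpace (EuclideanSpace ℝ (Fin n)) M]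
  [IsManifold (𝓡 n) ∞ M]
  {Γ : Type uΓ} [TopologicalSpace Γ] [ChartedSpace (EuclideanSpace ℝ (Fin k)) Γ]
  [IsManifold (𝓡 k) ∞ Γ] (𝒢 : LieGroupoid n k M Γ)
  {EZ : Type*} [NormedAddCommGroup EZ] [NormedSpace ℝ EZ] {HZ : Type*} [TopologicalSpace HZ]
  {IZ : ModelWithCorners ℝ EZ HZ} {Z : Type*} [TopologicalSpace Z] [ChartedSpace HZ Z]

attribute [local instance] sourceFiberChartedSpace isManifold_sourceFiber

/-- The anchor of the Lie algebroid of the groupoid is surjective. -/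
def IsTransitive : Prop :=
  ∀ (y : M) (v : TangentSpace (𝓡 n) y), ∃ w : TangentSpace (𝓡 k) (𝒢.one y),
    mfderiv (𝓡 k) (𝓡 n) 𝒢.s (𝒢.one y) w = 0 ∧ mfderiv (𝓡 k) (𝓡 n) 𝒢.t (𝒢.one y) w = v

variable {𝒢}

theorem IsTransitive.exists_tangent (h : 𝒢.IsTransitive) (g : Γ)
    (v : TangentSpace (𝓡 n) (𝒢.t g)) : ∃ w : TangentSpace (𝓡 k) g,
      mfderiv (𝓡 k) (𝓡 n) 𝒢.s g w = 0 ∧ mfderiv (𝓡 k) (𝓡 n) 𝒢.t g w = v := by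
  obtain ⟨w, hw, hv⟩ := h (𝒢.t g) v
  exact ⟨𝒢.rightTranslate g w, 𝒢.mfderiv_s_rightTranslate hw,
    (𝒢.mfderiv_t_rightTranslate hw).trans hv⟩

theorem contMDiff_fiber_t (x : M) : ContMDiff (𝓡 (sourceFiberDim n k)) (𝓡 n) ∞
    (fun u : 𝒢.SourceFiber x => 𝒢.t u.1) :=
  𝒢.contMDiff_t.comp (𝒢.contMDiff_sourceFiber_val x)

theorem mfderiv_fiber_t {x : M} (u : 𝒢.SourceFiber x)
    (w : TangentSpace (𝓡 (sourceFiberDim n k)) u) :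
    mfderiv (𝓡 (sourceFiberDim n k)) (𝓡 n) (fun u : 𝒢.SourceFiber x => 𝒢.t u.1) u w =
      mfderiv (𝓡 k) (𝓡 n) 𝒢.t u.1 (mfderiv (𝓡 (sourceFiberDim n k)) (𝓡 k)
        (fun u : 𝒢.SourceFiber x => u.1) u w) :=
  DFunLike.congr_fun (mfderiv_comp u (𝒢.contMDiff_t.contMDiffAt.mdifferentiableAt (by simp))
    ((𝒢.contMDiff_sourceFiber_val x).contMDiffAt.mdifferentiableAt (by simp))) w

/-- Right translation makes the target map a submersion on the source fibre; a section is the slice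
through `u` of a product decomposition. -/
theorem IsTransitive.exists_fiber_section (h : 𝒢.IsTransitive) {x : M} (u : 𝒢.SourceFiber x) :
    ∃ (U : Set M) (σ : M → 𝒢.SourceFiber x), IsOpen U ∧ 𝒢.t u.1 ∈ U ∧
      ContMDiffOn (𝓡 n) (𝓡 (sourceFiberDim n k)) ∞ σ U ∧ ∀ y ∈ U, 𝒢.t (σ y).1 = y := by
  have hs : Function.Surjective (mfderiv (𝓡 (sourceFiberDim n k)) (𝓡 n)
      (fun u : 𝒢.SourceFiber x => 𝒢.t u.1) u) := fun v => by
    obtain ⟨w, hw, hv⟩ := h.exists_tangent u.1 v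
    obtain ⟨w', hw'⟩ := (𝒢.sourceFiberTangentEquiv u).surjective ⟨w, hw⟩
    have h1 := congrArg Subtype.val hw'
    rw [sourceFiberTangentEquiv_apply] at h1
    exact ⟨w', by rw [mfderiv_fiber_t, h1, hv]⟩
  obtain ⟨S⟩ := nonempty_submersionChart_of_surjective_mfderiv isOpen_univ
    (contMDiff_fiber_t x).contMDiffOn (mem_univ u) hs
  have hline : Continuous fun y : M => (y, (S.toProd u).2) := by fun_prop
  have hu : (𝒢.t u.1, (S.toProd u).2) = S.toProd u := Prod.ext (S.fst_eq u S.mem_source).symm rfl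
  refine ⟨(fun y => (y, (S.toProd u).2)) ⁻¹' S.toProd.target,
    fun y => S.toProd.symm (y, (S.toProd u).2), S.toProd.open_target.preimage hline, ?_, ?_, ?_⟩
  · rw [mem_preimage, hu]
    exact S.toProd.map_source S.mem_source
  · intro y hy
    exact (ContMDiffAt.comp y (g := S.toProd.symm) (S.smooth.contMDiffAt_symm hy)
      (contMDiffAt_id.prodMk contMDiffAt_const)).contMDiffWithinAt
  · intro y hy
    have h1 := S.fst_eq _ (S.toProd.map_target hy)
    rw [S.toProd.right_inv hy] at h1
    exact h1.symm

/-- Local sections make orbits open. An orbit that meets the orbit of `z` contains `z`, by composing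
with an inverse arrow, so the complement of an orbit is open as well and connectedness leaves one
orbit. -/
theorem IsTransitive.exists_t_eq [ConnectedSpace M] (h : 𝒢.IsTransitive) (x y : M) :
    ∃ u : 𝒢.SourceFiber x, 𝒢.t u.1 = y := by
  have hopen : ∀ x, IsOpen (range fun u : 𝒢.SourceFiber x => 𝒢.t u.1) := fun x => by
    rw [isOpen_iff_mem_nhds]
    rintro _ ⟨u, rfl⟩
    obtain ⟨U, σ, hU, hu, -, hσ⟩ := h.exists_fiber_section u
    exact mem_of_superset (hU.mem_nhds hu) fun y hy => ⟨σ y, hσ y hy⟩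
  have hclosed : IsClosed (range fun u : 𝒢.SourceFiber x => 𝒢.t u.1) := by
    rw [← isOpen_compl_iff, isOpen_iff_mem_nhds]
    intro z hz
    refine mem_of_superset ((hopen z).mem_nhds ⟨𝒢.fiberOne z, 𝒢.t_one z⟩) ?_
    rintro _ ⟨v, rfl⟩ ⟨u, hu⟩
    refine hz ⟨⟨𝒢.mul (𝒢.inv v.1) u.1, ?_⟩, ?_⟩
    · rw [𝒢.s_mul _ _ ((𝒢.s_inv _).trans hu.symm), u.2]
    · exact (𝒢.t_mul _ _ ((𝒢.s_inv _).trans hu.symm)).trans ((𝒢.t_inv _).trans v.2)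
  have h1 : range (fun u : 𝒢.SourceFiber x => 𝒢.t u.1) = univ :=
    IsClopen.eq_univ ⟨hclosed, hopen x⟩ ⟨_, 𝒢.fiberOne x, rfl⟩
  exact (h1.symm ▸ mem_univ y :)

/-- Given `(v₁, v₂)`, lift `v₁` along `ds` to `w`, then correct `dt w` to `v₂` by a vector of `ker
ds`, on which `dt` is still surjective. -/
theorem IsTransitive.nonempty_submersionChart (h : 𝒢.IsTransitive) (g : Γ) :
    Nonempty (SubmersionChart (𝓡 k) ((𝓡 n).prod (𝓡 n)) (fun g => (𝒢.s g, 𝒢.t g)) g) := by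
  refine nonempty_submersionChart_of_surjective_mfderiv isOpen_univ
    (𝒢.contMDiff_s.prodMk 𝒢.contMDiff_t).contMDiffOn (mem_univ g) ?_
  rw [mfderiv_prodMk (𝒢.contMDiff_s.contMDiffAt.mdifferentiableAt (by simp))
    (𝒢.contMDiff_t.contMDiffAt.mdifferentiableAt (by simp))]
  rintro ⟨v₁, v₂⟩
  obtain ⟨w, hw⟩ := 𝒢.surjective_mfderiv_s g v₁
  obtain ⟨w', hw', hw2⟩ := h.exists_tangent g
    (v₂ - (show EuclideanSpace ℝ (Fin n) from mfderiv (𝓡 k) (𝓡 n) 𝒢.t g w))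
  refine ⟨w + w', Prod.ext ?_ ?_⟩
  · refine (map_add (mfderiv (𝓡 k) (𝓡 n) 𝒢.s g) w w').trans ?_
    have h0 : ∀ a b c : EuclideanSpace ℝ (Fin n), a = c → b = 0 → a + b = c := fun a b c h h' => by
      rw [h, h', add_zero]
    exact h0 _ _ _ hw hw'
  · refine (map_add (mfderiv (𝓡 k) (𝓡 n) 𝒢.t g) w w').trans ?_
    have h0 : ∀ a b c : EuclideanSpace ℝ (Fin n), b = c - a → a + b = c := fun a b c h => by
      rw [h, add_sub_cancel]
    exact h0 _ _ _ hw2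

variable (n k) in
/-- The dimension of the isotropy groups of a transitive groupoid. -/
noncomputable abbrev isotropyDim : ℕ :=
  finrank ℝ (EuclideanSpace ℝ (Fin k)) -
    finrank ℝ (EuclideanSpace ℝ (Fin n) × EuclideanSpace ℝ (Fin n))

variable (𝒢) in
theorem isEmbedding_isotropy (x : M) : IsEmbedding (fun u : 𝒢.Isotropy x => u.1) :=
  IsEmbedding.subtypeVal

variable (𝒢) in
theorem range_isotropy (x : M) :
    range (fun u : 𝒢.Isotropy x => u.1) = (fun g => (𝒢.s g, 𝒢.t g)) ⁻¹' {(x, x)} := by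
  ext g
  simp only [mem_preimage, mem_singleton_iff, Prod.mk.injEq]
  exact ⟨fun ⟨u, hu⟩ => hu ▸ u.2, fun hg => ⟨⟨g, hg⟩, rfl⟩⟩

/-- The manifold structure of an isotropy group of a transitive groupoid. -/
@[reducible] noncomputable def isotropyChartedSpace (h : 𝒢.IsTransitive) (x : M) :
    ChartedSpace (EuclideanSpace ℝ (Fin (isotropyDim n k))) (𝒢.Isotropy x) :=
  fiberChartedSpace (𝒢.isEmbedding_isotropy x) (𝒢.range_isotropy x)
    (fun u => (h.nonempty_submersionChart u.1).some)

theorem isManifold_isotropy (h : 𝒢.IsTransitive) (x : M) :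
    letI := isotropyChartedSpace h x
    IsManifold (𝓡 (isotropyDim n k)) ∞ (𝒢.Isotropy x) :=
  fiber_isManifold (𝒢.isEmbedding_isotropy x) (𝒢.range_isotropy x)
    (fun u => (h.nonempty_submersionChart u.1).some)

theorem isSmoothEmbedding_isotropy (h : 𝒢.IsTransitive) (x : M) :
    letI := isotropyChartedSpace h x
    IsSmoothEmbedding (𝓡 (isotropyDim n k)) (𝓡 k) ∞ (fun u : 𝒢.Isotropy x => u.1) :=
  fiber_isSmoothEmbedding (𝒢.isEmbedding_isotropy x) (𝒢.range_isotropy x)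
    (fun u => (h.nonempty_submersionChart u.1).some)

/-- The operations are restrictions of those of `Γ`, and smoothness into an embedded submanifold can
be tested in `Γ`. -/
theorem lieGroup_isotropy (h : 𝒢.IsTransitive) (x : M) :
    letI := isotropyChartedSpace h x
    LieGroup (𝓡 (isotropyDim n k)) ∞ (𝒢.Isotropy x) := by
  let := isotropyChartedSpace h x
  have hM := isManifold_isotropy h x
  have he := isSmoothEmbedding_isotropy h x
  have h1 : ContMDiff ((𝓡 (isotropyDim n k)).prod (𝓡 (isotropyDim n k))) (𝓡 (isotropyDim n k)) ∞
      (fun q : 𝒢.Isotropy x × 𝒢.Isotropy x => q.1 * q.2) :=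
    he.contMDiff_of_comp fun q => 𝒢.contMDiffAt_mul (f := fun q : 𝒢.Isotropy x × 𝒢.Isotropy x => q.1.1)
      (g := fun q => q.2.1) (he.contMDiff.comp contMDiff_fst).contMDiffAt
      (he.contMDiff.comp contMDiff_snd).contMDiffAt
      (Eventually.of_forall fun q => q.1.2.1.trans q.2.2.2.symm)
  have h2 : ContMDiff (𝓡 (isotropyDim n k)) (𝓡 (isotropyDim n k)) ∞
      (fun q : 𝒢.Isotropy x => q⁻¹) :=
    he.contMDiff_of_comp (𝒢.contMDiff_inv.comp he.contMDiff)
  exact { hM with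
    contMDiff_mul := h1
    contMDiff_inv := h2 }

open scoped Classical in
variable (𝒢) in
/-- The element of the isotropy group that takes `u` to `v`, if they have the same target. -/
noncomputable def fiberDiv {x : M} (u v : 𝒢.SourceFiber x) : 𝒢.Isotropy x :=
  if h : 𝒢.t u.1 = 𝒢.t v.1 then ⟨𝒢.mul (𝒢.inv u.1) v.1,
    (𝒢.s_mul _ _ ((𝒢.s_inv _).trans h)).trans v.2,
    (𝒢.t_mul _ _ ((𝒢.s_inv _).trans h)).trans ((𝒢.t_inv _).trans u.2)⟩
  else 1

theorem fiberDiv_val {x : M} {u v : 𝒢.SourceFiber x} (h : 𝒢.t u.1 = 𝒢.t v.1) :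
    (𝒢.fiberDiv u v).1 = 𝒢.mul (𝒢.inv u.1) v.1 :=
  congrArg Subtype.val (dif_pos h)

theorem sourceFiberMul_fiberDiv {x : M} {u v : 𝒢.SourceFiber x} (h : 𝒢.t u.1 = 𝒢.t v.1) :
    𝒢.sourceFiberMul u (𝒢.fiberDiv u v) = v := by
  refine Subtype.ext ?_
  change 𝒢.mul u.1 (𝒢.fiberDiv u v).1 = v.1
  rw [fiberDiv_val h, ← 𝒢.mul_assoc _ _ _ (𝒢.t_inv _).symm ((𝒢.s_inv _).trans h), 𝒢.mul_inv, h,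
    𝒢.one_mul]

theorem t_sourceFiberMul {x : M} (u : 𝒢.SourceFiber x) (g : 𝒢.Isotropy x) :
    𝒢.t (𝒢.sourceFiberMul u g).1 = 𝒢.t u.1 :=
  𝒢.t_mul _ _ (u.2.trans g.2.2.symm)

theorem fiberDiv_mul {x : M} {u v : 𝒢.SourceFiber x} (h : 𝒢.t u.1 = 𝒢.t v.1)
    (g : 𝒢.Isotropy x) : 𝒢.fiberDiv u (𝒢.sourceFiberMul v g) = 𝒢.fiberDiv u v * g := by
  refine Subtype.ext ?_
  rw [fiberDiv_val (h.trans (t_sourceFiberMul v g).symm)]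
  change 𝒢.mul (𝒢.inv u.1) (𝒢.mul v.1 g.1) = 𝒢.mul (𝒢.fiberDiv u v).1 g.1
  rw [fiberDiv_val h, 𝒢.mul_assoc _ _ _ ((𝒢.s_inv _).trans h) (v.2.trans g.2.2.symm)]

theorem fiberDiv_sourceFiberMul {x : M} (u : 𝒢.SourceFiber x) (g : 𝒢.Isotropy x) :
    𝒢.fiberDiv u (𝒢.sourceFiberMul u g) = g := by
  refine Subtype.ext ?_
  rw [fiberDiv_val (t_sourceFiberMul u g).symm]
  exact 𝒢.inv_mul_cancel_left (u.2.trans g.2.2.symm)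

theorem contMDiff_sourceFiberMul (h : 𝒢.IsTransitive) (x : M) :
    letI := isotropyChartedSpace h x
    ContMDiff ((𝓡 (sourceFiberDim n k)).prod (𝓡 (isotropyDim n k))) (𝓡 (sourceFiberDim n k)) ∞
      (fun q : 𝒢.SourceFiber x × 𝒢.Isotropy x => 𝒢.sourceFiberMul q.1 q.2) := by
  let := isotropyChartedSpace h x
  have he := isSmoothEmbedding_isotropy h x
  exact (𝒢.isSmoothEmbedding_sourceFiber x).contMDiff_of_comp fun q =>
    𝒢.contMDiffAt_mul (f := fun q : 𝒢.SourceFiber x × 𝒢.Isotropy x => q.1.1)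
      (g := fun q => q.2.1) ((𝒢.contMDiff_sourceFiber_val x).comp contMDiff_fst).contMDiffAt
      (he.contMDiff.comp contMDiff_snd).contMDiffAt
      (Eventually.of_forall fun q => q.1.2.trans q.2.2.2.symm)

/-- The source fibre of a transitive Lie groupoid, as a principal bundle. -/
noncomputable def sourceFiberBundle [ConnectedSpace M] (h : 𝒢.IsTransitive) (x : M) :
    letI := isotropyChartedSpace h x
    PrincipalBundle n (sourceFiberDim n k) (isotropyDim n k) M (𝒢.SourceFiber x)
      (𝒢.Isotropy x) :=
  letI := isotropyChartedSpace h x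
  { t2Space := haveI := 𝒢.t2Space; (𝒢.isEmbedding_sourceFiber x).t2Space
    secondCountable := haveI := 𝒢.secondCountable
      (𝒢.isEmbedding_sourceFiber x).secondCountableTopology
    lieGroup := lieGroup_isotropy h x
    proj := fun u => 𝒢.t u.1
    act := 𝒢.sourceFiberMul
    act_one := fun u => Subtype.ext (by
      have h := 𝒢.mul_one u.1
      rw [u.2] at h
      exact h)
    act_mul := fun u g h => Subtype.ext
      (𝒢.mul_assoc _ _ _ (u.2.trans g.2.2.symm) (g.2.1.trans h.2.2.symm)).symm
    proj_act := t_sourceFiberMul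
    contMDiff_proj := contMDiff_fiber_t x
    contMDiff_act := contMDiff_sourceFiberMul h x
    exists_localTriv := fun y => by
      have he := isSmoothEmbedding_isotropy h x
      obtain ⟨u₀, hu₀⟩ := h.exists_t_eq x y
      obtain ⟨U, σ, hU, hyU, hσ, hσU⟩ := h.exists_fiber_section u₀
      rw [hu₀] at hyU
      have hP : IsOpen ((fun u : 𝒢.SourceFiber x => 𝒢.t u.1) ⁻¹' U) :=
        hU.preimage (contMDiff_fiber_t x).continuous
      -- The trivialization is `u ↦ (t u, σ(t u)⁻¹ u)`, with inverse `(y, g) ↦ σ(y) g`. Smoothness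
      -- of its group component is tested in `Γ`, where it is a product of smooth maps.
      have h1 : ContMDiffOn (𝓡 (sourceFiberDim n k)) ((𝓡 n).prod (𝓡 (isotropyDim n k))) ∞
          (fun u : 𝒢.SourceFiber x => (𝒢.t u.1, 𝒢.fiberDiv (σ (𝒢.t u.1)) u))
          ((fun u : 𝒢.SourceFiber x => 𝒢.t u.1) ⁻¹' U) := by
        intro u hu
        have hσu : ContMDiffAt (𝓡 (sourceFiberDim n k)) (𝓡 k) ∞
            (fun u : 𝒢.SourceFiber x => (σ (𝒢.t u.1)).1) u :=
          (𝒢.contMDiff_sourceFiber_val x).contMDiffAt.comp u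
            (ContMDiffAt.comp u (g := σ) (hσ.contMDiffAt (hU.mem_nhds hu))
              (contMDiff_fiber_t x).contMDiffAt)
        have hev : ∀ᶠ v : 𝒢.SourceFiber x in 𝓝 u, 𝒢.t (σ (𝒢.t v.1)).1 = 𝒢.t v.1 :=
          (hP.eventually_mem hu).mono fun v hv => hσU _ hv
        refine ((contMDiff_fiber_t x).contMDiffAt.prodMk
          (he.contMDiffAt_of_comp ?_)).contMDiffWithinAt
        refine (𝒢.contMDiffAt_mul (𝒢.contMDiff_inv.contMDiffAt.comp u hσu)
          (𝒢.contMDiff_sourceFiber_val x).contMDiffAt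
          (hev.mono fun v hv => (𝒢.s_inv _).trans hv)).congr_of_eventuallyEq ?_
        filter_upwards [hev] with v hv using fiberDiv_val hv
      have h2 : ContMDiffOn ((𝓡 n).prod (𝓡 (isotropyDim n k))) (𝓡 (sourceFiberDim n k)) ∞
          (fun q : M × 𝒢.Isotropy x => 𝒢.sourceFiberMul (σ q.1) q.2) (U ×ˢ univ) := by
        intro q hq
        exact (ContMDiffAt.comp q (g := fun q : 𝒢.SourceFiber x × 𝒢.Isotropy x =>
          𝒢.sourceFiberMul q.1 q.2) (f := fun q : M × 𝒢.Isotropy x => (σ q.1, q.2))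
          (contMDiff_sourceFiberMul h x).contMDiffAt
          ((ContMDiffAt.comp q (g := σ) (hσ.contMDiffAt (hU.mem_nhds hq.1))
            contMDiffAt_fst).prodMk contMDiffAt_snd)).contMDiffWithinAt
      refine ⟨U, {
        toFun := fun u => (𝒢.t u.1, 𝒢.fiberDiv (σ (𝒢.t u.1)) u)
        invFun := fun q => 𝒢.sourceFiberMul (σ q.1) q.2
        source := (fun u : 𝒢.SourceFiber x => 𝒢.t u.1) ⁻¹' U
        target := U ×ˢ univ
        map_source' := fun u hu => ⟨hu, mem_univ _⟩
        map_target' := fun q hq => by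
          rw [mem_preimage, t_sourceFiberMul, hσU _ hq.1]
          exact hq.1
        left_inv' := fun u hu => sourceFiberMul_fiberDiv (hσU _ hu)
        right_inv' := fun q hq => by
          have h3 : 𝒢.t (𝒢.sourceFiberMul (σ q.1) q.2).1 = q.1 := by
            rw [t_sourceFiberMul, hσU _ hq.1]
          refine Prod.ext h3 ?_
          simp only [h3]
          exact fiberDiv_sourceFiberMul _ _
        open_source := hP
        open_target := hU.prod isOpen_univ
        continuousOn_toFun := h1.continuousOn
        continuousOn_invFun := h2.continuousOn }, hU, hyU, rfl, rfl, h1, h2, fun _ _ => rfl,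
        fun u hu g => ?_⟩
      have h3 : 𝒢.t (𝒢.sourceFiberMul u g).1 = 𝒢.t u.1 := t_sourceFiberMul u g
      refine Prod.ext h3 ?_
      change 𝒢.fiberDiv (σ (𝒢.t (𝒢.sourceFiberMul u g).1)) _ = _
      rw [h3]
      exact fiberDiv_mul (hσU _ hu) g }

end LieGroupoid

end TransitiveGroupoids

/-! ### The Lie algebroid of a transitive groupoid as an Atiyah algebroid. -/

section AtiyahOfGroupoid

open Set Filter Topology Module

set_option linter.unusedSectionVars false

variable {n k : ℕ} {M : Type uM} [TopologicalSpace M] [ChartedSpace (EuclideanSpace ℝ (Fin n)) M]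
  [IsManifold (𝓡 n) ∞ M]
  {Γ : Type uΓ} [TopologicalSpace Γ] [ChartedSpace (EuclideanSpace ℝ (Fin k)) Γ]
  [IsManifold (𝓡 k) ∞ Γ] {𝒢 : LieGroupoid n k M Γ}
  {F : Type uF} [NormedAddCommGroup F] [NormedSpace ℝ F] [FiniteDimensional ℝ F]
  {A : M → Type uA} [TopologicalSpace (TotalSpace F A)] [∀ x, TopologicalSpace (A x)]
  [∀ x, AddCommGroup (A x)] [∀ x, Module ℝ (A x)] [FiberBundle F A] [VectorBundle ℝ F A]
  [ContMDiffVectorBundle ∞ F A (𝓡 n)] {L : LieAlgebroid n F A}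

attribute [local instance] LieGroupoid.sourceFiberChartedSpace LieGroupoid.isManifold_sourceFiber

open LieGroupoid

namespace LieAlgebroid.IsoOfGroupoid

variable (φ : L.IsoOfGroupoid 𝒢)

theorem isTransitive (φ : L.IsoOfGroupoid 𝒢) (hL : L.IsTransitive) : 𝒢.IsTransitive := fun y v => by
  obtain ⟨a, rfl⟩ := hL y v
  refine ⟨(φ.fiberEquiv y a).1, (φ.fiberEquiv y a).2, ?_⟩
  -- Second components are compared in the common model space, which avoids a heterogeneous equality
  -- between tangent spaces at the points `t 1_y` and `y`.
  have h : ∀ p q : TangentBundle (𝓡 n) M, p = q →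
      (show EuclideanSpace ℝ (Fin n) from p.2) = (show EuclideanSpace ℝ (Fin n) from q.2) := by
    rintro p _ rfl; rfl
  exact h _ _ (φ.anchor_eq y a)

/-- The value at `g` of the right-invariant extension of an element of `A`. -/
noncomputable def rightInvariant (g : Γ) : A (𝒢.t g) →ₗ[ℝ] TangentSpace (𝓡 k) g :=
  (LinearMap.ker (mfderiv (𝓡 k) (𝓡 n) 𝒢.s g).toLinearMap).subtype ∘ₗ
    (𝒢.rightTranslateEquiv g).toLinearMap ∘ₗ (φ.fiberEquiv (𝒢.t g)).toLinearMap

theorem rightInvariant_apply (g : Γ) (a : A (𝒢.t g)) :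
    φ.rightInvariant g a = 𝒢.rightTranslate g (φ.fiberEquiv (𝒢.t g) a).1 := rfl

theorem rightInvariant_injective (g : Γ) : Function.Injective (φ.rightInvariant g) :=
  Subtype.val_injective.comp
    ((𝒢.rightTranslateEquiv g).injective.comp (φ.fiberEquiv (𝒢.t g)).injective)

theorem contMDiffAt_rightInvariant {EZ : Type*} [NormedAddCommGroup EZ] [NormedSpace ℝ EZ]
    {HZ : Type*} [TopologicalSpace HZ] {IZ : ModelWithCorners ℝ EZ HZ} {Z : Type*}
    [TopologicalSpace Z] [ChartedSpace HZ Z] [IsManifold IZ ∞ Z] {g : Z → Γ} {z₀ : Z}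
    (hg : ContMDiffAt IZ (𝓡 k) ∞ g z₀) {a : ∀ z, A (𝒢.t (g z))}
    (ha : ContMDiffAt IZ ((𝓡 n).prod 𝓘(ℝ, F)) ∞
      (fun z => (⟨𝒢.t (g z), a z⟩ : TotalSpace F A)) z₀) :
    ContMDiffAt IZ (𝓡 k).tangent ∞
      (fun z => (⟨g z, φ.rightInvariant (g z) (a z)⟩ : TangentBundle (𝓡 k) Γ)) z₀ :=
  contMDiffAt_rightTranslate hg (φ.contMDiff_fiberEquiv.contMDiffAt.comp z₀ ha)
    fun z => (φ.fiberEquiv _ (a z)).2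

theorem contMDiff_rightInvariant_section (X : Cₛ^∞⟮𝓡 n; F, A⟯) :
    ContMDiff (𝓡 k) (𝓡 k).tangent ∞
      (fun g => (⟨g, φ.rightInvariant g (X (𝒢.t g))⟩ : TangentBundle (𝓡 k) Γ)) := fun g =>
  φ.contMDiffAt_rightInvariant contMDiffAt_id
    (ContMDiffAt.comp g (g := fun y => (⟨y, X y⟩ : TotalSpace F A)) X.contMDiff.contMDiffAt
      𝒢.contMDiff_t.contMDiffAt)

/-- The identification of `A` at the target of `u` with the tangent space of the source fibre. -/
noncomputable def fiberTangent {x : M} (u : 𝒢.SourceFiber x) :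
    A (𝒢.t u.1) ≃ₗ[ℝ] TangentSpace (𝓡 (sourceFiberDim n k)) u :=
  ((φ.fiberEquiv (𝒢.t u.1)).trans (𝒢.rightTranslateEquiv u.1)).trans
    (𝒢.sourceFiberTangentEquiv u).symm

theorem mfderiv_fiberTangent {x : M} (u : 𝒢.SourceFiber x) (a : A (𝒢.t u.1)) :
    mfderiv (𝓡 (sourceFiberDim n k)) (𝓡 k) (fun u : 𝒢.SourceFiber x => u.1) u
      (φ.fiberTangent u a) = φ.rightInvariant u.1 a := by
  rw [← sourceFiberTangentEquiv_apply]
  exact congrArg Subtype.val ((𝒢.sourceFiberTangentEquiv u).apply_symm_apply _)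

/-- `fiberTangent`, for a target that is only propositionally known. -/
noncomputable def fiberTangentAt {x y : M} (u : 𝒢.SourceFiber x) (h : 𝒢.t u.1 = y) :
    A y ≃ₗ[ℝ] TangentSpace (𝓡 (sourceFiberDim n k)) u :=
  h.rec (motive := fun y _ => A y ≃ₗ[ℝ] TangentSpace (𝓡 (sourceFiberDim n k)) u)
    (φ.fiberTangent u)

theorem fiberTangentAt_rfl {x : M} (u : 𝒢.SourceFiber x) :
    φ.fiberTangentAt u rfl = φ.fiberTangent u := rfl

/-- Expresses the identification by the differential of a map between source fibres, with no
derivative within a subset, so that the chain rule applies. It is proved after embedding in `Γ`,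
where it is the formula for right translation. -/
theorem fiberTangentAt_eq {x y : M} (u : 𝒢.SourceFiber x) (h : 𝒢.t u.1 = y) {a : A y}
    {w : TangentSpace (𝓡 (sourceFiberDim n k)) (𝒢.fiberOne y)}
    (hw : mfderiv (𝓡 (sourceFiberDim n k)) (𝓡 k) (fun u : 𝒢.SourceFiber y => u.1) (𝒢.fiberOne y) w
      = (φ.fiberEquiv y a).1) :
    φ.fiberTangentAt u h a = mfderiv (𝓡 (sourceFiberDim n k)) (𝓡 (sourceFiberDim n k))
      (fiberRightMul u h) (𝒢.fiberOne y) w := by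
  subst h
  apply ((𝒢.isSmoothEmbedding_sourceFiber x).isImmersion.isImmersionAt u).injective_mfderiv
  rw [fiberTangentAt_rfl, mfderiv_fiberTangent, rightInvariant_apply, ← hw, rightTranslate_fiber]
  have h1 : HasMFDerivAt (𝓡 (sourceFiberDim n k)) (𝓡 k) (fun u : 𝒢.SourceFiber x => u.1)
      (fiberRightMul u rfl (𝒢.fiberOne (𝒢.t u.1)))
      (mfderiv (𝓡 (sourceFiberDim n k)) (𝓡 k) (fun u : 𝒢.SourceFiber x => u.1) u) := by
    rw [fiberRightMul_one]
    exact ((𝒢.contMDiff_sourceFiber_val x).contMDiffAt.mdifferentiableAt (by simp)).hasMFDerivAt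
  have h2 := h1.comp (𝒢.fiberOne (𝒢.t u.1)) ((𝒢.contMDiff_fiberRightMul u
    rfl).contMDiffAt.mdifferentiableAt (by simp)).hasMFDerivAt
  exact DFunLike.congr_fun h2.mfderiv w

/-- Equivariance is associativity: right translation by `u g` is right translation by `u` followed
by right multiplication by `g`. -/
theorem fiberTangentAt_sourceFiberMul (hT : 𝒢.IsTransitive) {x y : M} (u : 𝒢.SourceFiber x)
    (h : 𝒢.t u.1 = y) (g : 𝒢.Isotropy x) (h' : 𝒢.t (𝒢.sourceFiberMul u g).1 = y) (a : A y) :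
    φ.fiberTangentAt (𝒢.sourceFiberMul u g) h' a =
      mfderiv (𝓡 (sourceFiberDim n k)) (𝓡 (sourceFiberDim n k))
        (fun v => 𝒢.sourceFiberMul v g) u (φ.fiberTangentAt u h a) := by
  obtain ⟨w, hw⟩ := 𝒢.exists_fiber_tangent (φ.fiberEquiv y a).2
  rw [φ.fiberTangentAt_eq u h hw, φ.fiberTangentAt_eq _ h' hw]
  let := isotropyChartedSpace hT x
  have hd : MDifferentiableAt (𝓡 (sourceFiberDim n k)) (𝓡 (sourceFiberDim n k))
      (fun v => 𝒢.sourceFiberMul v g) u :=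
    (ContMDiffAt.comp u (g := fun q : 𝒢.SourceFiber x × 𝒢.Isotropy x =>
      𝒢.sourceFiberMul q.1 q.2) (f := fun v => (v, g)) (contMDiff_sourceFiberMul hT x).contMDiffAt
      (contMDiffAt_id.prodMk contMDiffAt_const)).mdifferentiableAt (by simp)
  have h1 : HasMFDerivAt (𝓡 (sourceFiberDim n k)) (𝓡 (sourceFiberDim n k))
      (fun v => 𝒢.sourceFiberMul v g) (fiberRightMul u h (𝒢.fiberOne y))
      (mfderiv (𝓡 (sourceFiberDim n k)) (𝓡 (sourceFiberDim n k))
        (fun v => 𝒢.sourceFiberMul v g) u) := by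
    rw [fiberRightMul_one]
    exact hd.hasMFDerivAt
  have h2 := h1.comp (𝒢.fiberOne y) ((𝒢.contMDiff_fiberRightMul u
    h).contMDiffAt.mdifferentiableAt (by simp)).hasMFDerivAt
  have h3 : (fun v => 𝒢.sourceFiberMul v g) ∘ fiberRightMul u h =
      fiberRightMul (𝒢.sourceFiberMul u g) h' := funext fun w => Subtype.ext
    (𝒢.mul_assoc _ _ _ (w.2.trans h.symm) (u.2.trans g.2.2.symm))
  rw [h3] at h2
  exact DFunLike.congr_fun h2.mfderiv w

/-- The projection from the tangent bundle of a source fibre to `A`. -/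
noncomputable def tangentToAlgebroid {x : M}
    (v : TangentBundle (𝓡 (sourceFiberDim n k)) (𝒢.SourceFiber x)) : TotalSpace F A :=
  ⟨𝒢.t v.1.1, (φ.fiberTangent v.1).symm v.2⟩

theorem tangentToAlgebroid_fiberTangentAt {x y : M} (u : 𝒢.SourceFiber x) (h : 𝒢.t u.1 = y)
    (a : A y) : φ.tangentToAlgebroid ⟨u, φ.fiberTangentAt u h a⟩ = ⟨y, a⟩ := by
  subst h
  exact congrArg (TotalSpace.mk _) ((φ.fiberTangent u).symm_apply_apply a)

theorem exists_of_tangentToAlgebroid_eq {x : M}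
    {v : TangentBundle (𝓡 (sourceFiberDim n k)) (𝒢.SourceFiber x)} {p : TotalSpace F A}
    (h : φ.tangentToAlgebroid v = p) :
    ∃ hv : 𝒢.t v.1.1 = p.1, v.2 = φ.fiberTangentAt v.1 hv p.2 := by
  subst h
  exact ⟨rfl, ((φ.fiberTangent v.1).apply_symm_apply v.2).symm⟩

/-- Points of `P` with the same target differ by a unique isotropy element. By equivariance, vectors
there with the same image in `A` correspond under the differential of its action. -/
theorem tangentToAlgebroid_eq_iff (hT : 𝒢.IsTransitive) {x : M}
    (v w : TangentBundle (𝓡 (sourceFiberDim n k)) (𝒢.SourceFiber x)) :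
    φ.tangentToAlgebroid v = φ.tangentToAlgebroid w ↔
      ∃ g : 𝒢.Isotropy x, w = tangentMap (𝓡 (sourceFiberDim n k)) (𝓡 (sourceFiberDim n k))
        (fun u => 𝒢.sourceFiberMul u g) v := by
  obtain ⟨u, v⟩ := v
  have hv : v = φ.fiberTangentAt u rfl ((φ.fiberTangent u).symm v) :=
    ((φ.fiberTangent u).apply_symm_apply v).symm
  constructor
  · intro h
    obtain ⟨u', w⟩ := w
    obtain ⟨hu', hw⟩ := φ.exists_of_tangentToAlgebroid_eq h.symm
    have hg := sourceFiberMul_fiberDiv (u := u) (v := u') hu'.symm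
    refine ⟨𝒢.fiberDiv u u', ?_⟩
    -- Forgetting how the group element was obtained allows `u'` to be replaced by the translate of
    -- `u`.
    generalize 𝒢.fiberDiv u u' = g at hg
    subst hg
    refine congrArg (TotalSpace.mk _) (hw.trans ?_)
    have h3 := φ.fiberTangentAt_sourceFiberMul hT u rfl g hu' ((φ.fiberTangent u).symm v)
    rw [← hv] at h3
    exact h3
  · rintro ⟨g, rfl⟩
    have h3 := φ.fiberTangentAt_sourceFiberMul hT u rfl g (t_sourceFiberMul u g)
      ((φ.fiberTangent u).symm v)
    rw [← hv] at h3
    have h4 := φ.tangentToAlgebroid_fiberTangentAt (𝒢.sourceFiberMul u g)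
      (t_sourceFiberMul u g) ((φ.fiberTangent u).symm v)
    rw [h3] at h4
    exact h4.symm

/-- The right-invariant extension `A → TΓ` is smooth and fibrewise injective, and its composition
with this map is the tangent map of the inclusion of the source fibre. -/
theorem contMDiff_tangentToAlgebroid (x : M) :
    ContMDiff (𝓡 (sourceFiberDim n k)).tangent ((𝓡 n).prod 𝓘(ℝ, F)) ∞
      (φ.tangentToAlgebroid (x := x)) := by
  intro v
  have hπ : ContMDiff (𝓡 (sourceFiberDim n k)).tangent (𝓡 (sourceFiberDim n k)) ∞
      (fun v : TangentBundle (𝓡 (sourceFiberDim n k)) (𝒢.SourceFiber x) => v.1) :=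
    contMDiff_proj _
  have hb : ContMDiffAt (𝓡 (sourceFiberDim n k)).tangent (𝓡 n) ∞
      (fun v : TangentBundle (𝓡 (sourceFiberDim n k)) (𝒢.SourceFiber x) => 𝒢.t v.1.1) v :=
    ((contMDiff_fiber_t x).comp hπ).contMDiffAt
  refine contMDiffAt_of_injective_bundleMap (F' := EuclideanSpace ℝ (Fin k)) (IB' := 𝓡 k)
    (A' := fun g : Γ => TangentSpace (𝓡 k) g)
    (b' := fun v => v.1.1) hb (fun v => φ.rightInvariant v.1.1) (fun a => ?_)
    (φ.rightInvariant_injective _) ?_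
  · exact φ.contMDiffAt_rightInvariant ((𝒢.contMDiff_sourceFiber_val x).comp hπ).contMDiffAt
      (contMDiffAt_trivializationAt_symm hb a)
  · have h : ContMDiff (𝓡 (sourceFiberDim n k)).tangent (𝓡 k).tangent ∞
        (tangentMap (𝓡 (sourceFiberDim n k)) (𝓡 k) (fun u : 𝒢.SourceFiber x => u.1)) :=
      (𝒢.contMDiff_sourceFiber_val x).contMDiff_tangentMap (by simp)
    refine (h v).congr_of_eventuallyEq (Eventually.of_forall fun w => ?_)
    refine congrArg (TotalSpace.mk _) ?_
    rw [← mfderiv_fiberTangent, LinearEquiv.apply_symm_apply]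

theorem contMDiff_fiberTangent_section (X : Cₛ^∞⟮𝓡 n; F, A⟯) (x : M) :
    ContMDiff (𝓡 (sourceFiberDim n k)) (𝓡 (sourceFiberDim n k)).tangent ∞
      (fun u : 𝒢.SourceFiber x => (⟨u, φ.fiberTangent u (X (𝒢.t u.1))⟩ :
        TangentBundle (𝓡 (sourceFiberDim n k)) (𝒢.SourceFiber x))) := by
  intro u
  refine contMDiffAt_of_isImmersionAt_mfderiv (b := fun u => u)
    ((𝒢.isSmoothEmbedding_sourceFiber x).isImmersion.isImmersionAt u) contMDiffAt_id ?_
  simp only [mfderiv_fiberTangent]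
  exact ContMDiffAt.comp u (φ.contMDiff_rightInvariant_section X).contMDiffAt
    (𝒢.contMDiff_sourceFiber_val x).contMDiffAt

/-- The differential of the inclusion is injective, and the fields on the source fibre are related
by it to the right-invariant fields on `Γ`, whose bracket is known. -/
theorem fiberTangent_bracket (X Y : Cₛ^∞⟮𝓡 n; F, A⟯) {x : M} (u : 𝒢.SourceFiber x) :
    φ.fiberTangent u (L.bracket X Y (𝒢.t u.1)) =
      mlieBracket (𝓡 (sourceFiberDim n k)) (fun w => φ.fiberTangent w (X (𝒢.t w.1)))
        (fun w => φ.fiberTangent w (Y (𝒢.t w.1))) u := by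
  apply ((𝒢.isSmoothEmbedding_sourceFiber x).isImmersion.isImmersionAt u).injective_mfderiv
  rw [mfderiv_fiberTangent]
  refine (φ.bracket_eq X Y u.1).trans (mfderiv_mlieBracket_of_related
    (f := fun u : 𝒢.SourceFiber x => u.1) (𝒢.contMDiff_sourceFiber_val x).contMDiffAt
    ((φ.contMDiff_fiberTangent_section X x).contMDiffAt.mdifferentiableAt (by simp))
    ((φ.contMDiff_fiberTangent_section Y x).contMDiffAt.mdifferentiableAt (by simp))
    ((φ.contMDiff_rightInvariant_section X).contMDiffAt.mdifferentiableAt (by simp))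
    ((φ.contMDiff_rightInvariant_section Y).contMDiffAt.mdifferentiableAt (by simp))
    (Eventually.of_forall fun w => φ.mfderiv_fiberTangent w _)
    (Eventually.of_forall fun w => φ.mfderiv_fiberTangent w _)).symm

theorem anchor_eq_fiberTangent {x : M} (u : 𝒢.SourceFiber x) (a : A (𝒢.t u.1)) :
    L.anchor (𝒢.t u.1) a = mfderiv (𝓡 (sourceFiberDim n k)) (𝓡 n)
      (fun u : 𝒢.SourceFiber x => 𝒢.t u.1) u (φ.fiberTangent u a) := by
  refine Eq.symm ((mfderiv_fiber_t u _).trans ?_)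
  rw [mfderiv_fiberTangent, rightInvariant_apply]
  refine (𝒢.mfderiv_t_rightTranslate (φ.fiberEquiv _ a).2).trans ?_
  have h : ∀ p q : TangentBundle (𝓡 n) M, p = q →
      (show EuclideanSpace ℝ (Fin n) from p.2) = (show EuclideanSpace ℝ (Fin n) from q.2) := by
    rintro p _ rfl; rfl
  exact h _ _ (φ.anchor_eq _ a)

/-- A transitive Lie algebroid of a groupoid is the Atiyah algebroid of a source fibre. -/
noncomputable def atiyahIso [ConnectedSpace M] (hT : 𝒢.IsTransitive) (x : M) :
    letI := isotropyChartedSpace hT x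
    L.AtiyahIso (sourceFiberBundle hT x) :=
  letI := isotropyChartedSpace hT x
  { toEquiv := Equiv.ofBijective
      (Quot.lift φ.tangentToAlgebroid fun v w h => (φ.tangentToAlgebroid_eq_iff hT v w).2 h)
      ⟨by
        rintro ⟨v⟩ ⟨w⟩ h
        exact Quot.sound ((φ.tangentToAlgebroid_eq_iff hT v w).1 h), fun ⟨y, a⟩ => by
        obtain ⟨u, hu⟩ := hT.exists_t_eq x y
        exact ⟨Quot.mk _ ⟨u, φ.fiberTangentAt u hu a⟩,
          φ.tangentToAlgebroid_fiberTangentAt u hu a⟩⟩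
    fiberEquiv := fun u => (φ.fiberTangent u).symm
    toEquiv_mk := fun _ _ => rfl
    contMDiff_toEquiv_mk := φ.contMDiff_tangentToAlgebroid x
    anchor_eq := fun u v => by
      have h := φ.anchor_eq_fiberTangent u ((φ.fiberTangent u).symm v)
      rw [LinearEquiv.apply_symm_apply] at h
      exact h
    bracket_eq := fun X Y u => φ.fiberTangent_bracket X Y u }

end LieAlgebroid.IsoOfGroupoid

end AtiyahOfGroupoid

/-! ### The quotient manifold `(P × P)/G`. -/

section GaugeManifold

open Set Filter Topology Module

set_option linter.unusedSectionVars false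

namespace PrincipalBundle

variable {n p d : ℕ} {M : Type uM} [TopologicalSpace M]
  [ChartedSpace (EuclideanSpace ℝ (Fin n)) M] [IsManifold (𝓡 n) ∞ M]
  {P : Type uP} [TopologicalSpace P] [ChartedSpace (EuclideanSpace ℝ (Fin p)) P]
  [IsManifold (𝓡 p) ∞ P]
  {G : Type uG} [TopologicalSpace G] [ChartedSpace (EuclideanSpace ℝ (Fin d)) G] [Group G]
  (B : PrincipalBundle n p d M P G)
  {EZ : Type*} [NormedAddCommGroup EZ] [NormedSpace ℝ EZ] {HZ : Type*} [TopologicalSpace HZ]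
  {IZ : ModelWithCorners ℝ EZ HZ} {Z : Type*} [TopologicalSpace Z] [ChartedSpace HZ Z]

/-- A smooth section over an open subset. -/
structure LocalSection where
  /-- the domain -/
  dom : Set M
  /-- the section, with arbitrary values outside of the domain -/
  toFun : M → P
  isOpen_dom : IsOpen dom
  contMDiffOn : ContMDiffOn (𝓡 n) (𝓡 p) ∞ toFun dom
  proj_toFun : ∀ y ∈ dom, B.proj (toFun y) = y

/-- In a trivialization, the section through `v` is the one with constant group component. -/
theorem exists_localSection (v : P) :
    ∃ S : B.LocalSection, B.proj v ∈ S.dom ∧ S.toFun (B.proj v) = v := by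
  obtain ⟨U, e, hU, hv, hes, het, -, he, h1, -⟩ := B.exists_localTriv (B.proj v)
  have hve : v ∈ e.source := hes ▸ hv
  have hmem : ∀ y ∈ U, (y, (e v).2) ∈ e.target := fun y hy => het ▸ ⟨hy, mem_univ _⟩
  refine ⟨⟨U, fun y => e.symm (y, (e v).2), hU, fun y hy => ?_, fun y hy => ?_⟩, hv, ?_⟩
  · exact (ContMDiffAt.comp y (g := e.symm)
      (he.contMDiffAt (e.open_target.mem_nhds (hmem y hy)))
      (contMDiffAt_id.prodMk contMDiffAt_const)).contMDiffWithinAt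
  · rw [← h1 _ (e.map_target (hmem y hy)), e.right_inv (hmem y hy)]
  · change e.symm (B.proj v, (e v).2) = v
    rw [← h1 v hve]
    exact e.left_inv hve

theorem exists_proj_eq (x : M) : ∃ u, B.proj u = x := by
  obtain ⟨U, e, -, hx, hes, het, -, -, h1, -⟩ := B.exists_localTriv x
  have h2 : (x, (1 : G)) ∈ e.target := het ▸ ⟨hx, mem_univ _⟩
  exact ⟨e.symm (x, 1), by rw [← h1 _ (e.map_target h2), e.right_inv h2]⟩

theorem act_injective (u : P) : Function.Injective (B.act u) := fun g h hgh => by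
  obtain ⟨U, e, -, hx, hes, -, -, -, -, h2⟩ := B.exists_localTriv (B.proj u)
  have hu : u ∈ e.source := hes ▸ hx
  have h3 := congrArg (fun v => (e v).2) hgh
  simp only [h2 u hu] at h3
  exact mul_left_cancel h3

theorem exists_act_eq {u v : P} (h : B.proj u = B.proj v) : ∃ g, B.act u g = v := by
  obtain ⟨U, e, -, hx, hes, -, -, -, h1, h2⟩ := B.exists_localTriv (B.proj u)
  have hu : u ∈ e.source := hes ▸ hx
  have hv : v ∈ e.source := hes ▸ (show B.proj v ∈ U from h ▸ hx)
  have hug : B.act u ((e u).2⁻¹ * (e v).2) ∈ e.source :=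
    hes ▸ (show B.proj (B.act u _) ∈ U from (B.proj_act u _).symm ▸ hx)
  refine ⟨(e u).2⁻¹ * (e v).2, e.injOn hug hv ?_⟩
  rw [h2 u hu]
  exact Prod.ext ((h1 u hu).trans (h.trans (h1 v hv).symm)) (mul_inv_cancel_left _ _)

open scoped Classical in
/-- The group element that takes `u` to `v`, if they are in the same fibre. -/
noncomputable def div (u v : P) : G := if h : ∃ g, B.act u g = v then h.choose else 1

variable {B}

theorem act_div {u v : P} (h : B.proj u = B.proj v) : B.act u (B.div u v) = v := by
  have h' := B.exists_act_eq h
  rw [div, dif_pos h']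
  exact h'.choose_spec

theorem div_eq {u v : P} {g : G} (h : B.act u g = v) : B.div u v = g :=
  B.act_injective u ((act_div (by rw [← h, B.proj_act])).trans h.symm)

theorem act_act_inv (u : P) (g : G) : B.act (B.act u g) g⁻¹ = u := by
  rw [← B.act_mul, mul_inv_cancel, B.act_one]

theorem contMDiffAt_act {f : Z → P} {g : Z → G} {z : Z} (hf : ContMDiffAt IZ (𝓡 p) ∞ f z)
    (hg : ContMDiffAt IZ (𝓡 d) ∞ g z) : ContMDiffAt IZ (𝓡 p) ∞ (fun z => B.act (f z) (g z)) z :=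
  ContMDiffAt.comp z (g := fun q : P × G => B.act q.1 q.2) (f := fun z => (f z, g z))
    B.contMDiff_act.contMDiffAt (hf.prodMk hg)

/-- In a trivialization the quotient of two points of a fibre is `g⁻¹ g'`, with `g` and `g'` their
group components. -/
theorem contMDiffAt_div {f f' : Z → P} {z : Z} (hf : ContMDiffAt IZ (𝓡 p) ∞ f z)
    (hf' : ContMDiffAt IZ (𝓡 p) ∞ f' z) (h : ∀ᶠ z in 𝓝 z, B.proj (f z) = B.proj (f' z)) :
    ContMDiffAt IZ (𝓡 d) ∞ (fun z => B.div (f z) (f' z)) z := by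
  have := B.lieGroup
  obtain ⟨U, e, -, hx, hes, -, he, -, h1, h2⟩ := B.exists_localTriv (B.proj (f z))
  have hfz : f z ∈ e.source := hes ▸ hx
  have hfz' : f' z ∈ e.source := hes ▸ (show B.proj (f' z) ∈ U from h.self_of_nhds ▸ hx)
  have hs : ∀ {f : Z → P}, ContMDiffAt IZ (𝓡 p) ∞ f z → f z ∈ e.source →
      ContMDiffAt IZ (𝓡 d) ∞ (fun z => (e (f z)).2) z := fun {f} hf hfz =>
    contMDiffAt_snd.comp z (ContMDiffAt.comp z (g := e)
      (he.contMDiffAt (e.open_source.mem_nhds hfz)) hf)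
  refine ((hs hf hfz).inv.mul (hs hf' hfz')).congr_of_eventuallyEq ?_
  filter_upwards [h, hf.continuousAt.eventually (e.open_source.eventually_mem hfz)] with z hz hez
  have h3 := h2 _ hez (B.div (f z) (f' z))
  rw [act_div hz] at h3
  simp [h3]

theorem contMDiffAt_act_const (g : G) (u : P) :
    ContMDiffAt (𝓡 p) (𝓡 p) ∞ (fun u => B.act u g) u :=
  contMDiffAt_act contMDiffAt_id contMDiffAt_const

theorem gaugeMk_act (u v : P) (g : G) :
    B.gaugeMk (B.act u g, B.act v g) = B.gaugeMk (u, v) :=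
  (Quot.sound ⟨g, rfl⟩).symm

theorem gaugeMk_eq_iff (a b : P × P) :
    B.gaugeMk a = B.gaugeMk b ↔ ∃ g : G, b = (B.act a.1 g, B.act a.2 g) := by
  refine Equivalence.quot_mk_eq_iff (r := fun a b : P × P => ∃ g : G, b = (B.act a.1 g, B.act a.2 g))
    ⟨fun a => ⟨1, by simp [B.act_one]⟩, ?_, ?_⟩ a b
  · rintro ⟨u, v⟩ _ ⟨g, rfl⟩
    exact ⟨g⁻¹, by simp [act_act_inv]⟩
  · rintro ⟨u, v⟩ _ _ ⟨g, rfl⟩ ⟨h, rfl⟩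
    exact ⟨g * h, by simp [B.act_mul]⟩

variable (B) in
/-- A representative of an arrow of the gauge groupoid. -/
noncomputable def gaugeOut (a : B.Gauge) : P × P := Quot.out a

theorem gaugeMk_out (a : B.Gauge) : B.gaugeMk (B.gaugeOut a) = a := Quot.out_eq a

theorem exists_gaugeOut_eq (u v : P) :
    ∃ g : G, B.gaugeOut (B.gaugeMk (u, v)) = (B.act u g, B.act v g) :=
  (gaugeMk_eq_iff (u, v) _).1 (gaugeMk_out (B.gaugeMk (u, v))).symm

theorem exists_gaugeMk (a : B.Gauge) : ∃ u v, B.gaugeMk (u, v) = a :=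
  ⟨_, _, gaugeMk_out a⟩

/-- The saturation of an open set is the union of its translates by the group. Openness of the map
lets continuity and neighbourhoods be tested on representatives. -/
theorem isOpenQuotientMap_gaugeMk : IsOpenQuotientMap B.gaugeMk := by
  refine ⟨Quot.mk_surjective, continuous_quot_mk, fun W hW => ?_⟩
  refine isQuotientMap_quot_mk.isOpen_preimage.1 ?_
  have h : B.gaugeMk ⁻¹' (B.gaugeMk '' W) =
      ⋃ g : G, (fun a : P × P => (B.act a.1 g, B.act a.2 g)) ⁻¹' W := by
    ext a
    simp only [mem_preimage, mem_image, mem_iUnion]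
    constructor
    · rintro ⟨b, hb, hab⟩
      obtain ⟨g, rfl⟩ := (gaugeMk_eq_iff a b).1 hab.symm
      exact ⟨g, hb⟩
    · rintro ⟨g, hg⟩
      exact ⟨_, hg, gaugeMk_act _ _ g⟩
  change IsOpen (B.gaugeMk ⁻¹' (B.gaugeMk '' W))
  rw [h]
  refine isOpen_iUnion fun g => hW.preimage ?_
  have hg : Continuous fun u => B.act u g :=
    continuous_iff_continuousAt.2 fun u => (contMDiffAt_act_const g u).continuousAt
  exact (hg.comp continuous_fst).prodMk (hg.comp continuous_snd)

variable (B) in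
/-- The source of an arrow. -/
noncomputable def gaugeSource (a : B.Gauge) : M := B.proj (B.gaugeOut a).2

variable (B) in
/-- The target of an arrow. -/
noncomputable def gaugeTarget (a : B.Gauge) : M := B.proj (B.gaugeOut a).1

theorem gaugeSource_mk (u v : P) : B.gaugeSource (B.gaugeMk (u, v)) = B.proj v := by
  obtain ⟨g, hg⟩ := exists_gaugeOut_eq (B := B) u v
  rw [gaugeSource, hg, B.proj_act]

theorem gaugeTarget_mk (u v : P) : B.gaugeTarget (B.gaugeMk (u, v)) = B.proj u := by
  obtain ⟨g, hg⟩ := exists_gaugeOut_eq (B := B) u v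
  rw [gaugeTarget, hg, B.proj_act]

theorem continuous_gaugeSource : Continuous B.gaugeSource := by
  rw [← isOpenQuotientMap_gaugeMk.continuous_comp_iff]
  exact (B.contMDiff_proj.continuous.comp continuous_snd).congr fun a => (gaugeSource_mk _ _).symm

namespace LocalSection

variable (S S' : B.LocalSection)

/-- The element `u` for which `a` is the class of `u` and the value of the section. -/
noncomputable def coord (a : B.Gauge) : P :=
  B.act (B.gaugeOut a).1 (B.div (B.gaugeOut a).2 (S.toFun (B.gaugeSource a)))

variable {S S'}

/-- A representative `(u g, v g)` changes the quotient in the definition by `g⁻¹` on the left, which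
cancels against the translation of `u`. -/
theorem coord_mk {u v : P} (hv : B.proj v ∈ S.dom) :
    S.coord (B.gaugeMk (u, v)) = B.act u (B.div v (S.toFun (B.proj v))) := by
  obtain ⟨g, hg⟩ := exists_gaugeOut_eq (B := B) u v
  have h2 : B.proj v = B.proj (S.toFun (B.proj v)) := (S.proj_toFun _ hv).symm
  rw [coord, gaugeSource_mk, hg, ← B.act_mul]
  congr 1
  refine (div_eq ?_).symm
  rw [B.act_mul, act_div ((B.proj_act v g).trans h2)]

theorem coord_mk_section {u : P} {y : M} (hy : y ∈ S.dom) :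
    S.coord (B.gaugeMk (u, S.toFun y)) = u := by
  have h := S.proj_toFun y hy
  rw [coord_mk (h.symm ▸ hy), h, div_eq (B.act_one _), B.act_one]

theorem gaugeMk_coord {a : B.Gauge} (ha : B.gaugeSource a ∈ S.dom) :
    B.gaugeMk (S.coord a, S.toFun (B.gaugeSource a)) = a := by
  obtain ⟨u, v, rfl⟩ := exists_gaugeMk a
  rw [gaugeSource_mk] at ha ⊢
  have h2 : B.proj v = B.proj (S.toFun (B.proj v)) := (S.proj_toFun _ ha).symm
  rw [coord_mk ha]
  conv_lhs => rw [← act_div h2]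
  rw [act_div h2]
  have h3 := gaugeMk_act (B := B) u v (B.div v (S.toFun (B.proj v)))
  rwa [act_div h2] at h3

theorem contMDiffAt_toFun_proj {v : P} (hv : B.proj v ∈ S.dom) :
    ContMDiffAt (𝓡 p) (𝓡 p) ∞ (fun v => S.toFun (B.proj v)) v :=
  ContMDiffAt.comp v (g := S.toFun) (S.contMDiffOn.contMDiffAt (S.isOpen_dom.mem_nhds hv))
    B.contMDiff_proj.contMDiffAt

theorem contMDiffAt_coord_mk {a : P × P} (ha : B.proj a.2 ∈ S.dom) :
    ContMDiffAt ((𝓡 p).prod (𝓡 p)) (𝓡 p) ∞ (fun a => S.coord (B.gaugeMk a)) a := by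
  have hev : ∀ᶠ b : P × P in 𝓝 a, B.proj b.2 ∈ S.dom :=
    (B.contMDiff_proj.continuous.comp continuous_snd).continuousAt.eventually
      (S.isOpen_dom.eventually_mem ha)
  refine (contMDiffAt_act (B := B) (f := fun a : P × P => a.1)
    (g := fun a => B.div a.2 (S.toFun (B.proj a.2))) contMDiffAt_fst
    (contMDiffAt_div contMDiffAt_snd ((contMDiffAt_toFun_proj ha).comp a contMDiffAt_snd)
      (hev.mono fun b hb => (S.proj_toFun _ hb).symm))).congr_of_eventuallyEq ?_
  filter_upwards [hev] with b hb using coord_mk hb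

variable (S) in
/-- The chart of the gauge groupoid given by a local section. -/
noncomputable def gaugeChart : OpenPartialHomeomorph B.Gauge (M × P) where
  toFun a := (B.gaugeSource a, S.coord a)
  invFun q := B.gaugeMk (q.2, S.toFun q.1)
  source := B.gaugeSource ⁻¹' S.dom
  target := S.dom ×ˢ univ
  map_source' _ ha := ⟨ha, mem_univ _⟩
  map_target' q hq := by
    rw [mem_preimage, gaugeSource_mk, S.proj_toFun _ hq.1]
    exact hq.1
  left_inv' _ ha := gaugeMk_coord ha
  right_inv' q hq := Prod.ext ((gaugeSource_mk _ _).trans (S.proj_toFun _ hq.1))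
    (coord_mk_section hq.1)
  open_source := S.isOpen_dom.preimage continuous_gaugeSource
  open_target := S.isOpen_dom.prod isOpen_univ
  continuousOn_toFun a ha := by
    refine (continuous_gaugeSource.continuousAt.prodMk ?_).continuousWithinAt
    obtain ⟨u, v, rfl⟩ := exists_gaugeMk a
    rw [mem_preimage, gaugeSource_mk] at ha
    exact isOpenQuotientMap_gaugeMk.continuousAt_comp_iff.1
      (contMDiffAt_coord_mk (a := (u, v)) ha).continuousAt
  continuousOn_invFun q hq := by
    refine (isOpenQuotientMap_gaugeMk.continuous.continuousAt.comp
      (f := fun q : M × P => (q.2, S.toFun q.1)) (continuousAt_snd.prodMk ?_)).continuousWithinAt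
    exact ((S.contMDiffOn.contMDiffAt (S.isOpen_dom.mem_nhds hq.1)).continuousAt).comp
      continuousAt_fst

/-- A change of charts sends `(y, u)` first to the pair `(u, S y)` and then through the chart of the
second section, which is smooth on representatives. -/
theorem gaugeChart_compatible :
    ContMDiffOn ((𝓡 n).prod (𝓡 p)) ((𝓡 n).prod (𝓡 p)) ∞ (S'.gaugeChart ∘ S.gaugeChart.symm)
      (S.gaugeChart.symm ≫ₕ S'.gaugeChart).source := by
  rintro ⟨y, u⟩ hq
  obtain ⟨⟨hy, -⟩, hy'⟩ := hq
  have hs := S.contMDiffOn.contMDiffAt (S.isOpen_dom.mem_nhds hy)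
  have hm : ContMDiffAt ((𝓡 n).prod (𝓡 p)) ((𝓡 p).prod (𝓡 p)) ∞
      (fun q : M × P => (q.2, S.toFun q.1)) (y, u) :=
    contMDiffAt_snd.prodMk (ContMDiffAt.comp (y, u) (g := S.toFun) hs contMDiffAt_fst)
  have hy2 : B.proj (S.toFun y) ∈ S'.dom := by
    have h : B.gaugeSource (B.gaugeMk (u, S.toFun y)) ∈ S'.dom := hy'
    rwa [gaugeSource_mk] at h
  have h1 : ContMDiffAt ((𝓡 n).prod (𝓡 p)) (𝓡 n) ∞
      (fun q : M × P => B.gaugeSource (B.gaugeMk (q.2, S.toFun q.1))) (y, u) := by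
    simp only [gaugeSource_mk]
    exact B.contMDiff_proj.contMDiffAt.comp (y, u)
      (ContMDiffAt.comp (y, u) (g := S.toFun) hs contMDiffAt_fst)
  exact (h1.prodMk (ContMDiffAt.comp (y, u) (contMDiffAt_coord_mk (S := S')
    (a := (u, S.toFun y)) hy2) hm)).contMDiffWithinAt

end LocalSection

variable (B)

/-- A local section near the source of an arrow. -/
noncomputable def sectionAt (a : B.Gauge) : B.LocalSection :=
  (B.exists_localSection (B.gaugeOut a).2).choose

theorem mem_sectionAt_dom (a : B.Gauge) : B.gaugeSource a ∈ (B.sectionAt a).dom :=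
  (B.exists_localSection (B.gaugeOut a).2).choose_spec.1

/-- The model space of the gauge groupoid. -/
noncomputable def gaugeModelEquiv (n p : ℕ) :
    (EuclideanSpace ℝ (Fin n) × EuclideanSpace ℝ (Fin p)) ≃L[ℝ] EuclideanSpace ℝ (Fin (n + p)) :=
  ContinuousLinearEquiv.ofFinrankEq (by simp)

/-- The quotient manifold structure of `(P × P)/G`. -/
@[reducible] noncomputable def gaugeChartedSpace :
    ChartedSpace (EuclideanSpace ℝ (Fin (n + p))) B.Gauge :=
  chartedSpaceOfLocal ((𝓡 n).prod (𝓡 p)) (gaugeModelEquiv n p)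
    (fun a => (B.sectionAt a).gaugeChart) (fun a => B.mem_sectionAt_dom a)

attribute [local instance] gaugeChartedSpace

theorem isManifold_gauge : IsManifold (𝓡 (n + p)) ∞ B.Gauge :=
  isManifold_chartedSpaceOfLocal _ fun _ _ => LocalSection.gaugeChart_compatible

attribute [local instance] isManifold_gauge

variable {B}

theorem isSmoothLocalEquiv_gaugeChart_sectionAt (a : B.Gauge) :
    IsSmoothLocalEquiv (𝓡 (n + p)) ((𝓡 n).prod (𝓡 p)) (B.sectionAt a).gaugeChart :=
  isSmoothLocalEquiv_chartedSpaceOfLocal (L := gaugeModelEquiv n p)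
    (fun a => B.mem_sectionAt_dom a) (fun _ _ => LocalSection.gaugeChart_compatible) a

theorem contMDiff_gaugeMk : ContMDiff ((𝓡 p).prod (𝓡 p)) (𝓡 (n + p)) ∞ B.gaugeMk := by
  rintro ⟨u, v⟩
  set a := B.gaugeMk (u, v) with ha
  set S := B.sectionAt a with hS
  have hSa : B.gaugeSource a ∈ S.dom := B.mem_sectionAt_dom a
  have hv : B.proj v ∈ S.dom := by rwa [ha, gaugeSource_mk] at hSa
  have h1 := (isSmoothLocalEquiv_gaugeChart_sectionAt a).contMDiffAt_symm
    (S.gaugeChart.map_source hSa)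
  have h2 : ContMDiffAt ((𝓡 p).prod (𝓡 p)) ((𝓡 n).prod (𝓡 p)) ∞
      (fun b : P × P => (B.proj b.2, S.coord (B.gaugeMk b))) (u, v) :=
    (B.contMDiff_proj.contMDiffAt.comp (u, v) contMDiffAt_snd).prodMk
      (LocalSection.contMDiffAt_coord_mk hv)
  have h3 : (B.proj v, S.coord (B.gaugeMk (u, v))) = S.gaugeChart a :=
    Prod.ext (gaugeSource_mk u v).symm rfl
  have h4 := ContMDiffAt.comp (u, v) (g := S.gaugeChart.symm)
    (f := fun b : P × P => (B.proj b.2, S.coord (B.gaugeMk b))) (h3 ▸ h1) h2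
  refine h4.congr_of_eventuallyEq ?_
  have hev : ∀ᶠ b : P × P in 𝓝 (u, v), B.proj b.2 ∈ S.dom :=
    (B.contMDiff_proj.continuous.comp continuous_snd).continuousAt.eventually
      (S.isOpen_dom.eventually_mem hv)
  filter_upwards [hev] with b hb
  have h5 := S.gaugeChart.left_inv (x := B.gaugeMk b)
    (show B.gaugeSource (B.gaugeMk (b.1, b.2)) ∈ S.dom from
      (gaugeSource_mk (B := B) b.1 b.2).symm ▸ hb)
  refine h5.symm.trans (congrArg S.gaugeChart.symm (Prod.ext (gaugeSource_mk (B := B) b.1 b.2) rfl))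

namespace LocalSection

variable {S : B.LocalSection}

theorem contMDiffAt_gaugeChart {a : B.Gauge} (ha : B.gaugeSource a ∈ S.dom) :
    ContMDiffAt (𝓡 (n + p)) ((𝓡 n).prod (𝓡 p)) ∞ S.gaugeChart a := by
  set S' := B.sectionAt a
  have ha' : a ∈ S'.gaugeChart.source := B.mem_sectionAt_dom a
  have h1 := (isSmoothLocalEquiv_gaugeChart_sectionAt a).contMDiffAt ha'
  have h2 : S'.gaugeChart a ∈ (S'.gaugeChart.symm ≫ₕ S.gaugeChart).source := by
    refine ⟨S'.gaugeChart.map_source ha', ?_⟩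
    change S'.gaugeChart.symm (S'.gaugeChart a) ∈ S.gaugeChart.source
    rw [S'.gaugeChart.left_inv ha']
    exact ha
  have h3 := (gaugeChart_compatible (S := S') (S' := S)).contMDiffAt
    ((S'.gaugeChart.symm ≫ₕ S.gaugeChart).open_source.mem_nhds h2)
  refine (h3.comp a h1).congr_of_eventuallyEq ?_
  filter_upwards [S'.gaugeChart.open_source.mem_nhds ha'] with b hb
  simp only [Function.comp_apply, S'.gaugeChart.left_inv hb]

theorem contMDiffAt_coord {a : B.Gauge} (ha : B.gaugeSource a ∈ S.dom) :
    ContMDiffAt (𝓡 (n + p)) (𝓡 p) ∞ S.coord a :=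
  contMDiffAt_snd.comp a (contMDiffAt_gaugeChart ha)

end LocalSection

theorem contMDiff_gaugeSource : ContMDiff (𝓡 (n + p)) (𝓡 n) ∞ B.gaugeSource := fun a =>
  contMDiffAt_fst.comp a (LocalSection.contMDiffAt_gaugeChart (B.mem_sectionAt_dom a))

/-- Smoothness on the gauge groupoid can be tested on representatives. -/
theorem contMDiffAt_of_comp_gaugeMk {f : B.Gauge → Z} {u v : P}
    (hf : ContMDiffAt ((𝓡 p).prod (𝓡 p)) IZ ∞ (fun a => f (B.gaugeMk a)) (u, v)) :
    ContMDiffAt (𝓡 (n + p)) IZ ∞ f (B.gaugeMk (u, v)) := by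
  obtain ⟨S, hv, hS⟩ := B.exists_localSection v
  set a := B.gaugeMk (u, v) with ha_def
  have ha : B.gaugeSource a ∈ S.dom := by rwa [ha_def, gaugeSource_mk]
  -- This map is a smooth local section of `P × P → (P × P)/G` through `(u, v)`; near the arrow, `f`
  -- is the given smooth map composed with it.
  have h1 : ContMDiffAt (𝓡 (n + p)) ((𝓡 p).prod (𝓡 p)) ∞
      (fun b => (S.coord b, S.toFun (B.gaugeSource b))) a :=
    (LocalSection.contMDiffAt_coord ha).prodMk (ContMDiffAt.comp a (g := S.toFun)
      (S.contMDiffOn.contMDiffAt (S.isOpen_dom.mem_nhds ha)) contMDiff_gaugeSource.contMDiffAt)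
  have h2 : (S.coord a, S.toFun (B.gaugeSource a)) = (u, v) := by
    rw [ha_def, LocalSection.coord_mk hv, gaugeSource_mk, hS, div_eq (B.act_one v), B.act_one]
  rw [← h2] at hf
  refine (hf.comp a h1).congr_of_eventuallyEq ?_
  filter_upwards [(S.isOpen_dom.preimage continuous_gaugeSource).mem_nhds ha] with b hb
  exact congrArg f (LocalSection.gaugeMk_coord hb).symm

/-- Arrows with different sources are separated in `M`. Arrows with the same source lie in a common
chart, whose values are in the Hausdorff space `M × P`. -/
theorem t2Space_gauge [T2Space M] : T2Space B.Gauge := by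
  have := B.t2Space
  refine ⟨fun a b hab => ?_⟩
  by_cases h : B.gaugeSource a = B.gaugeSource b
  · set S := B.sectionAt a
    have ha : a ∈ S.gaugeChart.source := B.mem_sectionAt_dom a
    have hb : b ∈ S.gaugeChart.source := by
      change B.gaugeSource b ∈ S.dom
      rw [← h]
      exact B.mem_sectionAt_dom a
    have hne : S.gaugeChart a ≠ S.gaugeChart b := fun h => hab (S.gaugeChart.injOn ha hb h)
    obtain ⟨V, W, hV, hW, haV, hbW, hVW⟩ := t2_separation hne
    refine ⟨_, _, S.gaugeChart.isOpen_inter_preimage hV, S.gaugeChart.isOpen_inter_preimage hW,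
      ⟨ha, haV⟩, ⟨hb, hbW⟩, ?_⟩
    rw [Set.disjoint_left] at hVW ⊢
    exact fun c hc hc' => hVW hc.2 hc'.2
  · obtain ⟨V, W, hV, hW, haV, hbW, hVW⟩ := t2_separation h
    exact ⟨_, _, hV.preimage continuous_gaugeSource, hW.preimage continuous_gaugeSource, haV, hbW,
      hVW.preimage _⟩

theorem secondCountableTopology_gauge : SecondCountableTopology B.Gauge := by
  have := B.secondCountable
  exact isOpenQuotientMap_gaugeMk.isQuotientMap.secondCountableTopology
    isOpenQuotientMap_gaugeMk.isOpenMap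

end PrincipalBundle

end GaugeManifold

/-! ### The gauge groupoid. -/

section GaugeGroupoid

open Set Filter Topology Module

set_option linter.unusedSectionVars false

variable {n p d : ℕ} {M : Type uM} [TopologicalSpace M]
  [ChartedSpace (EuclideanSpace ℝ (Fin n)) M] [IsManifold (𝓡 n) ∞ M]
  {P : Type uP} [TopologicalSpace P] [ChartedSpace (EuclideanSpace ℝ (Fin p)) P]
  [IsManifold (𝓡 p) ∞ P]
  {G : Type uG} [TopologicalSpace G] [ChartedSpace (EuclideanSpace ℝ (Fin d)) G] [Group G]
  {B : PrincipalBundle n p d M P G}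
  {EZ : Type*} [NormedAddCommGroup EZ] [NormedSpace ℝ EZ] {HZ : Type*} [TopologicalSpace HZ]
  {IZ : ModelWithCorners ℝ EZ HZ} {Z : Type*} [TopologicalSpace Z] [ChartedSpace HZ Z]

attribute [local instance] PrincipalBundle.gaugeChartedSpace PrincipalBundle.isManifold_gauge

namespace PrincipalBundle

variable (B) in
/-- The product of arrows of the gauge groupoid. -/
noncomputable def gaugeMul (a b : B.Gauge) : B.Gauge :=
  B.gaugeMk ((B.gaugeOut a).1, B.act (B.gaugeOut b).2 (B.div (B.gaugeOut b).1 (B.gaugeOut a).2))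

variable (B) in
/-- The inverse of an arrow of the gauge groupoid. -/
noncomputable def gaugeInv (a : B.Gauge) : B.Gauge := B.gaugeMk (B.gaugeOut a).swap

variable (B) in
/-- The units of the gauge groupoid. -/
noncomputable def gaugeOne (y : M) : B.Gauge :=
  B.gaugeMk ((B.exists_proj_eq y).choose, (B.exists_proj_eq y).choose)

theorem gaugeMul_mk (u v w : P) :
    B.gaugeMul (B.gaugeMk (u, v)) (B.gaugeMk (v, w)) = B.gaugeMk (u, w) := by
  obtain ⟨g, hg⟩ := exists_gaugeOut_eq (B := B) u v
  obtain ⟨h, hh⟩ := exists_gaugeOut_eq (B := B) v w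
  -- The chosen representatives are `(u g, v g)` and `(v h, w h)`; translating the second by `h⁻¹ g`
  -- makes the middle points agree.
  have h1 : B.div (B.act v h) (B.act v g) = h⁻¹ * g :=
    div_eq (by rw [← B.act_mul, mul_inv_cancel_left])
  rw [gaugeMul, hg, hh]
  simp only [h1]
  rw [← B.act_mul, mul_inv_cancel_left, gaugeMk_act]

theorem gaugeInv_mk (u v : P) : B.gaugeInv (B.gaugeMk (u, v)) = B.gaugeMk (v, u) := by
  obtain ⟨g, hg⟩ := exists_gaugeOut_eq (B := B) u v
  rw [gaugeInv, hg]
  exact gaugeMk_act v u g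

theorem gaugeMk_self_eq {u v : P} (h : B.proj u = B.proj v) :
    B.gaugeMk (u, u) = B.gaugeMk (v, v) := by
  have h1 := gaugeMk_act (B := B) u u (B.div u v)
  rw [act_div h] at h1
  exact h1.symm

theorem gaugeOne_eq {u : P} {y : M} (h : B.proj u = y) : B.gaugeOne y = B.gaugeMk (u, u) :=
  gaugeMk_self_eq ((B.exists_proj_eq y).choose_spec.trans h.symm)

theorem exists_gaugeMk_right {a : B.Gauge} {u : P} (h : B.gaugeTarget a = B.proj u) :
    ∃ v, B.gaugeMk (u, v) = a := by
  obtain ⟨u', v', rfl⟩ := exists_gaugeMk a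
  rw [gaugeTarget_mk] at h
  refine ⟨B.act v' (B.div u' u), ?_⟩
  have h1 := gaugeMk_act (B := B) u' v' (B.div u' u)
  rwa [act_div h] at h1

theorem exists_gaugeMk_pair {a b : B.Gauge} (h : B.gaugeSource a = B.gaugeTarget b) :
    ∃ u v w, a = B.gaugeMk (u, v) ∧ b = B.gaugeMk (v, w) := by
  obtain ⟨u, v, rfl⟩ := exists_gaugeMk a
  rw [gaugeSource_mk] at h
  obtain ⟨w, rfl⟩ := exists_gaugeMk_right h.symm
  exact ⟨u, v, w, rfl, rfl⟩

theorem contMDiff_gaugeTarget : ContMDiff (𝓡 (n + p)) (𝓡 n) ∞ B.gaugeTarget := fun a => by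
  obtain ⟨u, v, rfl⟩ := exists_gaugeMk a
  refine contMDiffAt_of_comp_gaugeMk ?_
  have h : (fun a => B.gaugeTarget (B.gaugeMk a)) = fun a => B.proj a.1 :=
    funext fun a => gaugeTarget_mk _ _
  rw [h]
  exact B.contMDiff_proj.contMDiffAt.comp (u, v) contMDiffAt_fst

theorem contMDiff_gaugeInv : ContMDiff (𝓡 (n + p)) (𝓡 (n + p)) ∞ B.gaugeInv := fun a => by
  obtain ⟨u, v, rfl⟩ := exists_gaugeMk a
  refine contMDiffAt_of_comp_gaugeMk ?_
  have h : (fun a => B.gaugeInv (B.gaugeMk a)) = fun a => B.gaugeMk (a.2, a.1) :=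
    funext fun a => gaugeInv_mk _ _
  rw [h]
  exact ContMDiffAt.comp (u, v) (g := B.gaugeMk) (f := fun a : P × P => (a.2, a.1))
    contMDiff_gaugeMk.contMDiffAt (contMDiffAt_snd.prodMk contMDiffAt_fst)

theorem contMDiff_gaugeOne : ContMDiff (𝓡 n) (𝓡 (n + p)) ∞ B.gaugeOne := fun y => by
  obtain ⟨u, rfl⟩ := B.exists_proj_eq y
  obtain ⟨S, hS, -⟩ := B.exists_localSection u
  have h1 := S.contMDiffOn.contMDiffAt (S.isOpen_dom.mem_nhds hS)
  refine (ContMDiffAt.comp _ (g := B.gaugeMk) (f := fun y => (S.toFun y, S.toFun y))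
    contMDiff_gaugeMk.contMDiffAt (h1.prodMk h1)).congr_of_eventuallyEq ?_
  filter_upwards [S.isOpen_dom.mem_nhds hS] with y hy using gaugeOne_eq (S.proj_toFun y hy)

theorem contMDiffOn_gaugeMul : ContMDiffOn ((𝓡 (n + p)).prod (𝓡 (n + p))) (𝓡 (n + p)) ∞
    (fun q : B.Gauge × B.Gauge => B.gaugeMul q.1 q.2)
    {q | B.gaugeSource q.1 = B.gaugeTarget q.2} := by
  rintro ⟨a, b⟩ hab
  have hab : B.gaugeSource a = B.gaugeTarget b := hab
  set S := B.sectionAt a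
  have ha : B.gaugeSource a ∈ S.dom := B.mem_sectionAt_dom a
  have hinv : ∀ b, B.gaugeSource (B.gaugeInv b) = B.gaugeTarget b := fun b => by
    obtain ⟨u, v, rfl⟩ := exists_gaugeMk b
    rw [gaugeInv_mk, gaugeSource_mk, gaugeTarget_mk]
  have hb : B.gaugeSource (B.gaugeInv b) ∈ S.dom := by rwa [hinv, ← hab]
  -- With `σ` a section near the source of `a`, composable arrows are `[u, σ y]` and `[σ y, w]`,
  -- with product `[u, w]`. Here `u` and `w` are the coordinates of the first arrow and of the
  -- inverse of the second, so this formula is smooth on a full neighbourhood and not only on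
  -- composable pairs.
  have h1 : ContMDiffAt ((𝓡 (n + p)).prod (𝓡 (n + p))) (𝓡 (n + p)) ∞
      (fun q : B.Gauge × B.Gauge => B.gaugeMk (S.coord q.1, S.coord (B.gaugeInv q.2))) (a, b) :=
    ContMDiffAt.comp (a, b) (g := B.gaugeMk)
      (f := fun q : B.Gauge × B.Gauge => (S.coord q.1, S.coord (B.gaugeInv q.2)))
      contMDiff_gaugeMk.contMDiffAt
      ((ContMDiffAt.comp (a, b) (g := S.coord) (LocalSection.contMDiffAt_coord ha)
        contMDiffAt_fst).prodMk
      (ContMDiffAt.comp (a, b) (g := S.coord) (LocalSection.contMDiffAt_coord hb)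
        (contMDiff_gaugeInv.contMDiffAt.comp (a, b) contMDiffAt_snd)))
  have key : ∀ q : B.Gauge × B.Gauge, B.gaugeSource q.1 = B.gaugeTarget q.2 →
      B.gaugeSource q.1 ∈ S.dom →
      B.gaugeMul q.1 q.2 = B.gaugeMk (S.coord q.1, S.coord (B.gaugeInv q.2)) := by
    rintro ⟨a, b⟩ h ha
    have h2 := LocalSection.gaugeMk_coord ha
    have hb : B.gaugeSource (B.gaugeInv b) ∈ S.dom := by rw [hinv]; exact h ▸ ha
    have h3 := congrArg B.gaugeInv (LocalSection.gaugeMk_coord hb)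
    have h4 : B.gaugeInv (B.gaugeInv b) = b := by
      obtain ⟨u, v, rfl⟩ := exists_gaugeMk b
      rw [gaugeInv_mk, gaugeInv_mk]
    rw [h4, gaugeInv_mk, hinv, ← show B.gaugeSource a = B.gaugeTarget b from h] at h3
    conv_lhs => rw [← h2]
    change B.gaugeMul _ b = _
    conv_lhs => rw [← h3]
    exact gaugeMul_mk _ _ _
  refine h1.contMDiffWithinAt.congr_of_eventuallyEq ?_ (key _ hab ha)
  have hev : ∀ᶠ q : B.Gauge × B.Gauge in 𝓝 (a, b), B.gaugeSource q.1 ∈ S.dom :=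
    (continuous_gaugeSource.comp continuous_fst).continuousAt.eventually
      (S.isOpen_dom.eventually_mem ha)
  filter_upwards [nhdsWithin_le_nhds hev, self_mem_nhdsWithin] with q hq hq' using key q hq' hq

/-- The map `b ↦ (coord b, S (s b))` is a local section, and it passes through `(u, v)` when `S`
passes through `v`. -/
theorem isSubmersion_gaugeMk :
    IsSubmersion ((𝓡 p).prod (𝓡 p)) (𝓡 (n + p)) ∞ B.gaugeMk := by
  refine isSubmersion_of_sections contMDiff_gaugeMk fun ⟨u, v⟩ => ?_
  obtain ⟨S, hv, hS⟩ := B.exists_localSection v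
  set a := B.gaugeMk (u, v) with ha_def
  have ha : B.gaugeSource a ∈ S.dom := by rwa [ha_def, gaugeSource_mk]
  have h1 : ContMDiffAt (𝓡 (n + p)) ((𝓡 p).prod (𝓡 p)) ∞
      (fun b => (S.coord b, S.toFun (B.gaugeSource b))) a :=
    (LocalSection.contMDiffAt_coord ha).prodMk (ContMDiffAt.comp a (g := S.toFun)
      (S.contMDiffOn.contMDiffAt (S.isOpen_dom.mem_nhds ha)) contMDiff_gaugeSource.contMDiffAt)
  refine ⟨_, h1.mdifferentiableAt (by simp), ?_, ?_⟩
  · simp only [ha_def]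
    rw [LocalSection.coord_mk hv, gaugeSource_mk, hS, div_eq (B.act_one v), B.act_one]
  · filter_upwards [(S.isOpen_dom.preimage continuous_gaugeSource).mem_nhds ha] with b hb
    exact LocalSection.gaugeMk_coord hb

theorem isSubmersion_gaugeSource : IsSubmersion (𝓡 (n + p)) (𝓡 n) ∞ B.gaugeSource := by
  refine isSubmersion_of_sections contMDiff_gaugeSource fun a => ?_
  obtain ⟨u, v, rfl⟩ := exists_gaugeMk a
  obtain ⟨S, hv, hS⟩ := B.exists_localSection v
  rw [gaugeSource_mk]
  have h1 := S.contMDiffOn.contMDiffAt (S.isOpen_dom.mem_nhds hv)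
  have h2 : ContMDiffAt (𝓡 n) (𝓡 (n + p)) ∞ (fun y => B.gaugeMk (u, S.toFun y)) (B.proj v) :=
    ContMDiffAt.comp _ (g := B.gaugeMk) (f := fun y => (u, S.toFun y))
      contMDiff_gaugeMk.contMDiffAt (contMDiffAt_const.prodMk h1)
  refine ⟨_, h2.mdifferentiableAt (by simp), by rw [hS], ?_⟩
  filter_upwards [S.isOpen_dom.mem_nhds hv] with y hy
  rw [gaugeSource_mk, S.proj_toFun y hy]

theorem isSubmersion_gaugeTarget : IsSubmersion (𝓡 (n + p)) (𝓡 n) ∞ B.gaugeTarget := by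
  refine isSubmersion_of_sections contMDiff_gaugeTarget fun a => ?_
  obtain ⟨u, v, rfl⟩ := exists_gaugeMk a
  obtain ⟨S, hu, hS⟩ := B.exists_localSection u
  rw [gaugeTarget_mk]
  have h1 := S.contMDiffOn.contMDiffAt (S.isOpen_dom.mem_nhds hu)
  have h2 : ContMDiffAt (𝓡 n) (𝓡 (n + p)) ∞ (fun y => B.gaugeMk (S.toFun y, v)) (B.proj u) :=
    ContMDiffAt.comp _ (g := B.gaugeMk) (f := fun y => (S.toFun y, v))
      contMDiff_gaugeMk.contMDiffAt (h1.prodMk contMDiffAt_const)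
  refine ⟨_, h2.mdifferentiableAt (by simp), by rw [hS], ?_⟩
  filter_upwards [S.isOpen_dom.mem_nhds hu] with y hy
  rw [gaugeTarget_mk, S.proj_toFun y hy]

variable (B) in
/-- The gauge groupoid of a principal bundle. -/
noncomputable def gaugeGroupoid [T2Space M] : LieGroupoid n (n + p) M B.Gauge where
  t2Space := t2Space_gauge
  secondCountable := secondCountableTopology_gauge
  s := B.gaugeSource
  t := B.gaugeTarget
  one := B.gaugeOne
  inv := B.gaugeInv
  mul := B.gaugeMul
  s_one y := by
    obtain ⟨u, rfl⟩ := B.exists_proj_eq y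
    rw [gaugeOne_eq rfl, gaugeSource_mk]
  t_one y := by
    obtain ⟨u, rfl⟩ := B.exists_proj_eq y
    rw [gaugeOne_eq rfl, gaugeTarget_mk]
  s_inv a := by
    obtain ⟨u, v, rfl⟩ := exists_gaugeMk a
    rw [gaugeInv_mk, gaugeSource_mk, gaugeTarget_mk]
  t_inv a := by
    obtain ⟨u, v, rfl⟩ := exists_gaugeMk a
    rw [gaugeInv_mk, gaugeSource_mk, gaugeTarget_mk]
  s_mul a b h := by
    obtain ⟨u, v, w, rfl, rfl⟩ := exists_gaugeMk_pair h
    rw [gaugeMul_mk, gaugeSource_mk, gaugeSource_mk]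
  t_mul a b h := by
    obtain ⟨u, v, w, rfl, rfl⟩ := exists_gaugeMk_pair h
    rw [gaugeMul_mk, gaugeTarget_mk, gaugeTarget_mk]
  mul_assoc a b c h h' := by
    obtain ⟨u, v, w, rfl, rfl⟩ := exists_gaugeMk_pair h
    rw [gaugeSource_mk] at h'
    obtain ⟨z, rfl⟩ := exists_gaugeMk_right h'.symm
    simp only [gaugeMul_mk]
  one_mul a := by
    obtain ⟨u, v, rfl⟩ := exists_gaugeMk a
    rw [gaugeTarget_mk, gaugeOne_eq rfl, gaugeMul_mk]
  mul_one a := by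
    obtain ⟨u, v, rfl⟩ := exists_gaugeMk a
    rw [gaugeSource_mk, gaugeOne_eq rfl, gaugeMul_mk]
  inv_mul a := by
    obtain ⟨u, v, rfl⟩ := exists_gaugeMk a
    rw [gaugeSource_mk, gaugeOne_eq rfl, gaugeInv_mk, gaugeMul_mk]
  mul_inv a := by
    obtain ⟨u, v, rfl⟩ := exists_gaugeMk a
    rw [gaugeTarget_mk, gaugeOne_eq rfl, gaugeInv_mk, gaugeMul_mk]
  isSubmersion_s := isSubmersion_gaugeSource
  isSubmersion_t := isSubmersion_gaugeTarget
  contMDiff_one := contMDiff_gaugeOne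
  contMDiff_inv := contMDiff_gaugeInv
  contMDiffOn_mul := contMDiffOn_gaugeMul

theorem isGaugeGroupoid_gaugeGroupoid [T2Space M] : B.IsGaugeGroupoid B.gaugeGroupoid where
  isSubmersion_mk := isSubmersion_gaugeMk
  t_mk := gaugeTarget_mk
  s_mk := gaugeSource_mk
  mul_mk := gaugeMul_mk

end PrincipalBundle

end GaugeGroupoid

/-! ### The Lie algebroid of the gauge groupoid. -/

section GaugeAlgebroid

open Set Filter Topology Module PrincipalBundle

set_option linter.unusedSectionVars false

variable {n p d : ℕ} {M : Type uM} [TopologicalSpace M]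
  [ChartedSpace (EuclideanSpace ℝ (Fin n)) M] [IsManifold (𝓡 n) ∞ M]
  {P : Type uP} [TopologicalSpace P] [ChartedSpace (EuclideanSpace ℝ (Fin p)) P]
  [IsManifold (𝓡 p) ∞ P]
  {G : Type uG} [TopologicalSpace G] [ChartedSpace (EuclideanSpace ℝ (Fin d)) G] [Group G]
  {B : PrincipalBundle n p d M P G}
  {F : Type uF} [NormedAddCommGroup F] [NormedSpace ℝ F] [FiniteDimensional ℝ F]
  {A : M → Type uA} [TopologicalSpace (TotalSpace F A)] [∀ x, TopologicalSpace (A x)]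
  [∀ x, AddCommGroup (A x)] [∀ x, Module ℝ (A x)] [FiberBundle F A] [VectorBundle ℝ F A]
  [ContMDiffVectorBundle ∞ F A (𝓡 n)] {L : LieAlgebroid n F A}
  {EZ : Type*} [NormedAddCommGroup EZ] [NormedSpace ℝ EZ] {HZ : Type*} [TopologicalSpace HZ]
  {IZ : ModelWithCorners ℝ EZ HZ} {Z : Type*} [TopologicalSpace Z] [ChartedSpace HZ Z]
  [IsManifold IZ ∞ Z]

attribute [local instance] PrincipalBundle.gaugeChartedSpace PrincipalBundle.isManifold_gauge

theorem PrincipalBundle.contMDiff_gaugeMk_left (v : P) :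
    ContMDiff (𝓡 p) (𝓡 (n + p)) ∞ (fun w => B.gaugeMk (w, v)) := fun w =>
  ContMDiffAt.comp w (g := B.gaugeMk) (f := fun w => (w, v)) contMDiff_gaugeMk.contMDiffAt
    (contMDiffAt_id.prodMk contMDiffAt_const)

theorem PrincipalBundle.mdifferentiableAt_gaugeMk_left (v w : P) :
    MDifferentiableAt (𝓡 p) (𝓡 (n + p)) (fun w => B.gaugeMk (w, v)) w :=
  (contMDiff_gaugeMk_left v).contMDiffAt.mdifferentiableAt (by simp)

/-- For a local section through `v`, the coordinate of the arrow `[w, v]` is `w`: a smooth left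
inverse. -/
theorem PrincipalBundle.injective_mfderiv_gaugeMk_left (v w : P) :
    Function.Injective (mfderiv (𝓡 p) (𝓡 (n + p)) (fun w => B.gaugeMk (w, v)) w) := by
  obtain ⟨S, hv, hS⟩ := B.exists_localSection v
  have h1 : MDifferentiableAt (𝓡 (n + p)) (𝓡 p) S.coord (B.gaugeMk (w, v)) :=
    (LocalSection.contMDiffAt_coord (by rwa [gaugeSource_mk])).mdifferentiableAt (by simp)
  have h2 := h1.hasMFDerivAt.comp w (mdifferentiableAt_gaugeMk_left v w).hasMFDerivAt
  have h3 : (S.coord ∘ fun w => B.gaugeMk (w, v)) = id := funext fun w => by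
    have := LocalSection.coord_mk (u := w) hv
    rw [hS, div_eq (B.act_one v), B.act_one] at this
    exact this
  rw [h3] at h2
  have h4 := h2.mfderiv
  rw [mfderiv_id] at h4
  exact Function.LeftInverse.injective
    (g := mfderiv (𝓡 (n + p)) (𝓡 p) S.coord (B.gaugeMk (w, v))) fun ξ =>
    (DFunLike.congr_fun h4 ξ).symm

namespace LieAlgebroid.AtiyahIso

variable (ψ : L.AtiyahIso B)

/-- The tangent vector at `u` that represents an element of `A`. -/
noncomputable def tangentAt {y : M} (u : P) (h : B.proj u = y) : A y ≃ₗ[ℝ] TangentSpace (𝓡 p) u :=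
  h.rec (motive := fun y _ => A y ≃ₗ[ℝ] TangentSpace (𝓡 p) u) (ψ.fiberEquiv u).symm

theorem tangentAt_rfl (u : P) : ψ.tangentAt u rfl = (ψ.fiberEquiv u).symm := rfl

/-- Equality is required in the total space because the fibres over `B.proj u` and `y` are only
propositionally the same. -/
theorem eq_tangentAt {y : M} {u : P} (h : B.proj u = y) {a : A y} {ξ : TangentSpace (𝓡 p) u}
    (hξ : (⟨B.proj u, ψ.fiberEquiv u ξ⟩ : TotalSpace F A) = ⟨y, a⟩) : ξ = ψ.tangentAt u h a := by
  subst h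
  rw [tangentAt_rfl, LinearEquiv.eq_symm_apply]
  exact eq_of_heq (TotalSpace.mk.inj hξ).2

theorem mk_fiberEquiv_tangentAt {y : M} {u : P} (h : B.proj u = y) (a : A y) :
    (⟨B.proj u, ψ.fiberEquiv u (ψ.tangentAt u h a)⟩ : TotalSpace F A) = ⟨y, a⟩ := by
  subst h
  rw [tangentAt_rfl, LinearEquiv.apply_symm_apply]

/-- The isomorphism is defined on orbits, so a vector and its translate represent the same element
of `A`. -/
theorem tangentAt_act {y : M} {u : P} (h : B.proj u = y) (g : G) (h' : B.proj (B.act u g) = y)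
    (a : A y) : ψ.tangentAt (B.act u g) h' a =
      mfderiv (𝓡 p) (𝓡 p) (fun u => B.act u g) u (ψ.tangentAt u h a) := by
  refine (ψ.eq_tangentAt h' ?_).symm
  rw [← ψ.mk_fiberEquiv_tangentAt h a, ← ψ.toEquiv_mk, ← ψ.toEquiv_mk]
  exact congrArg ψ.toEquiv (Quot.sound ⟨g, rfl⟩).symm

/-- The maps `T_u P → A` form a smooth injective bundle map, whose inverse is smooth by
`contMDiffAt_of_injective_bundleMap`. -/
theorem contMDiffAt_fiberEquiv_symm {u : Z → P} {z₀ : Z} (hu : ContMDiffAt IZ (𝓡 p) ∞ u z₀)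
    {a : ∀ z, A (B.proj (u z))} (ha : ContMDiffAt IZ ((𝓡 n).prod 𝓘(ℝ, F)) ∞
      (fun z => (⟨B.proj (u z), a z⟩ : TotalSpace F A)) z₀) :
    ContMDiffAt IZ (𝓡 p).tangent ∞
      (fun z => (⟨u z, (ψ.fiberEquiv (u z)).symm (a z)⟩ : TangentBundle (𝓡 p) P)) z₀ := by
  refine contMDiffAt_of_injective_bundleMap (A := fun u : P => TangentSpace (𝓡 p) u)
    (F' := F) (IB' := 𝓡 n) (A' := A) (b' := fun z => B.proj (u z)) hu
    (fun z => (ψ.fiberEquiv (u z)).toLinearMap) (fun v => ?_) (ψ.fiberEquiv (u z₀)).injective ?_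
  · have h1 := ContMDiffAt.comp z₀ ψ.contMDiff_toEquiv_mk.contMDiffAt
      (contMDiffAt_trivializationAt_symm (F := EuclideanSpace ℝ (Fin p))
        (A := fun u : P => TangentSpace (𝓡 p) u) hu v)
    refine h1.congr_of_eventuallyEq (Eventually.of_forall fun z => ?_)
    exact (ψ.toEquiv_mk _ _).symm
  · refine ha.congr_of_eventuallyEq (Eventually.of_forall fun z => ?_)
    exact congrArg (TotalSpace.mk _) ((ψ.fiberEquiv (u z)).apply_symm_apply (a z))

theorem contMDiff_invariantField (X : Cₛ^∞⟮𝓡 n; F, A⟯) :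
    ContMDiff (𝓡 p) (𝓡 p).tangent ∞
      (fun u => (⟨u, (ψ.fiberEquiv u).symm (X (B.proj u))⟩ : TangentBundle (𝓡 p) P)) := fun u =>
  ψ.contMDiffAt_fiberEquiv_symm contMDiffAt_id
    (ContMDiffAt.comp u (g := fun y => (⟨y, X y⟩ : TotalSpace F A)) X.contMDiff.contMDiffAt
      B.contMDiff_proj.contMDiffAt)

/-- The isomorphism from `A` to the Lie algebroid of the gauge groupoid, on a fibre. -/
noncomputable def gaugeTangent (y : M) : A y →ₗ[ℝ] TangentSpace (𝓡 (n + p)) (B.gaugeOne y) :=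
  (mfderiv (𝓡 p) (𝓡 (n + p)) (fun w => B.gaugeMk (w, (B.exists_proj_eq y).choose))
    (B.exists_proj_eq y).choose : TangentSpace (𝓡 p) (B.exists_proj_eq y).choose →L[ℝ]
      TangentSpace (𝓡 (n + p)) (B.gaugeOne y)).toLinearMap ∘ₗ
    (ψ.tangentAt (B.exists_proj_eq y).choose (B.exists_proj_eq y).choose_spec).toLinearMap

/-- Independence of the chosen point over `y`: since `[w g, u g] = [w, u]`, translating both the
point and the vector changes nothing. -/
theorem gaugeTangent_eq {y : M} {u : P} (h : B.proj u = y) (a : A y) :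
    ψ.gaugeTangent y a = (show TangentSpace (𝓡 (n + p)) (B.gaugeOne y) from
      mfderiv (𝓡 p) (𝓡 (n + p)) (fun w => B.gaugeMk (w, u)) u (ψ.tangentAt u h a)) := by
  set u₀ := (B.exists_proj_eq y).choose with hu₀
  have h₀ : B.proj u₀ = y := (B.exists_proj_eq y).choose_spec
  have h1 : ψ.gaugeTangent y a = (show TangentSpace (𝓡 (n + p)) (B.gaugeOne y) from
    mfderiv (𝓡 p) (𝓡 (n + p)) (fun w => B.gaugeMk (w, u₀)) u₀ (ψ.tangentAt u₀ h₀ a)) := rfl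
  rw [h1]
  obtain ⟨g, rfl⟩ := B.exists_act_eq (h₀.trans h.symm)
  have h2 := (mdifferentiableAt_gaugeMk_left (B := B) (B.act u₀ g) (B.act u₀ g)).hasMFDerivAt.comp
    u₀ (((contMDiffAt_act_const (B := B) g u₀).mdifferentiableAt (by simp)).hasMFDerivAt)
  have h3 : ((fun w => B.gaugeMk (w, B.act u₀ g)) ∘ fun u => B.act u g) =
      fun w => B.gaugeMk (w, u₀) := funext fun w => gaugeMk_act w u₀ g
  rw [h3] at h2
  rw [ψ.tangentAt_act h₀ g h a]
  exact DFunLike.congr_fun h2.mfderiv _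

variable [T2Space M]

theorem mfderiv_s_gaugeTangent (y : M) (a : A y) :
    mfderiv (𝓡 (n + p)) (𝓡 n) B.gaugeGroupoid.s (B.gaugeOne y) (ψ.gaugeTangent y a) = 0 := by
  obtain ⟨u, rfl⟩ := B.exists_proj_eq y
  have h1 : HasMFDerivAt (𝓡 (n + p)) (𝓡 n) B.gaugeSource (B.gaugeMk (u, u))
      (mfderiv (𝓡 (n + p)) (𝓡 n) B.gaugeSource (B.gaugeOne (B.proj u))) := by
    rw [← gaugeOne_eq rfl]
    exact (contMDiff_gaugeSource.contMDiffAt.mdifferentiableAt (by simp)).hasMFDerivAt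
  have h2 := h1.comp u (mdifferentiableAt_gaugeMk_left u u).hasMFDerivAt
  have h3 : (B.gaugeSource ∘ fun w => B.gaugeMk (w, u)) = fun _ => B.proj u :=
    funext fun w => gaugeSource_mk w u
  rw [h3] at h2
  have h4 := h2.mfderiv
  rw [mfderiv_const] at h4
  rw [ψ.gaugeTangent_eq rfl]
  exact (DFunLike.congr_fun h4 (ψ.tangentAt u rfl a)).symm

theorem mfderiv_t_gaugeTangent {y : M} {u : P} (h : B.proj u = y) (a : A y) :
    mfderiv (𝓡 (n + p)) (𝓡 n) B.gaugeGroupoid.t (B.gaugeOne y) (ψ.gaugeTangent y a) =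
      (show EuclideanSpace ℝ (Fin n) from L.anchor y a) := by
  subst h
  have h1 : HasMFDerivAt (𝓡 (n + p)) (𝓡 n) B.gaugeTarget (B.gaugeMk (u, u))
      (mfderiv (𝓡 (n + p)) (𝓡 n) B.gaugeTarget (B.gaugeOne (B.proj u))) := by
    rw [← gaugeOne_eq rfl]
    exact (contMDiff_gaugeTarget.contMDiffAt.mdifferentiableAt (by simp)).hasMFDerivAt
  have h2 := h1.comp u (mdifferentiableAt_gaugeMk_left u u).hasMFDerivAt
  have h3 : (B.gaugeTarget ∘ fun w => B.gaugeMk (w, u)) = B.proj :=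
    funext fun w => gaugeTarget_mk w u
  rw [h3] at h2
  rw [ψ.gaugeTangent_eq rfl]
  refine (DFunLike.congr_fun h2.mfderiv (ψ.tangentAt u rfl a)).symm.trans ?_
  refine (ψ.anchor_eq u _).symm.trans ?_
  rw [tangentAt_rfl, LinearEquiv.apply_symm_apply]

theorem gaugeTangent_injective (y : M) : Function.Injective (ψ.gaugeTangent y) :=
  (injective_mfderiv_gaugeMk_left _ _).comp (ψ.tangentAt _ _).injective

/-- The isomorphism from `A` to the Lie algebroid of the gauge groupoid, on a fibre. -/
noncomputable def gaugeFiberEquiv (y : M) : A y ≃ₗ[ℝ]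
    LinearMap.ker (mfderiv (𝓡 (n + p)) (𝓡 n) B.gaugeGroupoid.s
      (B.gaugeGroupoid.one y)).toLinearMap :=
  let e := ψ.tangentAt _ (B.exists_proj_eq y).choose_spec
  haveI : FiniteDimensional ℝ (TangentSpace (𝓡 p) (B.exists_proj_eq y).choose) :=
    inferInstanceAs (FiniteDimensional ℝ (EuclideanSpace ℝ (Fin p)))
  haveI : FiniteDimensional ℝ (A y) := e.symm.finiteDimensional
  haveI : FiniteDimensional ℝ (TangentSpace (𝓡 (n + p)) (B.gaugeGroupoid.one y)) :=
    inferInstanceAs (FiniteDimensional ℝ (EuclideanSpace ℝ (Fin (n + p))))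
  LinearMap.linearEquivOfInjective
    (LinearMap.codRestrict (LinearMap.ker (mfderiv (𝓡 (n + p)) (𝓡 n) B.gaugeGroupoid.s
      (B.gaugeGroupoid.one y)).toLinearMap) (ψ.gaugeTangent y) (ψ.mfderiv_s_gaugeTangent y))
    (fun a b h => ψ.gaugeTangent_injective y (congrArg Subtype.val h))
    -- The fibre of `A` has the dimension `p` of `P`, and `ker ds` has dimension `(n + p) - n`, so
    -- injectivity is enough.
    ((e.finrank_eq.trans (finrank_euclideanSpace_fin (𝕜 := ℝ) (n := p))).trans (by
      rw [B.gaugeGroupoid.finrank_ker_mfderiv_s]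
      simp [LieGroupoid.sourceFiberDim]))

theorem mk_gaugeTangent {y : M} {u : P} (h : B.proj u = y) (a : A y) :
    (⟨B.gaugeOne y, ψ.gaugeTangent y a⟩ : TangentBundle (𝓡 (n + p)) B.Gauge) =
      ⟨B.gaugeMk (u, u), mfderiv (𝓡 p) (𝓡 (n + p)) (fun w => B.gaugeMk (w, u)) u
        (ψ.tangentAt u h a)⟩ := by
  rw [ψ.gaugeTangent_eq h]
  exact TotalSpace.ext (gaugeOne_eq h) (by rfl)

theorem contMDiff_gaugeTangent : ContMDiff ((𝓡 n).prod 𝓘(ℝ, F)) (𝓡 (n + p)).tangent ∞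
    (fun a : TotalSpace F A =>
      (⟨B.gaugeOne a.proj, ψ.gaugeTangent a.proj a.2⟩ : TangentBundle (𝓡 (n + p)) B.Gauge)) := by
  intro a₀
  obtain ⟨u₀, hu₀⟩ := B.exists_proj_eq a₀.proj
  obtain ⟨S, hS, -⟩ := B.exists_localSection u₀
  rw [hu₀] at hS
  classical
  have hev : ∀ᶠ a : TotalSpace F A in 𝓝 a₀, a.proj ∈ S.dom :=
    (FiberBundle.continuous_proj F A).continuousAt.eventually (S.isOpen_dom.eventually_mem hS)
  have hu : ContMDiffAt ((𝓡 n).prod 𝓘(ℝ, F)) (𝓡 p) ∞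
      (fun a : TotalSpace F A => S.toFun a.proj) a₀ :=
    ContMDiffAt.comp a₀ (g := S.toFun) (S.contMDiffOn.contMDiffAt (S.isOpen_dom.mem_nhds hS))
      (contMDiff_proj A).contMDiffAt
  -- The element `a` moved to the fibre over the projection of the section value. Over the domain of
  -- the section this is the same fibre; elsewhere the value may be the default `0`, which does not
  -- affect the germ at `a₀`.
  let c : ∀ a : TotalSpace F A, A (B.proj (S.toFun a.proj)) := fun a =>
    if h : a.proj = B.proj (S.toFun a.proj) then h ▸ a.2 else 0
  have hc : ∀ a : TotalSpace F A, a.proj ∈ S.dom →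
      (⟨B.proj (S.toFun a.proj), c a⟩ : TotalSpace F A) = a := fun a ha => by
    have h := (S.proj_toFun _ ha).symm
    have h1 : c a = h ▸ a.2 := dif_pos h
    rw [h1]
    refine TotalSpace.ext h.symm ?_
    simp
  have h1 := ψ.contMDiffAt_fiberEquiv_symm hu (a := c)
    (contMDiffAt_id.congr_of_eventuallyEq (hev.mono hc))
  have hf : ContMDiffAt (((𝓡 n).prod 𝓘(ℝ, F)).prod (𝓡 p)) (𝓡 (n + p)) ∞
      (Function.uncurry fun (a : TotalSpace F A) (w : P) => B.gaugeMk (w, S.toFun a.proj))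
      (a₀, S.toFun a₀.proj) :=
    ContMDiffAt.comp _ (g := B.gaugeMk) (f := fun q : TotalSpace F A × P =>
      (q.2, S.toFun q.1.proj)) contMDiff_gaugeMk.contMDiffAt
      (contMDiffAt_snd.prodMk (ContMDiffAt.comp _ (g := fun a : TotalSpace F A => S.toFun a.proj)
        hu contMDiffAt_fst))
  refine (contMDiffAt_mfderiv_apply hf h1).congr_of_eventuallyEq ?_
  filter_upwards [hev] with a ha
  rw [ψ.mk_gaugeTangent (S.proj_toFun _ ha)]
  have h2 : ψ.tangentAt (S.toFun a.proj) (S.proj_toFun _ ha) a.2 =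
      (ψ.fiberEquiv (S.toFun a.proj)).symm (c a) := by
    refine (ψ.eq_tangentAt (S.proj_toFun _ ha) ?_).symm
    rw [LinearEquiv.apply_symm_apply]
    exact hc a ha
  rw [h2]

/-- Since `[z, w][w, v] = [z, v]`, right translation by `[w, v]` turns the velocity of `z ↦ [z, w]`
into that of `z ↦ [z, v]`. Thus invariant fields on `P` are related to right-invariant fields on the
gauge groupoid. -/
theorem rightTranslate_gaugeTangent (w v : P) (a : A (B.gaugeGroupoid.t (B.gaugeMk (w, v))))
    (a' : A (B.proj w)) (ha : (⟨_, a⟩ : TotalSpace F A) = ⟨_, a'⟩) :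
    B.gaugeGroupoid.rightTranslate (B.gaugeMk (w, v))
      (ψ.gaugeTangent (B.gaugeGroupoid.t (B.gaugeMk (w, v))) a) =
    mfderiv (𝓡 p) (𝓡 (n + p)) (fun z => B.gaugeMk (z, v)) w ((ψ.fiberEquiv w).symm a') := by
  have ht : B.proj w = B.gaugeGroupoid.t (B.gaugeMk (w, v)) := (gaugeTarget_mk w v).symm
  have h1 := B.gaugeGroupoid.rightTranslate_mfderiv (γ := fun z => B.gaugeMk (z, w)) (z := w)
    (g := B.gaugeMk (w, v)) (mdifferentiableAt_gaugeMk_left w w) (gaugeOne_eq ht).symm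
    (Eventually.of_forall fun z => (gaugeSource_mk z w).trans ht) (ψ.tangentAt w ht a)
  rw [ψ.gaugeTangent_eq ht]
  refine h1.trans ?_
  have h2 : (fun z => B.gaugeGroupoid.mul (B.gaugeMk (z, w)) (B.gaugeMk (w, v))) =
      fun z => B.gaugeMk (z, v) := funext fun z => gaugeMul_mk z w v
  rw [h2]
  refine congrArg _ (ψ.eq_tangentAt ht ?_).symm
  rw [LinearEquiv.apply_symm_apply]
  exact ha.symm

theorem contMDiff_gaugeField (X : Cₛ^∞⟮𝓡 n; F, A⟯) :
    ContMDiff (𝓡 (n + p)) (𝓡 (n + p)).tangent ∞ (fun g =>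
      (⟨g, B.gaugeGroupoid.rightTranslate g (ψ.gaugeTangent (B.gaugeGroupoid.t g)
        (X (B.gaugeGroupoid.t g)))⟩ : TangentBundle (𝓡 (n + p)) B.Gauge)) := fun g =>
  LieGroupoid.contMDiffAt_rightTranslate (𝒢 := B.gaugeGroupoid) contMDiffAt_id
    (ContMDiffAt.comp g (g := fun a : TotalSpace F A =>
        (⟨B.gaugeOne a.proj, ψ.gaugeTangent a.proj a.2⟩ : TangentBundle (𝓡 (n + p)) B.Gauge))
      (f := fun g => (⟨B.gaugeGroupoid.t g, X (B.gaugeGroupoid.t g)⟩ : TotalSpace F A))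
      ψ.contMDiff_gaugeTangent.contMDiffAt
      (ContMDiffAt.comp g (g := fun y => (⟨y, X y⟩ : TotalSpace F A)) X.contMDiff.contMDiffAt
        B.gaugeGroupoid.contMDiff_t.contMDiffAt))
    fun _ => ψ.mfderiv_s_gaugeTangent _ _

/-- An Atiyah algebroid is the Lie algebroid of the gauge groupoid. -/
noncomputable def isoOfGauge : L.IsoOfGroupoid B.gaugeGroupoid where
  fiberEquiv := ψ.gaugeFiberEquiv
  contMDiff_fiberEquiv := ψ.contMDiff_gaugeTangent
  anchor_eq x a := by
    obtain ⟨u, hu⟩ := B.exists_proj_eq x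
    exact TotalSpace.ext (B.gaugeGroupoid.t_one x) (heq_of_eq (ψ.mfderiv_t_gaugeTangent hu a))
  bracket_eq X Y g := by
    obtain ⟨w, v, rfl⟩ := exists_gaugeMk g
    have ht : B.gaugeGroupoid.t (B.gaugeMk (w, v)) = B.proj w := gaugeTarget_mk w v
    have hs : ∀ (X : Cₛ^∞⟮𝓡 n; F, A⟯) (w : P),
        B.gaugeGroupoid.rightTranslate (B.gaugeMk (w, v))
          (ψ.gaugeFiberEquiv (B.gaugeGroupoid.t (B.gaugeMk (w, v)))
            (X (B.gaugeGroupoid.t (B.gaugeMk (w, v))))).1 =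
        mfderiv (𝓡 p) (𝓡 (n + p)) (fun z => B.gaugeMk (z, v)) w
          ((ψ.fiberEquiv w).symm (X (B.proj w))) := fun X w =>
      ψ.rightTranslate_gaugeTangent w v _ _ (by
        rw [show B.gaugeGroupoid.t (B.gaugeMk (w, v)) = B.proj w from gaugeTarget_mk w v])
    rw [hs, ψ.bracket_eq]
    -- Every arrow `[w, v]` is in the image of `z ↦ [z, v]`, so the bracket there is read off from
    -- `P`, where it is the bracket of invariant fields.
    exact mfderiv_mlieBracket_of_related (f := fun z => B.gaugeMk (z, v))
      (contMDiff_gaugeMk_left v).contMDiffAt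
      ((ψ.contMDiff_invariantField X).contMDiffAt.mdifferentiableAt (by simp))
      ((ψ.contMDiff_invariantField Y).contMDiffAt.mdifferentiableAt (by simp))
      ((ψ.contMDiff_gaugeField X).contMDiffAt.mdifferentiableAt (by simp))
      ((ψ.contMDiff_gaugeField Y).contMDiffAt.mdifferentiableAt (by simp))
      (Eventually.of_forall fun w => (hs X w).symm)
      (Eventually.of_forall fun w => (hs Y w).symm)

end LieAlgebroid.AtiyahIso

end GaugeAlgebroid

/-! ### Étale covers of Lie groupoids and their Lie algebroids. -/

section EtaleCovers

open Set Filter Topology Module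

set_option linter.unusedSectionVars false

variable {n k : ℕ} {M : Type uM} [TopologicalSpace M] [ChartedSpace (EuclideanSpace ℝ (Fin n)) M]
  [IsManifold (𝓡 n) ∞ M]
  {Γ : Type uΓ} [TopologicalSpace Γ] [ChartedSpace (EuclideanSpace ℝ (Fin k)) Γ]
  [IsManifold (𝓡 k) ∞ Γ]
  {Γ' : Type uP} [TopologicalSpace Γ']
  {EZ : Type*} [NormedAddCommGroup EZ] [NormedSpace ℝ EZ] {HZ : Type*} [TopologicalSpace HZ]
  {IZ : ModelWithCorners ℝ EZ HZ} {Z : Type*} [TopologicalSpace Z] [ChartedSpace HZ Z]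

variable (Γ') in
/-- A topological groupoid with an étale morphism to a Lie groupoid over the same base. -/
structure LieGroupoid.EtaleCover (𝒢 : LieGroupoid n k M Γ) where
  t2Space : T2Space Γ'
  secondCountable : SecondCountableTopology Γ'
  /-- the morphism -/
  toFun : Γ' → Γ
  /-- units -/
  one : M → Γ'
  /-- inversion -/
  inv : Γ' → Γ'
  /-- multiplication -/
  mul : Γ' → Γ' → Γ'
  isLocalHomeomorph : IsLocalHomeomorph toFun
  toFun_one : ∀ x, toFun (one x) = 𝒢.one x
  toFun_inv : ∀ g, toFun (inv g) = 𝒢.inv (toFun g)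
  toFun_mul : ∀ g h, 𝒢.s (toFun g) = 𝒢.t (toFun h) →
    toFun (mul g h) = 𝒢.mul (toFun g) (toFun h)
  mul_assoc : ∀ g h l, 𝒢.s (toFun g) = 𝒢.t (toFun h) → 𝒢.s (toFun h) = 𝒢.t (toFun l) →
    mul (mul g h) l = mul g (mul h l)
  one_mul : ∀ g, mul (one (𝒢.t (toFun g))) g = g
  mul_one : ∀ g, mul g (one (𝒢.s (toFun g))) = g
  inv_mul : ∀ g, mul (inv g) g = one (𝒢.s (toFun g))
  mul_inv : ∀ g, mul g (inv g) = one (𝒢.t (toFun g))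
  continuous_one : Continuous one
  continuous_inv : Continuous inv
  continuousOn_mul : ContinuousOn (fun q : Γ' × Γ' => mul q.1 q.2)
    {q | 𝒢.s (toFun q.1) = 𝒢.t (toFun q.2)}

namespace LieGroupoid.EtaleCover

variable {𝒢 : LieGroupoid n k M Γ} (C : 𝒢.EtaleCover Γ')

/-- A local inverse of the morphism, as a local homeomorphism. -/
noncomputable def localHomeo (g : Γ') : OpenPartialHomeomorph Γ' Γ :=
  (C.isLocalHomeomorph g).choose

theorem mem_localHomeo_source (g : Γ') : g ∈ (C.localHomeo g).source :=
  (C.isLocalHomeomorph g).choose_spec.1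

theorem coe_localHomeo (g : Γ') : ⇑(C.localHomeo g) = C.toFun :=
  (C.isLocalHomeomorph g).choose_spec.2.symm

/-- All the local homeomorphisms are restrictions of one map, so the transition maps are identities.
-/
theorem localHomeo_compatible (g h : Γ') : ContMDiffOn (𝓡 k) (𝓡 k) ∞
    (C.localHomeo h ∘ (C.localHomeo g).symm)
    ((C.localHomeo g).symm ≫ₕ C.localHomeo h).source := by
  refine contMDiffOn_id.congr fun x hx => ?_
  rw [Function.comp_apply, coe_localHomeo, ← C.coe_localHomeo g]
  exact (C.localHomeo g).right_inv hx.1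

/-- The manifold structure of an étale cover. -/
@[reducible] noncomputable def chartedSpace : ChartedSpace (EuclideanSpace ℝ (Fin k)) Γ' :=
  chartedSpaceOfLocal (𝓡 k) (ContinuousLinearEquiv.refl ℝ _) C.localHomeo C.mem_localHomeo_source

theorem isManifold : letI := C.chartedSpace; IsManifold (𝓡 k) ∞ Γ' :=
  isManifold_chartedSpaceOfLocal _ C.localHomeo_compatible

theorem isSmoothLocalEquiv_localHomeo (g : Γ') :
    letI := C.chartedSpace
    IsSmoothLocalEquiv (𝓡 k) (𝓡 k) (C.localHomeo g) :=
  isSmoothLocalEquiv_chartedSpaceOfLocal (L := ContinuousLinearEquiv.refl ℝ _)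
    C.mem_localHomeo_source C.localHomeo_compatible g

theorem contMDiff_toFun : letI := C.chartedSpace; ContMDiff (𝓡 k) (𝓡 k) ∞ C.toFun := by
  let := C.chartedSpace
  intro g
  have h := (C.isSmoothLocalEquiv_localHomeo g).contMDiffAt (C.mem_localHomeo_source g)
  rwa [coe_localHomeo] at h

/-- By continuity `f` stays near `z` in the domain of a single local inverse, and is that inverse
applied to `C.toFun ∘ f`. -/
theorem contMDiffWithinAt_of_comp {f : Z → Γ'} {s : Set Z} {z : Z}
    (hf : ContinuousWithinAt f s z)
    (h : ContMDiffWithinAt IZ (𝓡 k) ∞ (fun z => C.toFun (f z)) s z) :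
    letI := C.chartedSpace
    ContMDiffWithinAt IZ (𝓡 k) ∞ f s z := by
  let := C.chartedSpace
  set e := C.localHomeo (f z)
  have he : ∀ g ∈ e.source, e.symm (C.toFun g) = g := fun g hg => by
    rw [← C.coe_localHomeo (f z)]
    exact e.left_inv hg
  have h1 : ContMDiffAt (𝓡 k) (𝓡 k) ∞ e.symm (C.toFun (f z)) := by
    rw [← C.coe_localHomeo (f z)]
    exact (C.isSmoothLocalEquiv_localHomeo (f z)).contMDiffAt_symm
      (e.map_source (C.mem_localHomeo_source _))
  refine (h1.comp_contMDiffWithinAt z h).congr_of_eventuallyEq ?_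
    (he _ (C.mem_localHomeo_source _)).symm
  filter_upwards [hf.preimage_mem_nhdsWithin (e.open_source.mem_nhds (C.mem_localHomeo_source _))]
    with w hw using (he _ hw).symm

theorem contMDiff_of_comp {f : Z → Γ'} (hf : Continuous f)
    (h : ContMDiff IZ (𝓡 k) ∞ (fun z => C.toFun (f z))) :
    letI := C.chartedSpace
    ContMDiff IZ (𝓡 k) ∞ f := by
  let := C.chartedSpace
  exact fun z => contMDiffWithinAt_univ.1
    (C.contMDiffWithinAt_of_comp hf.continuousWithinAt (h z).contMDiffWithinAt)

theorem bijective_mfderiv_toFun (g : Γ') :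
    letI := C.chartedSpace
    Function.Bijective (mfderiv (𝓡 k) (𝓡 k) C.toFun g) := by
  let := C.chartedSpace
  have h := C.isSmoothLocalEquiv_localHomeo g
  have h1 := h.mfderiv_symm_comp (C.mem_localHomeo_source g)
  have h2 := h.mfderiv_comp_symm (C.mem_localHomeo_source g)
  rw [coe_localHomeo] at h1 h2
  exact Function.bijective_iff_has_inverse.2 ⟨_, h1, h2⟩

theorem contMDiffAt_of_mfderiv [IsManifold IZ ∞ Z] {f : Z → Γ'} {z : Z}
    (hf : ContinuousAt f z) :
    letI := C.chartedSpace
    haveI := C.isManifold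
    ∀ {v : ∀ z, TangentSpace (𝓡 k) (f z)},
    ContMDiffAt IZ (𝓡 k).tangent ∞
      (fun z => (⟨C.toFun (f z), mfderiv (𝓡 k) (𝓡 k) C.toFun (f z) (v z)⟩ :
        TangentBundle (𝓡 k) Γ)) z →
    ContMDiffAt IZ (𝓡 k).tangent ∞ (fun z => (⟨f z, v z⟩ : TangentBundle (𝓡 k) Γ')) z := by
  let := C.chartedSpace
  have := C.isManifold
  intro v hv
  set e := C.localHomeo (f z)
  have he := C.isSmoothLocalEquiv_localHomeo (f z)
  have hz := C.mem_localHomeo_source (f z)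
  have h1 : ContMDiffAt (𝓡 k) (𝓡 k) ∞ e.symm (C.toFun (f z)) := by
    rw [← C.coe_localHomeo (f z)]
    exact he.contMDiffAt_symm (e.map_source hz)
  refine (contMDiffAt_mfderiv_apply_const (g := fun z => C.toFun (f z)) h1 hv).congr_of_eventuallyEq ?_
  filter_upwards [hf.preimage_mem_nhds (e.open_source.mem_nhds hz)] with w hw
  have h2 := he.mfderiv_symm_comp hw (v w)
  have h3 := e.left_inv hw
  rw [coe_localHomeo] at h2 h3
  exact (TotalSpace.ext (x := (⟨e.symm (C.toFun (f w)), mfderiv (𝓡 k) (𝓡 k) e.symm (C.toFun (f w))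
    (mfderiv (𝓡 k) (𝓡 k) C.toFun (f w) (v w))⟩ : TangentBundle (𝓡 k) Γ')) (y := ⟨f w, v w⟩)
    h3 (heq_of_eq h2)).symm

/-- An étale cover of a Lie groupoid is a Lie groupoid. -/
noncomputable def lieGroupoid :
    letI := C.chartedSpace
    haveI := C.isManifold
    LieGroupoid n k M Γ' :=
  letI := C.chartedSpace
  haveI := C.isManifold
  { t2Space := C.t2Space
    secondCountable := C.secondCountable
    s := fun g => 𝒢.s (C.toFun g)
    t := fun g => 𝒢.t (C.toFun g)
    one := C.one
    inv := C.inv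
    mul := C.mul
    s_one := fun x => by rw [C.toFun_one, 𝒢.s_one]
    t_one := fun x => by rw [C.toFun_one, 𝒢.t_one]
    s_inv := fun g => by rw [C.toFun_inv, 𝒢.s_inv]
    t_inv := fun g => by rw [C.toFun_inv, 𝒢.t_inv]
    s_mul := fun g h hgh => by rw [C.toFun_mul g h hgh, 𝒢.s_mul _ _ hgh]
    t_mul := fun g h hgh => by rw [C.toFun_mul g h hgh, 𝒢.t_mul _ _ hgh]
    mul_assoc := C.mul_assoc
    one_mul := C.one_mul
    mul_one := C.mul_one
    inv_mul := C.inv_mul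
    mul_inv := C.mul_inv
    isSubmersion_s := isSubmersion_of_surjective_mfderiv (𝒢.contMDiff_s.comp C.contMDiff_toFun)
      fun g => by
        change Function.Surjective (mfderiv (𝓡 k) (𝓡 n) (𝒢.s ∘ C.toFun) g)
        rw [mfderiv_comp g (𝒢.contMDiff_s.contMDiffAt.mdifferentiableAt (by simp))
          (C.contMDiff_toFun.contMDiffAt.mdifferentiableAt (by simp))]
        exact (𝒢.surjective_mfderiv_s _).comp (C.bijective_mfderiv_toFun g).2
    isSubmersion_t := isSubmersion_of_surjective_mfderiv (𝒢.contMDiff_t.comp C.contMDiff_toFun)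
      fun g => by
        change Function.Surjective (mfderiv (𝓡 k) (𝓡 n) (𝒢.t ∘ C.toFun) g)
        rw [mfderiv_comp g (𝒢.contMDiff_t.contMDiffAt.mdifferentiableAt (by simp))
          (C.contMDiff_toFun.contMDiffAt.mdifferentiableAt (by simp))]
        exact ((𝒢.isSubmersion_t.isSubmersionAt _).surjective_mfderiv).comp
          (C.bijective_mfderiv_toFun g).2
    contMDiff_one := C.contMDiff_of_comp C.continuous_one (by
      simp only [C.toFun_one]
      exact 𝒢.contMDiff_one)
    contMDiff_inv := C.contMDiff_of_comp C.continuous_inv (by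
      simp only [C.toFun_inv]
      exact 𝒢.contMDiff_inv.comp C.contMDiff_toFun)
    contMDiffOn_mul := fun q hq => by
      refine C.contMDiffWithinAt_of_comp (C.continuousOn_mul q hq) ?_
      refine ContMDiffWithinAt.congr (f := fun q : Γ' × Γ' => 𝒢.mul (C.toFun q.1) (C.toFun q.2)) ?_
        (fun q hq => C.toFun_mul _ _ hq) (C.toFun_mul _ _ hq)
      exact ContMDiffWithinAt.comp (g := fun q : Γ × Γ => 𝒢.mul q.1 q.2)
        (f := fun q : Γ' × Γ' => (C.toFun q.1, C.toFun q.2)) q (𝒢.contMDiffOn_mul _ hq)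
        ((C.contMDiff_toFun.contMDiffAt.comp q contMDiffAt_fst).prodMk
          (C.contMDiff_toFun.contMDiffAt.comp q contMDiffAt_snd)).contMDiffWithinAt
        fun q hq => hq }

section Algebroid

variable {F : Type uF} [NormedAddCommGroup F] [NormedSpace ℝ F] [FiniteDimensional ℝ F]
  {A : M → Type uA} [TopologicalSpace (TotalSpace F A)] [∀ x, TopologicalSpace (A x)]
  [∀ x, AddCommGroup (A x)] [∀ x, Module ℝ (A x)] [FiberBundle F A] [VectorBundle ℝ F A]
  [ContMDiffVectorBundle ∞ F A (𝓡 n)] {L : LieAlgebroid n F A}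

attribute [local instance] LieGroupoid.sourceFiberChartedSpace LieGroupoid.isManifold_sourceFiber

/-- The morphism sends `u g` to the product of the images, so it intertwines right translations. The
vector `v'` is a separate variable because the morphism maps units to units only propositionally. -/
theorem mfderiv_toFun_rightTranslate (g : Γ') :
    letI := C.chartedSpace
    haveI := C.isManifold
    ∀ {v : TangentSpace (𝓡 k) (C.lieGroupoid.one (C.lieGroupoid.t g))}
      {v' : TangentSpace (𝓡 k) (𝒢.one (𝒢.t (C.toFun g)))}
    (_ : mfderiv (𝓡 k) (𝓡 n) C.lieGroupoid.s (C.lieGroupoid.one (C.lieGroupoid.t g)) v = 0)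
    (_ : mfderiv (𝓡 k) (𝓡 k) C.toFun (C.lieGroupoid.one (C.lieGroupoid.t g)) v = v'),
    mfderiv (𝓡 k) (𝓡 k) C.toFun g (C.lieGroupoid.rightTranslate g v) =
      𝒢.rightTranslate (C.toFun g) v' := by
  let := C.chartedSpace
  have := C.isManifold
  intro v v' hv hv'
  obtain ⟨w, rfl⟩ := C.lieGroupoid.exists_fiber_tangent hv
  rw [LieGroupoid.rightTranslate_fiber,
    LieGroupoid.mfderiv_comp_fiber_mul _ _ (C.contMDiff_toFun.contMDiffAt.mdifferentiableAt
      (by simp))]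
  have h1 := (C.contMDiff_toFun.contMDiffAt (x := C.lieGroupoid.one
    (C.lieGroupoid.t g))).mdifferentiableAt (by simp)
  have h2 := h1.hasMFDerivAt.comp (C.lieGroupoid.fiberOne (C.lieGroupoid.t g))
    ((C.lieGroupoid.contMDiff_sourceFiber_val _).contMDiffAt.mdifferentiableAt
      (by simp)).hasMFDerivAt
  have h3 := 𝒢.rightTranslate_mfderiv (g := C.toFun g) h2.mdifferentiableAt (C.toFun_one _)
    (Eventually.of_forall fun u => u.2) w
  rw [h2.mfderiv] at h3
  have h4 : 𝒢.rightTranslate (C.toFun g) v' = mfderiv (𝓡 (sourceFiberDim n k)) (𝓡 k)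
      (fun u : C.lieGroupoid.SourceFiber (C.lieGroupoid.t g) =>
        𝒢.mul (C.toFun u.1) (C.toFun g)) (C.lieGroupoid.fiberOne (C.lieGroupoid.t g)) w := by
    rw [← hv']
    exact h3
  rw [h4]
  have h5 : (fun u : C.lieGroupoid.SourceFiber (C.lieGroupoid.t g) =>
      C.toFun (C.lieGroupoid.mul u.1 g)) = fun u => 𝒢.mul (C.toFun u.1) (C.toFun g) :=
    funext fun u => C.toFun_mul _ _ u.2
  rw [h5]
  rfl

variable (φ : L.IsoOfGroupoid 𝒢)

/-- The lift of an isomorphism to the Lie algebroid of a groupoid to an étale cover. -/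
noncomputable def liftTangent (x : M) :
    letI := C.chartedSpace
    A x →ₗ[ℝ] TangentSpace (𝓡 k) (C.one x) :=
  letI := C.chartedSpace
  (LinearEquiv.ofBijective
    (mfderiv (𝓡 k) (𝓡 k) C.toFun (C.one x) : TangentSpace (𝓡 k) (C.one x) →L[ℝ]
      TangentSpace (𝓡 k) (𝒢.one x)).toLinearMap
    (C.bijective_mfderiv_toFun _)).symm.toLinearMap ∘ₗ
      (LinearMap.ker (mfderiv (𝓡 k) (𝓡 n) 𝒢.s (𝒢.one x)).toLinearMap).subtype ∘ₗ
      (φ.fiberEquiv x).toLinearMap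

theorem mfderiv_toFun_liftTangent (x : M) (a : A x) :
    letI := C.chartedSpace
    mfderiv (𝓡 k) (𝓡 k) C.toFun (C.one x) (C.liftTangent φ x a) =
      (show TangentSpace (𝓡 k) (𝒢.one x) from (φ.fiberEquiv x a).1) := by
  let := C.chartedSpace
  exact LinearEquiv.apply_symm_apply (LinearEquiv.ofBijective
    (mfderiv (𝓡 k) (𝓡 k) C.toFun (C.one x) : TangentSpace (𝓡 k) (C.one x) →L[ℝ]
      TangentSpace (𝓡 k) (𝒢.one x)).toLinearMap (C.bijective_mfderiv_toFun _)) _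

theorem mfderiv_comp_liftTangent (x : M) (a : A x) {f : Γ → M}
    (hf : ContMDiff (𝓡 k) (𝓡 n) ∞ f) :
    letI := C.chartedSpace
    mfderiv (𝓡 k) (𝓡 n) (fun g => f (C.toFun g)) (C.one x) (C.liftTangent φ x a) =
      (show EuclideanSpace ℝ (Fin n) from
        mfderiv (𝓡 k) (𝓡 n) f (𝒢.one x) (φ.fiberEquiv x a).1) := by
  let := C.chartedSpace
  have h1 : HasMFDerivAt (𝓡 k) (𝓡 n) f (C.toFun (C.one x)) (mfderiv (𝓡 k) (𝓡 n) f (𝒢.one x)) := by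
    rw [C.toFun_one]
    exact (hf.contMDiffAt.mdifferentiableAt (by simp)).hasMFDerivAt
  have h2 := h1.comp (C.one x)
    (C.contMDiff_toFun.contMDiffAt.mdifferentiableAt (by simp)).hasMFDerivAt
  refine (DFunLike.congr_fun h2.mfderiv (C.liftTangent φ x a)).trans ?_
  exact congrArg (mfderiv (𝓡 k) (𝓡 n) f (𝒢.one x)) (C.mfderiv_toFun_liftTangent φ x a)

theorem mfderiv_s_liftTangent (x : M) (a : A x) :
    letI := C.chartedSpace
    haveI := C.isManifold
    mfderiv (𝓡 k) (𝓡 n) C.lieGroupoid.s (C.lieGroupoid.one x) (C.liftTangent φ x a) = 0 := by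
  let := C.chartedSpace
  have := C.isManifold
  exact (C.mfderiv_comp_liftTangent φ x a 𝒢.contMDiff_s).trans (φ.fiberEquiv x a).2

theorem liftTangent_injective (x : M) : Function.Injective (C.liftTangent φ x) := by
  let := C.chartedSpace
  refine fun a b h => (φ.fiberEquiv x).injective (Subtype.ext ?_)
  have h1 := congrArg (mfderiv (𝓡 k) (𝓡 k) C.toFun (C.one x)) h
  rw [mfderiv_toFun_liftTangent, mfderiv_toFun_liftTangent] at h1
  exact h1

/-- The lift of an isomorphism to the Lie algebroid of a groupoid to an étale cover. -/
noncomputable def liftFiberEquiv (x : M) :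
    letI := C.chartedSpace
    haveI := C.isManifold
    A x ≃ₗ[ℝ] LinearMap.ker (mfderiv (𝓡 k) (𝓡 n) C.lieGroupoid.s
      (C.lieGroupoid.one x)).toLinearMap :=
  letI := C.chartedSpace
  haveI := C.isManifold
  haveI : FiniteDimensional ℝ (TangentSpace (𝓡 k) (𝒢.one x)) :=
    inferInstanceAs (FiniteDimensional ℝ (EuclideanSpace ℝ (Fin k)))
  haveI : FiniteDimensional ℝ (A x) := (φ.fiberEquiv x).symm.finiteDimensional
  haveI : FiniteDimensional ℝ (TangentSpace (𝓡 k) (C.lieGroupoid.one x)) :=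
    inferInstanceAs (FiniteDimensional ℝ (EuclideanSpace ℝ (Fin k)))
  LinearMap.linearEquivOfInjective
    (LinearMap.codRestrict (LinearMap.ker (mfderiv (𝓡 k) (𝓡 n) C.lieGroupoid.s
      (C.lieGroupoid.one x)).toLinearMap) (C.liftTangent φ x) (C.mfderiv_s_liftTangent φ x))
    (fun _ _ h => C.liftTangent_injective φ x (congrArg Subtype.val h))
    ((φ.fiberEquiv x).finrank_eq.trans ((𝒢.finrank_ker_mfderiv_s _).trans
      (C.lieGroupoid.finrank_ker_mfderiv_s _).symm))

theorem contMDiff_liftTangent :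
    letI := C.chartedSpace
    haveI := C.isManifold
    ContMDiff ((𝓡 n).prod 𝓘(ℝ, F)) (𝓡 k).tangent ∞ (fun a : TotalSpace F A =>
      (⟨C.one a.proj, C.liftTangent φ a.proj a.2⟩ : TangentBundle (𝓡 k) Γ')) := by
  let := C.chartedSpace
  have := C.isManifold
  intro a
  refine C.contMDiffAt_of_mfderiv (f := fun a : TotalSpace F A => C.one a.proj)
    (C.continuous_one.comp (FiberBundle.continuous_proj F A)).continuousAt ?_
  refine φ.contMDiff_fiberEquiv.contMDiffAt.congr_of_eventuallyEq (Eventually.of_forall fun a => ?_)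
  exact TotalSpace.ext (C.toFun_one _) (heq_of_eq (C.mfderiv_toFun_liftTangent φ _ a.2))

theorem mfderiv_toFun_rightTranslate_liftTangent (g : Γ') (a : A (𝒢.t (C.toFun g))) :
    letI := C.chartedSpace
    haveI := C.isManifold
    mfderiv (𝓡 k) (𝓡 k) C.toFun g (C.lieGroupoid.rightTranslate g (C.liftTangent φ _ a)) =
      𝒢.rightTranslate (C.toFun g) (φ.fiberEquiv _ a).1 := by
  let := C.chartedSpace
  have := C.isManifold
  exact C.mfderiv_toFun_rightTranslate g (C.mfderiv_s_liftTangent φ _ a)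
    (C.mfderiv_toFun_liftTangent φ _ a)

theorem contMDiff_liftField (X : Cₛ^∞⟮𝓡 n; F, A⟯) :
    letI := C.chartedSpace
    haveI := C.isManifold
    ContMDiff (𝓡 k) (𝓡 k).tangent ∞ (fun g => (⟨g, C.lieGroupoid.rightTranslate g
      (C.liftTangent φ _ (X (𝒢.t (C.toFun g))))⟩ : TangentBundle (𝓡 k) Γ')) := by
  let := C.chartedSpace
  have := C.isManifold
  intro g
  refine C.contMDiffAt_of_mfderiv (f := fun g => g) continuousAt_id ?_
  simp only [mfderiv_toFun_rightTranslate_liftTangent]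
  exact ContMDiffAt.comp g (φ.contMDiff_rightInvariant_section X).contMDiffAt
    C.contMDiff_toFun.contMDiffAt

/-- The Lie algebroid of an étale cover is the Lie algebroid of the groupoid. -/
noncomputable def isoOfEtaleCover :
    letI := C.chartedSpace
    haveI := C.isManifold
    L.IsoOfGroupoid C.lieGroupoid :=
  letI := C.chartedSpace
  haveI := C.isManifold
  { fiberEquiv := C.liftFiberEquiv φ
    contMDiff_fiberEquiv := C.contMDiff_liftTangent φ
    anchor_eq := fun x a => by
      refine Eq.trans ?_ (φ.anchor_eq x a)
      exact TotalSpace.ext (congrArg 𝒢.t (C.toFun_one x))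
        (heq_of_eq (C.mfderiv_comp_liftTangent φ x a 𝒢.contMDiff_t))
    bracket_eq := fun X Y g => by
      -- The covering map has injective differential and relates the lifted right-invariant fields
      -- to those of the original groupoid.
      apply (C.bijective_mfderiv_toFun g).1
      refine (C.mfderiv_toFun_rightTranslate_liftTangent φ g _).trans ?_
      refine (φ.bracket_eq X Y (C.toFun g)).trans (mfderiv_mlieBracket_of_related
        (f := C.toFun) C.contMDiff_toFun.contMDiffAt
        ((C.contMDiff_liftField φ X).contMDiffAt.mdifferentiableAt (by simp))
        ((C.contMDiff_liftField φ Y).contMDiffAt.mdifferentiableAt (by simp))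
        ((φ.contMDiff_rightInvariant_section X).contMDiffAt.mdifferentiableAt (by simp))
        ((φ.contMDiff_rightInvariant_section Y).contMDiffAt.mdifferentiableAt (by simp))
        (Eventually.of_forall fun g => C.mfderiv_toFun_rightTranslate_liftTangent φ g _)
        (Eventually.of_forall fun g => C.mfderiv_toFun_rightTranslate_liftTangent φ g _)).symm }

end Algebroid

end LieGroupoid.EtaleCover

end EtaleCovers

/-! ### The space of homotopy classes of paths, étale and separated over the pairs of end points. -/

section PathClasses

open Set Filter Topology unitInterval

/-- An open set any two points of which are joined by a preferred path inside it, depending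
continuously on them, to which every path between them inside the set is homotopic. -/
structure SegmentSet (X : Type*) [TopologicalSpace X] where
  carrier : Set X
  isOpen : IsOpen carrier
  /-- the preferred path -/
  seg : ∀ q : carrier × carrier, Path q.1.1 q.2.1
  continuous_seg : Continuous ↿seg
  seg_mem : ∀ q t, seg q t ∈ carrier
  homotopic : ∀ (q : carrier × carrier) (γ : Path q.1.1 q.2.1), (∀ t, γ t ∈ carrier) →
    γ.Homotopic (seg q)

/-- Every point has arbitrarily small neighbourhoods of the form `SegmentSet`. -/
def HasSegmentBasis (X : Type*) [TopologicalSpace X] : Prop :=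
  ∀ (x : X) (O : Set X), O ∈ 𝓝 x → ∃ U : SegmentSet X, x ∈ U.carrier ∧ U.carrier ⊆ O

/-- Preimages of small balls under charts serve: convexity provides segments that depend
continuously on their end points. -/
theorem hasSegmentBasis_of_chartedSpace (E : Type*) [NormedAddCommGroup E] [NormedSpace ℝ E]
    (X : Type*) [TopologicalSpace X] [ChartedSpace E X] : HasSegmentBasis X := by
  intro x O hO
  set φ := chartAt E x
  have hx : x ∈ φ.source := mem_chart_source E x
  have h1 : φ.target ∩ φ.symm ⁻¹' O ∈ 𝓝 (φ x) := by
    refine inter_mem (φ.open_target.mem_nhds (φ.map_source hx)) ?_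
    refine (φ.symm.continuousAt (φ.map_source hx)).preimage_mem_nhds ?_
    rwa [φ.left_inv hx]
  obtain ⟨ε, hε, hB⟩ := Metric.mem_nhds_iff.1 h1
  set C := Metric.ball (φ x) ε
  have hC : Convex ℝ C := convex_ball _ _
  have hmem : ∀ {v}, v ∈ C → φ.symm v ∈ φ.source ∩ φ ⁻¹' C := fun {v} hv =>
    ⟨φ.map_target (hB hv).1, by rw [mem_preimage, φ.right_inv (hB hv).1]; exact hv⟩
  have hline : ∀ {v w : E}, v ∈ C → w ∈ C → ∀ t : I, AffineMap.lineMap v w (t : ℝ) ∈ C :=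
    fun hv hw t => hC.lineMap_mem hv hw t.2
  have hcl : Continuous fun q : E × E × I => AffineMap.lineMap q.1 q.2.1 (q.2.2 : ℝ) := by
    simp only [AffineMap.lineMap_apply_module']
    fun_prop
  have hsy : ContinuousOn φ.symm C := φ.continuousOn_symm.mono fun v hv => (hB hv).1
  refine ⟨{
    carrier := φ.source ∩ φ ⁻¹' C
    isOpen := φ.isOpen_inter_preimage Metric.isOpen_ball
    seg := fun q =>
      { toFun := fun t => φ.symm (AffineMap.lineMap (φ q.1.1) (φ q.2.1) (t : ℝ))
        continuous_toFun := hsy.comp_continuous (hcl.comp (Continuous.prodMk continuous_const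
          (Continuous.prodMk continuous_const continuous_id))) fun t => hline q.1.2.2 q.2.2.2 t
        source' := by simp [φ.left_inv q.1.2.1]
        target' := by simp [φ.left_inv q.2.2.1] }
    continuous_seg := ?_
    seg_mem := fun q t => hmem (hline q.1.2.2 q.2.2.2 t)
    -- The straight-line homotopy in the chart, from the path to the segment.
    homotopic := fun q γ hγ => ⟨{
      toFun := fun z => φ.symm (AffineMap.lineMap (φ (γ z.2))
        (AffineMap.lineMap (φ q.1.1) (φ q.2.1) (z.2 : ℝ)) (z.1 : ℝ))
      continuous_toFun := ?_
      map_zero_left := fun t => by simp [φ.left_inv (hγ t).1]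
      map_one_left := fun t => by simp
      prop' := ?_ }⟩ }, ⟨hx, Metric.mem_ball_self hε⟩, ?_⟩
  · refine hsy.comp_continuous (hcl.comp (Continuous.prodMk
      (φ.continuousOn.comp_continuous
        (continuous_subtype_val.comp (continuous_fst.comp continuous_fst)) fun z => z.1.1.2.1)
      (Continuous.prodMk
        (φ.continuousOn.comp_continuous
          (continuous_subtype_val.comp (continuous_snd.comp continuous_fst)) fun z => z.1.2.2.1)
        continuous_snd))) fun z => hline z.1.1.2.2 z.1.2.2.2 z.2
  · have h2 : Continuous fun z : I × I => φ (γ z.2) :=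
      φ.continuousOn.comp_continuous (γ.continuous.comp continuous_snd) fun z => (hγ z.2).1
    have h3 : Continuous fun z : I × I => AffineMap.lineMap (φ q.1.1) (φ q.2.1) (z.2 : ℝ) :=
      hcl.comp (Continuous.prodMk continuous_const (Continuous.prodMk continuous_const
        continuous_snd))
    refine hsy.comp_continuous (hcl.comp (h2.prodMk (h3.prodMk continuous_fst)))
      fun z => hline (hγ z.2).2 (hline q.1.2.2 q.2.2.2 z.2) z.1
  · rintro s t (rfl | rfl)
    · simp [φ.left_inv q.1.2.1]
    · simp [φ.left_inv q.2.2.1]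
  · rintro y ⟨hy, hy'⟩
    have := (hB hy').2
    rwa [mem_preimage, φ.left_inv hy] at this

namespace SegmentSet

variable {X : Type*} [TopologicalSpace X] (U V W : SegmentSet X)

open Path.Homotopic.Quotient (trans symm refl)

/-- The homotopy class of the preferred path. -/
noncomputable def segClass (a b : U.carrier) : Path.Homotopic.Quotient a.1 b.1 :=
  Path.Homotopic.Quotient.mk (U.seg (a, b))

theorem mk_eq_segClass {a b : X} (ha : a ∈ U.carrier) (hb : b ∈ U.carrier) {γ : Path a b}
    (hγ : ∀ t, γ t ∈ U.carrier) : Path.Homotopic.Quotient.mk γ = U.segClass ⟨a, ha⟩ ⟨b, hb⟩ :=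
  Path.Homotopic.Quotient.eq.2 (U.homotopic (⟨a, ha⟩, ⟨b, hb⟩) γ hγ)

theorem segClass_self (a : U.carrier) : U.segClass a a = refl a.1 := by
  rw [← Path.Homotopic.Quotient.mk_refl]
  exact (U.mk_eq_segClass a.2 a.2 fun _ => a.2).symm

theorem segClass_trans (a b c : U.carrier) :
    trans (U.segClass a b) (U.segClass b c) = U.segClass a c := by
  rw [segClass, segClass, ← Path.Homotopic.Quotient.mk_trans]
  refine U.mk_eq_segClass a.2 c.2 fun t => ?_
  have h : ((U.seg (a, b)).trans (U.seg (b, c))) t ∈ range ((U.seg (a, b)).trans (U.seg (b, c))) :=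
    mem_range_self t
  rw [Path.trans_range] at h
  rcases h with ⟨s, hs⟩ | ⟨s, hs⟩
  · exact hs ▸ U.seg_mem _ _
  · exact hs ▸ U.seg_mem _ _

variable {U V} in
theorem segClass_of_subset (h : U.carrier ⊆ V.carrier) (a b : U.carrier) :
    U.segClass a b = V.segClass ⟨a.1, h a.2⟩ ⟨b.1, h b.2⟩ :=
  V.mk_eq_segClass (h a.2) (h b.2) fun _ => h (U.seg_mem _ _)

end SegmentSet

/-- The homotopy classes, relative to the end points, of paths in a space. -/
def PathClass (X : Type*) [TopologicalSpace X] : Type _ :=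
  Σ e : X × X, Path.Homotopic.Quotient e.1 e.2

namespace PathClass

variable {X : Type*} [TopologicalSpace X]

open Path.Homotopic.Quotient (trans mk symm refl trans_assoc refl_trans trans_refl mk_trans
  mk_refl)

/-- A homotopy class of paths with given end points. -/
def of {a b : X} (q : Path.Homotopic.Quotient a b) : PathClass X := ⟨(a, b), q⟩

/-- The homotopy class of a path. -/
def ofPath {a b : X} (γ : Path a b) : PathClass X := of (mk γ)

/-- The two end points. -/
def ends (p : PathClass X) : X × X := p.1

theorem of_injective {a b : X} {q q' : Path.Homotopic.Quotient a b} (h : of q = of q') :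
    q = q' :=
  eq_of_heq (Sigma.mk.inj h).2

theorem exists_of (p : PathClass X) : ∃ (a b : X) (q : Path.Homotopic.Quotient a b), of q = p :=
  ⟨p.1.1, p.1.2, p.2, rfl⟩

theorem exists_ofPath (p : PathClass X) : ∃ (a b : X) (γ : Path a b), ofPath γ = p := by
  obtain ⟨⟨a, b⟩, q⟩ := p
  obtain ⟨γ, rfl⟩ := Path.Homotopic.Quotient.mk_surjective q
  exact ⟨a, b, γ, rfl⟩

theorem ofPath_eq_ofPath {a b a' b' : X} {γ : Path a b} {δ : Path a' b'} (h : ∀ t, γ t = δ t) :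
    ofPath γ = ofPath δ := by
  have ha : a = a' := by rw [← γ.source, h, δ.source]
  have hb : b = b' := by rw [← γ.target, h, δ.target]
  subst ha hb
  rw [show γ = δ from Path.ext (funext h)]

/-- The classes of the paths obtained from a path by small changes at the end points. -/
noncomputable def spread (U V : SegmentSet X) (a : U.carrier) (b : V.carrier)
    (q : Path.Homotopic.Quotient a.1 b.1) (z : U.carrier × V.carrier) : PathClass X :=
  of (trans (U.segClass z.1 a) (trans q (V.segClass b z.2)))

noncomputable instance : TopologicalSpace (PathClass X) :=
  ⨆ (U : SegmentSet X) (V : SegmentSet X) (a : U.carrier) (b : V.carrier)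
    (q : Path.Homotopic.Quotient a.1 b.1), TopologicalSpace.coinduced (spread U V a b q)
      inferInstance

theorem isOpen_iff {S : Set (PathClass X)} :
    IsOpen S ↔ ∀ (U V : SegmentSet X) (a : U.carrier) (b : V.carrier)
      (q : Path.Homotopic.Quotient a.1 b.1), IsOpen (spread U V a b q ⁻¹' S) := by
  simp only [isOpen_iSup_iff, isOpen_coinduced]

section Spread

variable (U V : SegmentSet X) (a : U.carrier) (b : V.carrier) (q : Path.Homotopic.Quotient a.1 b.1)

theorem continuous_spread : Continuous (spread U V a b q) :=
  ⟨fun _ hS => isOpen_iff.1 hS U V a b q⟩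

theorem spread_self : spread U V a b q (a, b) = of q := by
  rw [spread, U.segClass_self, V.segClass_self, refl_trans, trans_refl]

theorem spread_injective : Function.Injective (spread U V a b q) := by
  rintro ⟨⟨u, hu⟩, ⟨v, hv⟩⟩ ⟨⟨u', hu'⟩, ⟨v', hv'⟩⟩ h
  cases congrArg ends h
  rfl

variable {U V} in
-- Recentring: the segments from the old centres to the new ones are absorbed into the class `q`.
theorem spread_of_subset {U' V' : SegmentSet X} (hU : U'.carrier ⊆ U.carrier)
    (hV : V'.carrier ⊆ V.carrier) (a' : U'.carrier) (b' : V'.carrier)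
    (z : U'.carrier × V'.carrier) :
    spread U V a b q (⟨z.1.1, hU z.1.2⟩, ⟨z.2.1, hV z.2.2⟩) =
      spread U' V' a' b' (trans (U.segClass ⟨a'.1, hU a'.2⟩ a)
        (trans q (V.segClass b ⟨b'.1, hV b'.2⟩))) z := by
  rw [spread, spread, SegmentSet.segClass_of_subset hU, SegmentSet.segClass_of_subset hV]
  simp only [trans_assoc]
  rw [V.segClass_trans, ← trans_assoc (U.segClass _ _) (U.segClass _ _), U.segClass_trans]

/-- Two spreads that share a class agree on a smaller product neighbourhood of its end points, since
both can be recentred there. Hence the image of an open set is open when tested against any other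
spread. -/
theorem isOpenMap_spread (hX : HasSegmentBasis X) : IsOpenMap (spread U V a b q) := by
  intro O hO
  obtain ⟨O', hO', rfl⟩ :=
    (IsInducing.subtypeVal.prodMap IsInducing.subtypeVal).isOpen_iff.1 hO
  refine isOpen_iff.2 fun U' V' a' b' q' => isOpen_iff_mem_nhds.2 ?_
  rintro ⟨⟨u, hu'⟩, ⟨v, hv'⟩⟩ ⟨⟨⟨u1, hu⟩, ⟨v1, hv⟩⟩, hz, h⟩
  cases congrArg ends h
  obtain ⟨U₀, hu0, hU₀⟩ := hX u _ (inter_mem (U.isOpen.mem_nhds hu) (U'.isOpen.mem_nhds hu'))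
  obtain ⟨V₀, hv0, hV₀⟩ := hX v _ (inter_mem (V.isOpen.mem_nhds hv) (V'.isOpen.mem_nhds hv'))
  have h1 : Continuous fun z : U'.carrier × V'.carrier => z.1.1 := by fun_prop
  have h2 : Continuous fun z : U'.carrier × V'.carrier => z.2.1 := by fun_prop
  filter_upwards [h1.continuousAt.preimage_mem_nhds (U₀.isOpen.mem_nhds hu0),
    h2.continuousAt.preimage_mem_nhds (V₀.isOpen.mem_nhds hv0),
    (h1.prodMk h2).continuousAt.preimage_mem_nhds (hO'.mem_nhds hz)] with w hw1 hw2 hw3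
  refine ⟨(⟨w.1.1, (hU₀ hw1).1⟩, ⟨w.2.1, (hV₀ hw2).1⟩), hw3, ?_⟩
  have e1 := spread_of_subset a b q (hU₀.trans inter_subset_left) (hV₀.trans inter_subset_left)
    ⟨u, hu0⟩ ⟨v, hv0⟩ (⟨w.1.1, hw1⟩, ⟨w.2.1, hw2⟩)
  have e2 := spread_of_subset a' b' q' (hU₀.trans inter_subset_right)
    (hV₀.trans inter_subset_right) ⟨u, hu0⟩ ⟨v, hv0⟩ (⟨w.1.1, hw1⟩, ⟨w.2.1, hw2⟩)
  exact e1.trans ((congrArg (fun r => spread U₀ V₀ ⟨u, hu0⟩ ⟨v, hv0⟩ r _)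
    (of_injective h)).trans e2.symm)

end Spread

theorem continuous_ends : Continuous (ends : PathClass X → X × X) :=
  ⟨fun S hS => isOpen_iff.2 fun U V _ _ _ => hS.preimage (f := fun z : U.carrier × V.carrier =>
    ((z.1.1, z.2.1) : X × X)) (by fun_prop)⟩

theorem exists_spread (hX : HasSegmentBasis X) (p : PathClass X) : ∃ (U V : SegmentSet X)
    (a : U.carrier) (b : V.carrier) (q : Path.Homotopic.Quotient a.1 b.1),
    spread U V a b q (a, b) = p ∧ p = of q := by
  obtain ⟨a, b, q, rfl⟩ := exists_of p
  obtain ⟨U, ha, -⟩ := hX a _ univ_mem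
  obtain ⟨V, hb, -⟩ := hX b _ univ_mem
  exact ⟨U, V, ⟨a, ha⟩, ⟨b, hb⟩, q, spread_self _ _ _ _ _, rfl⟩

theorem isOpenEmbedding_ends_spread (U V : SegmentSet X) (a : U.carrier) (b : V.carrier)
    (q : Path.Homotopic.Quotient a.1 b.1) : IsOpenEmbedding (ends ∘ spread U V a b q) :=
  U.isOpen.isOpenEmbedding_subtypeVal.prodMap V.isOpen.isOpenEmbedding_subtypeVal

/-- On the image of a spread, the end points are the parameters of that spread. -/
theorem isLocalHomeomorph_ends (hX : HasSegmentBasis X) :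
    IsLocalHomeomorph (ends : PathClass X → X × X) := by
  refine isLocalHomeomorph_iff_isOpenEmbedding_restrict.2 fun p => ?_
  obtain ⟨U, V, a, b, q, hp, -⟩ := exists_spread hX p
  have ho := isOpenMap_spread U V a b q hX
  have h1 : IsOpenEmbedding (spread U V a b q) :=
    .of_continuous_injective_isOpenMap (continuous_spread U V a b q) (spread_injective U V a b q) ho
  refine ⟨range (spread U V a b q), ho.isOpen_range.mem_nhds (hp ▸ mem_range_self _), ?_⟩
  refine .of_continuous_injective_isOpenMap (continuous_ends.comp continuous_subtype_val) ?_ ?_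
  · rintro ⟨_, z, rfl⟩ ⟨_, z', rfl⟩ h
    exact Subtype.ext (congrArg (spread U V a b q) ((isOpenEmbedding_ends_spread U V a b q).injective h))
  · intro S hS
    have h2 := (isOpenEmbedding_ends_spread U V a b q).isOpenMap _
      (hS.preimage (h1.continuous.codRestrict fun z => mem_range_self z))
    convert h2 using 1
    ext e
    constructor
    · rintro ⟨⟨_, z, rfl⟩, hz, rfl⟩
      exact ⟨z, hz, rfl⟩
    · rintro ⟨z, hz, rfl⟩
      exact ⟨_, hz, rfl⟩

/-- Two classes with the same ends are spread over the same neighbourhoods. A common class of the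
spreads would, after cancelling the added segments, force the two original classes to coincide. -/
theorem isSeparatedMap_ends (hX : HasSegmentBasis X) :
    IsSeparatedMap (ends : PathClass X → X × X) := by
  rintro ⟨⟨a, b⟩, q⟩ ⟨⟨a', b'⟩, q'⟩ h hne
  cases h
  obtain ⟨U, ha, -⟩ := hX a _ univ_mem
  obtain ⟨V, hb, -⟩ := hX b _ univ_mem
  refine ⟨range (spread U V ⟨a, ha⟩ ⟨b, hb⟩ q), range (spread U V ⟨a, ha⟩ ⟨b, hb⟩ q'),
    (isOpenMap_spread _ _ _ _ _ hX).isOpen_range, (isOpenMap_spread _ _ _ _ _ hX).isOpen_range,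
    ⟨(⟨a, ha⟩, ⟨b, hb⟩), spread_self _ _ _ _ _⟩, ⟨(⟨a, ha⟩, ⟨b, hb⟩), spread_self _ _ _ _ _⟩, ?_⟩
  rw [Set.disjoint_left]
  rintro _ ⟨⟨⟨u, hu⟩, ⟨v, hv⟩⟩, rfl⟩ ⟨⟨⟨u', hu'⟩, ⟨v', hv'⟩⟩, h⟩
  cases congrArg ends h
  refine hne (congrArg (Sigma.mk (a, b)) ?_)
  have h1 := congrArg (fun r => trans (U.segClass ⟨a, ha⟩ ⟨u, hu⟩)
    (trans r (V.segClass ⟨v, hv⟩ ⟨b, hb⟩))) (of_injective h)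
  simp only [trans_assoc, V.segClass_trans, V.segClass_self, trans_refl] at h1
  rw [← trans_assoc, ← trans_assoc, U.segClass_trans, U.segClass_self, refl_trans, refl_trans] at h1
  exact h1.symm

end PathClass

end PathClasses

/-! ### Continuous families of paths; simple connectedness of the classes with fixed start. -/

section PathClassFamilies

open Set Filter Topology unitInterval

namespace PathClass

universe u

variable {X : Type u} [TopologicalSpace X]

open Path.Homotopic.Quotient (trans mk symm refl trans_assoc refl_trans trans_refl mk_trans
  mk_refl)

theorem continuous_ofPath_refl (hX : HasSegmentBasis X) :
    Continuous fun x : X => ofPath (Path.refl x) := by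
  refine continuous_iff_continuousAt.2 fun x => ?_
  obtain ⟨U, hx, -⟩ := hX x _ univ_mem
  refine (U.isOpen.isOpenEmbedding_subtypeVal.continuousAt_iff (x := ⟨x, hx⟩)).1 ?_
  refine Continuous.continuousAt ?_
  convert (continuous_spread U U ⟨x, hx⟩ ⟨x, hx⟩ (refl x)).comp
    (continuous_id.prodMk continuous_id) using 1
  funext y
  simp only [Function.comp_apply, spread, refl_trans, U.segClass_trans, U.segClass_self, id]
  rfl

/-- For `t` near `t₀`, the path up to `t` is the path up to `t₀` followed by a short piece inside a
segment set, which is homotopic to the preferred segment. -/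
theorem continuous_ofPath_subpath (hX : HasSegmentBasis X) {a b : X} (γ : Path a b) :
    Continuous fun t => ofPath (γ.subpath 0 t) := by
  refine continuous_iff_continuousAt.2 fun t₀ => ?_
  obtain ⟨U, hU, -⟩ := hX (γ 0) _ univ_mem
  obtain ⟨V, hV, -⟩ := hX (γ t₀) _ univ_mem
  -- Compactness of the interval keeps the whole short piece inside `V` for all `t` close to `t₀`.
  have h1 : ∀ᶠ t in 𝓝 t₀, ∀ s ∈ univ, γ.subpath t₀ t s ∈ V.carrier := by
    refine isCompact_univ.eventually_forall_of_forall_eventually fun s _ => ?_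
    have h2 : Continuous fun q : I × I => γ.subpath t₀ q.1 q.2 :=
      γ.subpath_continuous_family.comp (by fun_prop : Continuous fun q : I × I => (t₀, q.1, q.2))
    refine h2.continuousAt.preimage_mem_nhds (V.isOpen.mem_nhds ?_)
    simpa using hV
  have h3 : Continuous fun t : γ ⁻¹' V.carrier => spread U V ⟨γ 0, hU⟩ ⟨γ t₀, hV⟩
      (mk (γ.subpath 0 t₀)) (⟨γ 0, hU⟩, ⟨γ t.1, t.2⟩) :=
    (continuous_spread _ _ _ _ _).comp (by fun_prop)
  refine ((V.isOpen.preimage γ.continuous).isOpenEmbedding_subtypeVal.continuousAt_iff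
    (x := ⟨t₀, hV⟩)).1 (h3.continuousAt.congr ?_)
  filter_upwards [continuous_subtype_val.continuousAt.eventually h1] with t ht
  rw [spread, U.segClass_self, refl_trans,
    ← V.mk_eq_segClass hV t.2 fun s => ht s (mem_univ s), ← mk_trans]
  exact congrArg of (Path.Homotopic.Quotient.eq.2 ⟨Path.Homotopy.subpathTransSubpath γ 0 t₀ t.1⟩)

/-- The class of a path depends continuously on the path. -/
theorem continuous_ofPath (hX : HasSegmentBasis X) {Z : Type*} [TopologicalSpace Z] {a b : Z → X}
    (γ : ∀ z, Path (a z) (b z)) (hγ : Continuous ↿γ) : Continuous fun z => ofPath (γ z) := by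
  have h0 : ∀ t : I, Continuous fun z => γ z t := fun t => hγ.comp (by fun_prop :
    Continuous fun z => (z, t))
  -- Joint continuity by lifting along the separated local homeomorphism `ends`: the projection is
  -- jointly continuous, the lift is continuous at time `0`, where the paths are constant, and
  -- continuous in time for each fixed `z`.
  have h1 : Continuous fun q : I × Z => ofPath ((γ q.2).subpath 0 q.1) := by
    refine (isLocalHomeomorph_ends hX).continuous_lift (isSeparatedMap_ends hX)
      ⟨fun q : I × Z => (γ q.2 0, γ q.2 q.1), ((h0 0).comp continuous_snd).prodMk
        (hγ.comp (by fun_prop : Continuous fun q : I × Z => (q.2, q.1)))⟩ rfl ?_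
      fun z => continuous_ofPath_subpath hX (γ z)
    simp only [Path.subpath_self]
    exact (continuous_ofPath_refl hX).comp (h0 0)
  convert h1.comp (by fun_prop : Continuous fun z : Z => ((1 : I), z)) using 1
  funext z
  exact ofPath_eq_ofPath fun t => by simp

theorem exists_local_pathFamily (hX : HasSegmentBasis X) (p : PathClass X) :
    ∃ (Z : Type u) (_ : TopologicalSpace Z) (a b : Z → X) (γ : ∀ z, Path (a z) (b z)),
      Continuous ↿γ ∧ IsOpenMap (fun z => ofPath (γ z)) ∧ ∃ z, ofPath (γ z) = p := by
  obtain ⟨U, V, a, b, q, hp, -⟩ := exists_spread hX p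
  obtain ⟨γ, rfl⟩ := Path.Homotopic.Quotient.mk_surjective q
  have h1 : ∀ z : U.carrier × V.carrier,
      ofPath ((U.seg (z.1, a)).trans (γ.trans (V.seg (b, z.2)))) = spread U V a b (mk γ) z := by
    intro z
    rw [ofPath, mk_trans, mk_trans]
    rfl
  refine ⟨U.carrier × V.carrier, inferInstance, fun z => z.1.1, fun z => z.2.1,
    fun z => (U.seg (z.1, a)).trans (γ.trans (V.seg (b, z.2))), ?_, ?_, (a, b), (h1 _).trans hp⟩
  · refine Path.trans_continuous_family _ ?_ _ (Path.trans_continuous_family _ ?_ _ ?_)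
    · exact U.continuous_seg.comp (by fun_prop :
        Continuous fun q : (U.carrier × V.carrier) × I => ((q.1.1, a), q.2))
    · exact γ.continuous.comp continuous_snd
    · exact V.continuous_seg.comp (by fun_prop :
        Continuous fun q : (U.carrier × V.carrier) × I => ((b, q.1.2), q.2))
  · simp only [h1]
    exact isOpenMap_spread U V a b _ hX

/-- Realises the space of classes as an open quotient of the parameter space of an actual family of
paths. Products of open quotient maps are again open quotient maps, so operations on classes can be
tested on paths, also in several variables. -/
theorem exists_pathFamily (hX : HasSegmentBasis X) :
    ∃ (Z : Type u) (_ : TopologicalSpace Z) (a b : Z → X) (γ : ∀ z, Path (a z) (b z)),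
      Continuous ↿γ ∧ IsOpenQuotientMap (fun z => ofPath (γ z)) := by
  choose Z τ a b γ hγ ho z hz using exists_local_pathFamily hX
  have hc : Continuous ↿(fun w : Σ p, Z p => γ w.1 w.2) := by
    refine (Homeomorph.comp_continuous_iff' (Homeomorph.sigmaProdDistrib (X := Z) (Y := I)).symm).1
      (continuous_sigma fun p => hγ p)
  refine ⟨Σ p, Z p, inferInstance, fun w => a w.1 w.2, fun w => b w.1 w.2, fun w => γ w.1 w.2, hc,
    fun p => ⟨⟨p, z p⟩, hz p⟩, continuous_ofPath hX _ hc, isOpenMap_sigma.2 fun p => ho p⟩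

section StartingAt

variable {a b : X} (δ : Path a b)

/-- The class of a path followed by the part of a loop up to a given time. -/
noncomputable def extend (η : Path b b) (t : I) : PathClass X :=
  ofPath (δ.trans ((η.subpath 0 t).cast η.source.symm rfl))

theorem extend_zero (η : Path b b) : extend δ η 0 = ofPath δ := by
  have h : (η.subpath 0 0).cast η.source.symm η.source.symm = Path.refl b := by ext; simp
  have h1 : extend δ η 0 = ofPath (δ.trans ((η.subpath 0 0).cast η.source.symm η.source.symm)) :=
    ofPath_eq_ofPath fun t => by simp [Path.trans_apply]
  rw [h1, h, ofPath, mk_trans, mk_refl, trans_refl]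
  rfl

theorem extend_one (η : Path b b) : extend δ η 1 = ofPath (δ.trans η) :=
  ofPath_eq_ofPath fun t => by simp [Path.trans_apply]

theorem extend_refl (t : I) : extend δ (Path.refl b) t = ofPath δ := by
  have h1 : extend δ (Path.refl b) t = ofPath (δ.trans (Path.refl b)) :=
    ofPath_eq_ofPath fun t => by simp [Path.trans_apply, Path.subpath]
  rw [h1, ofPath, mk_trans, mk_refl, trans_refl]
  rfl

theorem continuous_extend (hX : HasSegmentBasis X) {Z : Type*} [TopologicalSpace Z]
    (η : Z → Path b b) (hη : Continuous ↿η) {f : Z → I} (hf : Continuous f) :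
    Continuous fun z => extend δ (η z) (f z) := by
  refine continuous_ofPath hX _ (Path.trans_continuous_family _
    (δ.continuous.comp continuous_snd) _ ?_)
  change Continuous fun q : Z × I => η q.1 (Set.Icc.convexComb 0 (f q.1) q.2)
  exact hη.comp (continuous_fst.prodMk (Set.Icc.continuous_convexComb_prod.comp
    (continuous_const.prodMk ((hf.comp continuous_fst).prodMk continuous_snd))))

/-- The space of classes of paths with a given starting point is simply connected. -/
theorem simplyConnectedSpace_startingAt (hX : HasSegmentBasis X) (a : X) :
    SimplyConnectedSpace {p : PathClass X // p.ends.1 = a} := by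
  refine simply_connected_iff_loops_nullhomotopic.2 ⟨?_, ?_⟩
  · have hj : ∀ p : {p : PathClass X // p.ends.1 = a}, Joined ⟨ofPath (Path.refl a), rfl⟩ p := by
      rintro ⟨p, hp⟩
      obtain ⟨a', b, γ, rfl⟩ := exists_ofPath p
      obtain rfl : a' = a := hp
      exact ⟨{
        toFun := fun t => ⟨ofPath (γ.subpath 0 t), γ.source⟩
        continuous_toFun := (continuous_ofPath_subpath hX γ).subtype_mk _
        source' := Subtype.ext (ofPath_eq_ofPath fun t => by simp)
        target' := Subtype.ext (ofPath_eq_ofPath fun t => by simp) }⟩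
    exact ⟨⟨⟨ofPath (Path.refl a), rfl⟩⟩, fun p p' => (hj p).symm.trans (hj p')⟩
  · rintro ⟨x, hx⟩ c
    obtain ⟨a', b, δ, rfl⟩ := exists_ofPath x
    obtain rfl : a' = a := hx
    have hcc : Continuous fun t => (c t).1 := continuous_subtype_val.comp c.continuous
    let γ : Path b b :=
      { toFun := fun t => (c t).1.ends.2
        continuous_toFun := continuous_snd.comp (continuous_ends.comp hcc)
        source' := by rw [c.source]; rfl
        target' := by rw [c.target]; rfl }
    have hinj := (isLocalHomeomorph_ends hX).isLocallyInjective
    have hsep := isSeparatedMap_ends hX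
    -- Both sides lift the same path of end points and agree at time `0`; lifts along a separated
    -- locally injective map are unique.
    have hc : ∀ t, extend δ γ t = (c t).1 := by
      refine congrFun (hsep.eq_of_comp_eq hinj (continuous_extend δ hX (fun _ => γ)
        (γ.continuous.comp continuous_snd) continuous_id) hcc ?_ 0 ?_)
      · funext t
        exact Prod.ext (c t).2.symm rfl
      · rw [c.source]
        exact extend_zero δ γ
    -- The loop `c` closes up at time `1`, which says that `δ` followed by `γ` is homotopic to `δ`;
    -- cancel `δ`.
    have h1 : mk γ = mk (Path.refl b) := by
      have h2 := hc 1
      rw [c.target, extend_one] at h2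
      have h3 : trans (mk δ) (mk γ) = mk δ := by
        rw [← mk_trans]
        exact of_injective h2
      have h4 := congrArg (fun q => trans (symm (mk δ)) q) h3
      simpa [← trans_assoc] using h4
    obtain ⟨H⟩ := Path.Homotopic.Quotient.eq.1 h1
    have hH : Continuous ↿H.eval := H.continuous
    -- All these classes have the same end points, so as a lift of a constant path they are constant
    -- in `s`; at `s = 1` the loop is trivial. This makes the next homotopy one relative to the end
    -- points.
    have h5 : ∀ s, extend δ (H.eval s) 1 = ofPath δ := by
      refine congrFun (hsep.eq_of_comp_eq hinj (continuous_extend δ hX _ hH continuous_const)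
        continuous_const ?_ 1 ?_)
      · funext s
        exact Prod.ext rfl (H.eval s).target
      · rw [H.eval_one, extend_refl]
    refine ⟨{
      toFun := fun q => ⟨extend δ (H.eval q.1) q.2, rfl⟩
      continuous_toFun := (continuous_extend δ hX (fun q : I × I => H.eval q.1) (hH.comp
        (by fun_prop : Continuous fun q : (I × I) × I => (q.1.1, q.2)))
        continuous_snd).subtype_mk _
      map_zero_left := fun t => Subtype.ext (by rw [H.eval_zero]; exact hc t)
      map_one_left := fun t => Subtype.ext (by rw [H.eval_one]; exact extend_refl δ t)
      prop' := ?_ }⟩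
    rintro s t (rfl | rfl)
    · exact Subtype.ext ((extend_zero δ _).trans (congrArg Subtype.val c.source).symm)
    · exact Subtype.ext ((h5 s).trans (congrArg Subtype.val c.target).symm)

end StartingAt

end PathClass

end PathClassFamilies

/-! ### Path classes modulo the structure group, as a space over the gauge groupoid. -/

section PathGauge

open Set Filter Topology unitInterval TopologicalSpace

set_option linter.unusedSectionVars false

/-- An open quotient map restricts to one over any subset of its target. -/
theorem IsOpenQuotientMap.continuousOn_of_comp {X Y W : Type*} [TopologicalSpace X]
    [TopologicalSpace Y] [TopologicalSpace W] {f : X → Y} (hf : IsOpenQuotientMap f) {g : Y → W}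
    {S : Set Y} (h : Continuous fun x : f ⁻¹' S => g (f x)) : ContinuousOn g S := by
  have h1 : IsOpenQuotientMap (S.restrictPreimage f) :=
    ⟨S.restrictPreimage_surjective hf.surjective, hf.continuous.restrictPreimage,
      hf.isOpenMap.restrictPreimage S⟩
  exact continuousOn_iff_continuous_domRestrict.2 (h1.continuous_comp_iff.1 h)

theorem isLocalHomeomorph_of_isOpenMap {X Y : Type*} [TopologicalSpace X] [TopologicalSpace Y]
    {f : X → Y} (hf : Continuous f) (ho : IsOpenMap f)
    (hinj : ∀ x, ∃ N, IsOpen N ∧ x ∈ N ∧ InjOn f N) : IsLocalHomeomorph f := by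
  refine isLocalHomeomorph_iff_isOpenEmbedding_restrict.2 fun x => ?_
  obtain ⟨N, hN, hx, hfN⟩ := hinj x
  exact ⟨N, hN.mem_nhds hx, .of_continuous_injective_isOpenMap (hf.comp continuous_subtype_val)
    hfN.injective (ho.domRestrict hN)⟩

namespace PrincipalBundle

open Path.Homotopic.Quotient (trans mk symm refl mk_trans mk_refl mk_symm mk_map)

open PathClass (of ofPath)

variable {n p d : ℕ} {M : Type uM} [TopologicalSpace M]
  [ChartedSpace (EuclideanSpace ℝ (Fin n)) M] [IsManifold (𝓡 n) ∞ M]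
  {P : Type uP} [TopologicalSpace P] [ChartedSpace (EuclideanSpace ℝ (Fin p)) P]
  [IsManifold (𝓡 p) ∞ P]
  {G : Type uG} [TopologicalSpace G] [ChartedSpace (EuclideanSpace ℝ (Fin d)) G] [Group G]
  (B : PrincipalBundle n p d M P G)
  {Z : Type*} [TopologicalSpace Z]

theorem hasSegmentBasis (_B : PrincipalBundle n p d M P G) : HasSegmentBasis P :=
  hasSegmentBasis_of_chartedSpace (EuclideanSpace ℝ (Fin p)) P

variable {B} in
theorem continuous_act {f : Z → P} {g : Z → G} (hf : Continuous f) (hg : Continuous g) :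
    Continuous fun z => B.act (f z) (g z) :=
  B.contMDiff_act.continuous.comp (hf.prodMk hg)

variable {B} in
-- The counterpart of `contMDiffAt_div` for parameters in an arbitrary topological space, such as a
-- space of path classes.
theorem continuous_div {f f' : Z → P} (hf : Continuous f) (hf' : Continuous f')
    (h : ∀ z, B.proj (f z) = B.proj (f' z)) : Continuous fun z => B.div (f z) (f' z) := by
  have := B.lieGroup
  have := topologicalGroup_of_lieGroup (𝓡 d) ∞ (G := G)
  refine continuous_iff_continuousAt.2 fun z => ?_
  obtain ⟨U, e, -, hx, hes, -, -, -, h1, h2⟩ := B.exists_localTriv (B.proj (f z))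
  have hfz : f z ∈ e.source := hes ▸ hx
  have hfz' : f' z ∈ e.source := hes ▸ (show B.proj (f' z) ∈ U from h z ▸ hx)
  have hs : ∀ {f : Z → P}, Continuous f → f z ∈ e.source →
      ContinuousAt (fun z => (e (f z)).2) z := fun {f} hf hfz =>
    continuousAt_snd.comp ((e.continuousAt hfz).comp hf.continuousAt)
  refine ((hs hf hfz).inv.mul (hs hf' hfz')).congr ?_
  filter_upwards [hf.continuousAt.eventually (e.open_source.eventually_mem hfz)] with z hez
  have h3 := h2 _ hez (B.div (f z) (f' z))
  rw [act_div (h z)] at h3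
  simp [h3]

/-- The action of a group element. -/
def actMap (g : G) : C(P, P) :=
  ⟨fun u => B.act u g, continuous_act continuous_id continuous_const⟩

/-- The action on homotopy classes of paths. -/
def classAct (p : PathClass P) (g : G) : PathClass P := of (p.2.map (B.actMap g))

variable {B}

theorem ends_classAct (p : PathClass P) (g : G) :
    (B.classAct p g).ends = (B.act p.ends.1 g, B.act p.ends.2 g) := rfl

theorem classAct_ofPath {a b : P} (γ : Path a b) (g : G) :
    B.classAct (ofPath γ) g = ofPath (γ.map (B.actMap g).continuous) := rfl

theorem classAct_one (p : PathClass P) : B.classAct p 1 = p := by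
  obtain ⟨a, b, γ, rfl⟩ := p.exists_ofPath
  rw [classAct_ofPath]
  exact PathClass.ofPath_eq_ofPath fun t => B.act_one _

theorem classAct_mul (p : PathClass P) (g h : G) :
    B.classAct p (g * h) = B.classAct (B.classAct p g) h := by
  obtain ⟨a, b, γ, rfl⟩ := p.exists_ofPath
  simp only [classAct_ofPath]
  exact PathClass.ofPath_eq_ofPath fun t => B.act_mul _ _ _

theorem continuous_classAct {f : Z → PathClass P} {g : Z → G} (hf : Continuous f)
    (hg : Continuous g) : Continuous fun z => B.classAct (f z) (g z) := by
  have h : Continuous fun q : PathClass P × G => B.classAct q.1 q.2 := by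
    obtain ⟨Z, _, a, b, γ, hγ, hq⟩ := PathClass.exists_pathFamily B.hasSegmentBasis
    refine (hq.prodMap .id).continuous_comp_iff.1 ?_
    refine PathClass.continuous_ofPath B.hasSegmentBasis
      (fun q : Z × G => (γ q.1).map (B.actMap q.2).continuous) ?_
    exact continuous_act (f := fun q : (Z × G) × I => γ q.1.1 q.2)
      (hγ.comp (by fun_prop : Continuous fun q : (Z × G) × I => (q.1.1, q.2)))
      (by fun_prop : Continuous fun q : (Z × G) × I => q.1.2)
  exact h.comp (hf.prodMk hg)

variable (B) in
/-- The quotient by the structure group of the homotopy classes of paths in the total space. -/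
def PathGauge : Type uP := Quot (fun p q : PathClass P => ∃ g : G, q = B.classAct p g)

noncomputable instance : TopologicalSpace B.PathGauge :=
  inferInstanceAs (TopologicalSpace (Quot (fun p q : PathClass P => ∃ g : G, q = B.classAct p g)))

variable (B) in
/-- The class modulo the structure group of a class of paths. -/
def pathMk (p : PathClass P) : B.PathGauge := Quot.mk _ p

theorem pathMk_classAct (p : PathClass P) (g : G) : B.pathMk (B.classAct p g) = B.pathMk p :=
  (Quot.sound ⟨g, rfl⟩).symm

theorem pathMk_eq_iff {p q : PathClass P} :
    B.pathMk p = B.pathMk q ↔ ∃ g : G, q = B.classAct p g := by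
  refine Equivalence.quot_mk_eq_iff (r := fun p q : PathClass P => ∃ g : G, q = B.classAct p g)
    ⟨fun p => ⟨1, (classAct_one p).symm⟩, ?_, ?_⟩ p q
  · rintro p _ ⟨g, rfl⟩
    exact ⟨g⁻¹, by rw [← classAct_mul, mul_inv_cancel, classAct_one]⟩
  · rintro p _ _ ⟨g, rfl⟩ ⟨h, rfl⟩
    exact ⟨g * h, by rw [classAct_mul]⟩

theorem exists_pathMk (z : B.PathGauge) :
    ∃ (a b : P) (γ : Path.Homotopic.Quotient a b), B.pathMk (of γ) = z := by
  obtain ⟨⟨⟨a, b⟩, γ⟩, rfl⟩ := Quot.exists_rep z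
  exact ⟨a, b, γ, rfl⟩

theorem isOpenQuotientMap_pathMk : IsOpenQuotientMap B.pathMk := by
  refine ⟨Quot.mk_surjective, continuous_quot_mk, fun W hW => ?_⟩
  refine isQuotientMap_quot_mk.isOpen_preimage.1 ?_
  have h : B.pathMk ⁻¹' (B.pathMk '' W) = ⋃ g : G, (fun p => B.classAct p g) ⁻¹' W := by
    ext a
    simp only [mem_preimage, mem_image, mem_iUnion]
    constructor
    · rintro ⟨b, hb, hab⟩
      obtain ⟨g, rfl⟩ := pathMk_eq_iff.1 hab.symm
      exact ⟨g, hb⟩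
    · rintro ⟨g, hg⟩
      exact ⟨_, hg, pathMk_classAct _ g⟩
  change IsOpen (B.pathMk ⁻¹' (B.pathMk '' W))
  rw [h]
  exact isOpen_iUnion fun g => hW.preimage (continuous_classAct continuous_id continuous_const)

variable (B) in
/-- The arrow of the gauge groupoid from the start to the end of a path. -/
def pathGaugeMap : B.PathGauge → B.Gauge :=
  Quot.lift (fun p => B.gaugeMk (p.ends.2, p.ends.1)) (by
    rintro p _ ⟨g, rfl⟩
    exact (gaugeMk_act _ _ g).symm)

theorem pathGaugeMap_mk (p : PathClass P) :
    B.pathGaugeMap (B.pathMk p) = B.gaugeMk (p.ends.2, p.ends.1) := rfl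

theorem continuous_pathGaugeMap : Continuous B.pathGaugeMap := by
  rw [← isOpenQuotientMap_pathMk.continuous_comp_iff]
  exact isOpenQuotientMap_gaugeMk.continuous.comp (continuous_swap.comp PathClass.continuous_ends)

theorem isOpenMap_pathGaugeMap : IsOpenMap B.pathGaugeMap := by
  refine isOpenQuotientMap_pathMk.isOpenMap_iff.2 ?_
  exact isOpenQuotientMap_gaugeMk.isOpenMap.comp ((Homeomorph.prodComm P P).isOpenMap.comp
    (PathClass.isLocalHomeomorph_ends B.hasSegmentBasis).isOpenMap)

/-- On pairs of classes of paths with the same image in the gauge groupoid, equivalence modulo the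
structure group is open and closed. -/
theorem isClopen_pathMk_eq : IsClopen {w : {w : PathClass P × PathClass P //
    B.pathGaugeMap (B.pathMk w.1) = B.pathGaugeMap (B.pathMk w.2)} |
      B.pathMk w.1.1 = B.pathMk w.1.2} := by
  set K := {w : PathClass P × PathClass P //
    B.pathGaugeMap (B.pathMk w.1) = B.pathGaugeMap (B.pathMk w.2)}
  -- Freeness leaves one candidate for a group element that takes the first class to the second, the
  -- quotient of their starting points. As the images in the gauge groupoid agree, it also matches
  -- the final points.
  have hK : ∀ w : K, B.proj w.1.1.ends.1 = B.proj w.1.2.ends.1 ∧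
      B.act w.1.1.ends.2 (B.div w.1.1.ends.1 w.1.2.ends.1) = w.1.2.ends.2 := by
    rintro ⟨⟨p, q⟩, h⟩
    obtain ⟨g, hg⟩ := (gaugeMk_eq_iff _ _).1 h
    have h1 := congrArg Prod.fst hg
    have h2 := congrArg Prod.snd hg
    simp only at h1 h2
    rw [div_eq h2.symm, h2]
    exact ⟨(B.proj_act _ _).symm, h1.symm⟩
  have h1 : Continuous fun w : K => w.1.1 := by fun_prop
  have h2 : Continuous fun w : K => w.1.2 := by fun_prop
  have h3 : Continuous fun w : K => B.classAct w.1.1 (B.div w.1.1.ends.1 w.1.2.ends.1) :=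
    continuous_classAct h1 (continuous_div
      (continuous_fst.comp (PathClass.continuous_ends.comp h1))
      (continuous_fst.comp (PathClass.continuous_ends.comp h2)) fun w => (hK w).1)
  have he : PathClass.ends ∘ (fun w : K => B.classAct w.1.1 (B.div w.1.1.ends.1 w.1.2.ends.1)) =
      PathClass.ends ∘ fun w : K => w.1.2 :=
    funext fun w => Prod.ext (act_div (hK w).1) (hK w).2
  -- Equivalence is thus equality of two continuous maps with the same composite with `ends`. Their
  -- equality locus is closed because `ends` is separated, and open because it is locally injective.
  have hset : {w : K | B.pathMk w.1.1 = B.pathMk w.1.2} =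
      {w : K | B.classAct w.1.1 (B.div w.1.1.ends.1 w.1.2.ends.1) = w.1.2} := by
    ext w
    constructor
    · intro hw
      obtain ⟨g, hg⟩ := pathMk_eq_iff.1 hw
      have : B.div w.1.1.ends.1 w.1.2.ends.1 = g := div_eq (by rw [hg]; rfl)
      change B.classAct w.1.1 _ = _
      rw [this, hg]
    · intro hw
      exact pathMk_eq_iff.2 ⟨_, hw.symm⟩
  have hX := B.hasSegmentBasis
  rw [hset]
  exact ⟨(PathClass.isSeparatedMap_ends hX).isClosed_eqLocus h3 h2 he,
    (PathClass.isLocalHomeomorph_ends hX).isLocallyInjective.isOpen_eqLocus h3 h2 he⟩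

/-- The map is continuous and open. Near a diagonal pair, equal images force equivalence, by
openness of the equivalence locus; this is local injectivity. -/
theorem isLocalHomeomorph_pathGaugeMap : IsLocalHomeomorph B.pathGaugeMap := by
  refine isLocalHomeomorph_of_isOpenMap continuous_pathGaugeMap isOpenMap_pathGaugeMap fun z => ?_
  obtain ⟨p, rfl⟩ := isOpenQuotientMap_pathMk.surjective z
  obtain ⟨O, hO, hOK⟩ := isOpen_induced_iff.1 (isClopen_pathMk_eq (B := B)).isOpen
  have hK := Set.ext_iff.1 hOK
  obtain ⟨N, N', hN, hN', hp, hp', hNO⟩ := isOpen_prod_iff.1 hO p p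
    ((hK ⟨(p, p), rfl⟩).2 rfl)
  refine ⟨B.pathMk '' (N ∩ N'), isOpenQuotientMap_pathMk.isOpenMap _ (hN.inter hN'),
    mem_image_of_mem _ ⟨hp, hp'⟩, ?_⟩
  rintro _ ⟨a, ha, rfl⟩ _ ⟨b, hb, rfl⟩ hab
  exact (hK ⟨(a, b), hab⟩).1 (hNO ⟨ha.1, hb.2⟩)

/-- Points with different images are separated in the gauge groupoid. Over the same image,
closedness of the equivalence locus provides neighbourhoods of representatives containing no
equivalent pair. -/
theorem t2Space_pathGauge [T2Space M] : T2Space B.PathGauge := by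
  have := t2Space_gauge (B := B)
  refine ⟨fun x y hxy => ?_⟩
  by_cases h : B.pathGaugeMap x = B.pathGaugeMap y
  · obtain ⟨p, rfl⟩ := isOpenQuotientMap_pathMk.surjective x
    obtain ⟨q, rfl⟩ := isOpenQuotientMap_pathMk.surjective y
    obtain ⟨O, hO, hOK⟩ := isOpen_induced_iff.1 (isClopen_pathMk_eq (B := B)).compl.isOpen
    have hK := Set.ext_iff.1 hOK
    obtain ⟨N, N', hN, hN', hp, hq, hNO⟩ := isOpen_prod_iff.1 hO p q ((hK ⟨(p, q), h⟩).2 hxy)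
    refine ⟨_, _, isOpenQuotientMap_pathMk.isOpenMap _ hN,
      isOpenQuotientMap_pathMk.isOpenMap _ hN', mem_image_of_mem _ hp, mem_image_of_mem _ hq, ?_⟩
    rw [Set.disjoint_left]
    rintro _ ⟨a, ha, rfl⟩ ⟨b, hb, hab⟩
    exact (hK ⟨(a, b), congrArg B.pathGaugeMap hab.symm⟩).1 (hNO ⟨ha, hb⟩) hab.symm
  · obtain ⟨U, V, hU, hV, hx, hy, hUV⟩ := t2_separation h
    exact ⟨_, _, hU.preimage continuous_pathGaugeMap, hV.preimage continuous_pathGaugeMap, hx, hy,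
      hUV.preimage _⟩

/-- The space is a continuous image of the second countable space `C(I, P)`, hence Lindelöf.
Countably many domains of local homeomorphisms to the gauge groupoid then cover it, and each of them
is second countable. -/
theorem secondCountableTopology_pathGauge : SecondCountableTopology B.PathGauge := by
  have := B.secondCountable
  have := secondCountableTopology_gauge (B := B)
  let f : C(I, P) → B.PathGauge := fun γ => B.pathMk (ofPath (⟨γ, rfl, rfl⟩ : Path (γ 0) (γ 1)))
  have hf : Continuous f := isOpenQuotientMap_pathMk.continuous.comp
    (PathClass.continuous_ofPath B.hasSegmentBasis
      (fun γ : C(I, P) => (⟨γ, rfl, rfl⟩ : Path (γ 0) (γ 1))) continuous_eval)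
  have hs : Function.Surjective f := fun z => by
    obtain ⟨a, b, q, rfl⟩ := exists_pathMk z
    obtain ⟨γ, rfl⟩ := Path.Homotopic.Quotient.mk_surjective q
    exact ⟨γ.toContinuousMap, congrArg B.pathMk (PathClass.ofPath_eq_ofPath fun _ => rfl)⟩
  have : LindelofSpace B.PathGauge :=
    isLindelof_univ_iff.1 (hs.range_eq ▸ isLindelof_range hf)
  choose e he hee using isLocalHomeomorph_pathGaugeMap (B := B)
  obtain ⟨t, ht, htu⟩ := LindelofSpace.elim_nhds_subcover (fun z => (e z).source)
    fun z => (e z).open_source.mem_nhds (he z)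
  have := ht.to_subtype
  have : ∀ z : t, SecondCountableTopology (e z.1).source :=
    fun z => (e z.1).secondCountableTopology_source
  refine secondCountableTopology_of_countable_cover (U := fun z : t => (e z.1).source)
    (fun z => (e z.1).open_source) ?_
  rw [← htu, biUnion_eq_iUnion]

end PrincipalBundle

end PathGauge

/-! ### The groupoid of path classes modulo the structure group and its source fibres. -/

section PathGaugeGroupoid

open Set Filter Topology unitInterval

set_option linter.unusedSectionVars false

namespace PrincipalBundle

open Path.Homotopic.Quotient (trans mk symm refl mk_trans mk_refl mk_symm mk_map)

open PathClass (of ofPath)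

variable {n p d : ℕ} {M : Type uM} [TopologicalSpace M]
  [ChartedSpace (EuclideanSpace ℝ (Fin n)) M] [IsManifold (𝓡 n) ∞ M]
  {P : Type uP} [TopologicalSpace P] [ChartedSpace (EuclideanSpace ℝ (Fin p)) P]
  [IsManifold (𝓡 p) ∞ P]
  {G : Type uG} [TopologicalSpace G] [ChartedSpace (EuclideanSpace ℝ (Fin d)) G] [Group G]
  {B : PrincipalBundle n p d M P G}

theorem map_trans {X Y : Type*} [TopologicalSpace X] [TopologicalSpace Y] {a b c : X}
    (γ : Path.Homotopic.Quotient a b) (δ : Path.Homotopic.Quotient b c) (f : C(X, Y)) :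
    (trans γ δ).map f = trans (γ.map f) (δ.map f) := by
  obtain ⟨γ, rfl⟩ := Path.Homotopic.Quotient.mk_surjective γ
  obtain ⟨δ, rfl⟩ := Path.Homotopic.Quotient.mk_surjective δ
  rw [← mk_trans, ← mk_map, ← mk_map, ← mk_map, ← mk_trans, Path.map_trans]

theorem map_symm {X Y : Type*} [TopologicalSpace X] [TopologicalSpace Y] {a b : X}
    (γ : Path.Homotopic.Quotient a b) (f : C(X, Y)) : (symm γ).map f = symm (γ.map f) := by
  obtain ⟨γ, rfl⟩ := Path.Homotopic.Quotient.mk_surjective γ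
  rw [← mk_symm, ← mk_map, ← mk_map, ← mk_symm, Path.map_symm]

/-- A class is determined modulo the structure group by its translate with given starting point. -/
theorem exists_pathMk_start (z : B.PathGauge) {u : P}
    (h : B.gaugeSource (B.pathGaugeMap z) = B.proj u) :
    ∃ (b : P) (γ : Path.Homotopic.Quotient u b), B.pathMk (of γ) = z := by
  obtain ⟨a, b, γ, rfl⟩ := exists_pathMk z
  rw [pathGaugeMap_mk, gaugeSource_mk] at h
  obtain ⟨g, rfl⟩ := B.exists_act_eq h
  exact ⟨_, γ.map (B.actMap g), pathMk_classAct (of γ) g⟩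

theorem exists_pathMk_pair {z w : B.PathGauge}
    (h : B.gaugeSource (B.pathGaugeMap z) = B.gaugeTarget (B.pathGaugeMap w)) :
    ∃ (a b c : P) (γ : Path.Homotopic.Quotient a b) (δ : Path.Homotopic.Quotient b c),
      z = B.pathMk (of δ) ∧ w = B.pathMk (of γ) := by
  obtain ⟨a, b, γ, rfl⟩ := exists_pathMk w
  rw [pathGaugeMap_mk, gaugeTarget_mk] at h
  obtain ⟨c, δ, rfl⟩ := exists_pathMk_start z h
  exact ⟨a, b, c, γ, δ, rfl, rfl⟩

variable (B) in
/-- `r` is the product of `z` and `w`. -/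
def IsPathProduct (z w r : B.PathGauge) : Prop :=
  ∃ (a b c : P) (γ : Path.Homotopic.Quotient a b) (δ : Path.Homotopic.Quotient b c),
    B.pathMk (of δ) = z ∧ B.pathMk (of γ) = w ∧ B.pathMk (of (trans γ δ)) = r

/-- The elements that translate the two factors to other representatives both carry the common point
`b` to its new position, so by freeness they coincide and translate the concatenation too. -/
theorem IsPathProduct.unique {z w r r' : B.PathGauge} (h : B.IsPathProduct z w r)
    (h' : B.IsPathProduct z w r') : r = r' := by
  obtain ⟨a, b, c, γ, δ, rfl, rfl, rfl⟩ := h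
  obtain ⟨a', b', c', γ', δ', h1, h2, rfl⟩ := h'
  obtain ⟨g, hg⟩ := pathMk_eq_iff.1 h1.symm
  obtain ⟨g', hg'⟩ := pathMk_eq_iff.1 h2.symm
  obtain ⟨rfl, rfl⟩ := Prod.mk.inj (congrArg PathClass.ends hg)
  obtain ⟨rfl, hgg⟩ := Prod.mk.inj (congrArg PathClass.ends hg')
  obtain rfl : g = g' := B.act_injective b hgg
  obtain rfl := PathClass.of_injective hg
  obtain rfl := PathClass.of_injective hg'
  exact (pathMk_classAct (of (trans γ δ)) g).symm.trans
    (congrArg (fun q => B.pathMk (of q)) (map_trans γ δ (B.actMap g)))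

variable (B) in
open Classical in
/-- The product of composable classes of paths modulo the structure group. -/
noncomputable def pathMul (z w : B.PathGauge) : B.PathGauge :=
  -- The value `z` only fills in for pairs that are not composable.
  if h : ∃ r, B.IsPathProduct z w r then h.choose else z

theorem pathMul_mk {a b c : P} (γ : Path.Homotopic.Quotient a b)
    (δ : Path.Homotopic.Quotient b c) :
    B.pathMul (B.pathMk (of δ)) (B.pathMk (of γ)) = B.pathMk (of (trans γ δ)) := by
  have h1 : B.IsPathProduct (B.pathMk (of δ)) (B.pathMk (of γ)) (B.pathMk (of (trans γ δ))) :=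
    ⟨a, b, c, γ, δ, rfl, rfl, rfl⟩
  have h2 : ∃ r, B.IsPathProduct (B.pathMk (of δ)) (B.pathMk (of γ)) r := ⟨_, h1⟩
  rw [pathMul, dif_pos h2]
  exact h2.choose_spec.unique h1

variable (B) in
/-- The inverse of a class of paths modulo the structure group. -/
def pathInv : B.PathGauge → B.PathGauge :=
  Quot.lift (fun p => B.pathMk (of (symm p.2))) (by
    rintro p _ ⟨g, rfl⟩
    refine (pathMk_classAct (of (symm p.2)) g).symm.trans ?_
    exact congrArg (fun q => B.pathMk (of q)) (map_symm p.2 (B.actMap g)))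

theorem pathInv_mk {a b : P} (γ : Path.Homotopic.Quotient a b) :
    B.pathInv (B.pathMk (of γ)) = B.pathMk (of (symm γ)) := rfl

variable (B) in
/-- The class of the constant paths over a point. -/
noncomputable def pathOne (y : M) : B.PathGauge :=
  B.pathMk (of (refl (B.exists_proj_eq y).choose))

theorem pathOne_eq {u : P} {y : M} (h : B.proj u = y) : B.pathOne y = B.pathMk (of (refl u)) := by
  obtain ⟨g, hg⟩ := B.exists_act_eq ((B.exists_proj_eq y).choose_spec.trans h.symm)
  subst hg
  exact (pathMk_classAct (of (refl _)) g).symm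

theorem continuous_pathInv : Continuous B.pathInv := by
  obtain ⟨Z, _, a, b, γ, hγ, hq⟩ := PathClass.exists_pathFamily B.hasSegmentBasis
  refine (isOpenQuotientMap_pathMk.comp hq).continuous_comp_iff.1 ?_
  exact isOpenQuotientMap_pathMk.continuous.comp (PathClass.continuous_ofPath B.hasSegmentBasis
    (fun z => (γ z).symm) (Path.symm_continuous_family γ hγ))

theorem continuous_pathOne : Continuous B.pathOne := by
  refine continuous_iff_continuousAt.2 fun y => ?_
  obtain ⟨u, rfl⟩ := B.exists_proj_eq y
  obtain ⟨S, hS, -⟩ := B.exists_localSection u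
  have h1 := (S.contMDiffOn.contMDiffAt (S.isOpen_dom.mem_nhds hS)).continuousAt
  have h2 : Continuous fun u : P => B.pathMk (ofPath (Path.refl u)) :=
    isOpenQuotientMap_pathMk.continuous.comp (PathClass.continuous_ofPath_refl B.hasSegmentBasis)
  refine (h2.continuousAt.comp h1).congr ?_
  filter_upwards [S.isOpen_dom.mem_nhds hS] with y hy using (pathOne_eq (S.proj_toFun y hy)).symm

theorem continuousOn_pathMul : ContinuousOn (fun q : B.PathGauge × B.PathGauge =>
    B.pathMul q.1 q.2)
    {q | B.gaugeSource (B.pathGaugeMap q.1) = B.gaugeTarget (B.pathGaugeMap q.2)} := by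
  obtain ⟨Z, _, a, b, γ, hγ, hq⟩ := PathClass.exists_pathFamily B.hasSegmentBasis
  have hq' := (isOpenQuotientMap_pathMk (B := B)).comp hq
  refine IsOpenQuotientMap.continuousOn_of_comp (hq'.prodMap hq') ?_
  set T := (Prod.map (B.pathMk ∘ fun z => ofPath (γ z)) (B.pathMk ∘ fun z => ofPath (γ z))) ⁻¹'
    {q | B.gaugeSource (B.pathGaugeMap q.1) = B.gaugeTarget (B.pathGaugeMap q.2)}
  have hT : ∀ t : T, B.proj (b t.1.2) = B.proj (a t.1.1) := fun t => by
    have h : B.gaugeSource (B.gaugeMk (b t.1.1, a t.1.1)) =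
      B.gaugeTarget (B.gaugeMk (b t.1.2, a t.1.2)) := t.2
    rw [gaugeSource_mk, gaugeTarget_mk] at h
    exact h.symm
  -- The path travelled first is translated by the unique group element that moves its end to the
  -- start of the other one. This element depends continuously on the pair, so the concatenations
  -- form a continuous family.
  let δ : ∀ t : T, Path (B.act (a t.1.2) (B.div (b t.1.2) (a t.1.1))) (a t.1.1) := fun t =>
    ((γ t.1.2).map (B.actMap (B.div (b t.1.2) (a t.1.1))).continuous).cast rfl
      (act_div (hT t)).symm
  have h0 : ∀ s : I, Continuous fun z => γ z s := fun s => hγ.comp (by fun_prop :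
    Continuous fun z => (z, s))
  have ha : Continuous a := (h0 0).congr fun z => (γ z).source
  have hb : Continuous b := (h0 1).congr fun z => (γ z).target
  have hdiv : Continuous fun t : T => B.div (b t.1.2) (a t.1.1) :=
    continuous_div (hb.comp (by fun_prop : Continuous fun t : T => t.1.2))
      (ha.comp (by fun_prop : Continuous fun t : T => t.1.1)) hT
  have hδ : Continuous ↿δ := continuous_act (f := fun q : T × I => γ q.1.1.2 q.2)
    (hγ.comp (by fun_prop : Continuous fun q : T × I => (q.1.1.2, q.2)))
    (hdiv.comp continuous_fst)
  have h1 := isOpenQuotientMap_pathMk (B := B).continuous.comp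
    (PathClass.continuous_ofPath B.hasSegmentBasis _ (Path.trans_continuous_family δ hδ
      (fun t : T => γ t.1.1) (hγ.comp (by fun_prop : Continuous fun q : T × I => (q.1.1.1, q.2)))))
  refine h1.congr fun t => ?_
  have h2 : B.pathMk (ofPath (δ t)) = B.pathMk (ofPath (γ t.1.2)) := by
    rw [← pathMk_classAct (ofPath (γ t.1.2)) (B.div (b t.1.2) (a t.1.1)), classAct_ofPath]
    exact congrArg B.pathMk (PathClass.ofPath_eq_ofPath fun _ => rfl)
  change B.pathMk (ofPath ((δ t).trans (γ t.1.1))) =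
    B.pathMul (B.pathMk (ofPath (γ t.1.1))) (B.pathMk (ofPath (γ t.1.2)))
  rw [← h2]
  exact (pathMul_mk (Path.Homotopic.Quotient.mk (δ t)) (Path.Homotopic.Quotient.mk (γ t.1.1))).symm

variable [T2Space M]

attribute [local instance] PrincipalBundle.gaugeChartedSpace PrincipalBundle.isManifold_gauge

variable (B) in
/-- The étale cover of the gauge groupoid by the homotopy classes of paths in the total space modulo
the structure group. -/
noncomputable def gaugeEtaleCover : B.gaugeGroupoid.EtaleCover B.PathGauge where
  t2Space := t2Space_pathGauge
  secondCountable := secondCountableTopology_pathGauge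
  toFun := B.pathGaugeMap
  one := B.pathOne
  inv := B.pathInv
  mul := B.pathMul
  isLocalHomeomorph := isLocalHomeomorph_pathGaugeMap
  toFun_one y := by
    obtain ⟨u, rfl⟩ := B.exists_proj_eq y
    rw [pathOne_eq rfl]
    exact (gaugeOne_eq rfl).symm
  toFun_inv z := by
    obtain ⟨a, b, γ, rfl⟩ := exists_pathMk z
    rw [pathInv_mk]
    exact (gaugeInv_mk b a).symm
  toFun_mul z w h := by
    obtain ⟨a, b, c, γ, δ, rfl, rfl⟩ := exists_pathMk_pair h
    rw [pathMul_mk]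
    exact (gaugeMul_mk c b a).symm
  mul_assoc z w r h h' := by
    obtain ⟨a, b, c, γ, δ, rfl, rfl⟩ := exists_pathMk_pair h'
    obtain ⟨e, ε, rfl⟩ := exists_pathMk_start z (h.trans (gaugeTarget_mk c b))
    simp only [pathMul_mk, Path.Homotopic.Quotient.trans_assoc]
  one_mul z := by
    obtain ⟨a, b, γ, rfl⟩ := exists_pathMk z
    rw [show B.gaugeGroupoid.t (B.pathGaugeMap (B.pathMk (of γ))) = B.proj b from
      gaugeTarget_mk b a, pathOne_eq rfl, pathMul_mk, Path.Homotopic.Quotient.trans_refl]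
  mul_one z := by
    obtain ⟨a, b, γ, rfl⟩ := exists_pathMk z
    rw [show B.gaugeGroupoid.s (B.pathGaugeMap (B.pathMk (of γ))) = B.proj a from
      gaugeSource_mk b a, pathOne_eq rfl, pathMul_mk, Path.Homotopic.Quotient.refl_trans]
  inv_mul z := by
    obtain ⟨a, b, γ, rfl⟩ := exists_pathMk z
    rw [show B.gaugeGroupoid.s (B.pathGaugeMap (B.pathMk (of γ))) = B.proj a from
      gaugeSource_mk b a, pathOne_eq rfl, pathInv_mk, pathMul_mk,
      Path.Homotopic.Quotient.trans_symm]
  mul_inv z := by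
    obtain ⟨a, b, γ, rfl⟩ := exists_pathMk z
    rw [show B.gaugeGroupoid.t (B.pathGaugeMap (B.pathMk (of γ))) = B.proj b from
      gaugeTarget_mk b a, pathOne_eq rfl, pathInv_mk, pathMul_mk,
      Path.Homotopic.Quotient.symm_trans]
  continuous_one := continuous_pathOne
  continuous_inv := continuous_pathInv
  continuousOn_mul := continuousOn_pathMul

variable (B) in
/-- The representative with a given starting point. -/
noncomputable def pathStartingAt (a : P) (z : B.PathGauge) : PathClass P :=
  B.classAct (Quot.out z) (B.div (Quot.out z).ends.1 a)

theorem pathMk_pathStartingAt (a : P) (z : B.PathGauge) :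
    B.pathMk (B.pathStartingAt a z) = z :=
  (pathMk_classAct _ _).trans (Quot.out_eq z)

theorem pathStartingAt_mk {a : P} {q : PathClass P} (h : B.proj q.ends.1 = B.proj a) :
    B.pathStartingAt a (B.pathMk q) = B.classAct q (B.div q.ends.1 a) := by
  obtain ⟨g, hg⟩ := pathMk_eq_iff.1 (Quot.out_eq (B.pathMk q)).symm
  have h1 : B.div (B.act q.ends.1 g) a = g⁻¹ * B.div q.ends.1 a :=
    div_eq (by rw [← B.act_mul, mul_inv_cancel_left, act_div h])
  rw [pathStartingAt, hg, ends_classAct, h1, ← classAct_mul, mul_inv_cancel_left]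

/-- The classes of paths with a given starting point form a fibre of the source map. -/
noncomputable def startingAtHomeomorph (a : P) : {q : PathClass P // q.ends.1 = a} ≃ₜ
    {z : B.PathGauge // B.gaugeSource (B.pathGaugeMap z) = B.proj a} where
  toFun q := ⟨B.pathMk q.1, (gaugeSource_mk _ _).trans (congrArg B.proj q.2)⟩
  invFun z := ⟨B.pathStartingAt a z.1, by
    have h1 := z.2
    rw [← show B.pathMk (Quot.out z.1) = z.1 from Quot.out_eq _, pathGaugeMap_mk,
      gaugeSource_mk] at h1
    exact act_div h1⟩
  left_inv := by
    rintro ⟨q, rfl⟩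
    refine Subtype.ext ((pathStartingAt_mk rfl).trans ?_)
    rw [div_eq (B.act_one _), classAct_one]
  right_inv z := Subtype.ext (pathMk_pathStartingAt a z.1)
  continuous_toFun :=
    (isOpenQuotientMap_pathMk.continuous.comp continuous_subtype_val).subtype_mk _
  continuous_invFun := by
    -- The chosen representatives are not continuous. But the translate starting at `a` does not
    -- depend on the choice, and on path classes it is given by the continuous quotient of starting
    -- points.
    have h1 : ContinuousOn (B.pathStartingAt a)
        {z | B.gaugeSource (B.pathGaugeMap z) = B.proj a} := by
      refine isOpenQuotientMap_pathMk.continuousOn_of_comp ?_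
      have h2 : ∀ q : B.pathMk ⁻¹' {z | B.gaugeSource (B.pathGaugeMap z) = B.proj a},
          B.proj q.1.ends.1 = B.proj a := fun q => (gaugeSource_mk _ _).symm.trans q.2
      exact (continuous_classAct continuous_subtype_val (continuous_div (continuous_fst.comp
        (PathClass.continuous_ends.comp continuous_subtype_val)) continuous_const h2)).congr
        fun q => (pathStartingAt_mk (h2 q)).symm
    exact (continuousOn_iff_continuous_domRestrict.1 h1).subtype_mk _

/-- For `a` over `x`, the source fibre at `x` is homeomorphic to the classes of paths starting at
`a`. -/
theorem isSourceSimplyConnected_gaugeEtaleCover :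
    letI := B.gaugeEtaleCover.chartedSpace
    haveI := B.gaugeEtaleCover.isManifold
    B.gaugeEtaleCover.lieGroupoid.IsSourceSimplyConnected := by
  intro x
  obtain ⟨a, rfl⟩ := B.exists_proj_eq x
  have := PathClass.simplyConnectedSpace_startingAt B.hasSegmentBasis a
  exact (startingAtHomeomorph (B := B) a).symm.toHomotopyEquiv.simplyConnectedSpace

end PrincipalBundle

end PathGaugeGroupoid

/-! ### The two implications assembled. -/

theorem mainTheorem9 {n : ℕ} {M : Type uM} [TopologicalSpace M]
    [ChartedSpace (EuclideanSpace ℝ (Fin n)) M] [IsManifold (𝓡 n) ∞ M]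
    [T2Space M] [SecondCountableTopology M] [ConnectedSpace M]
    {F : Type uF} [NormedAddCommGroup F] [NormedSpace ℝ F] [FiniteDimensional ℝ F]
    {A : M → Type uA} [TopologicalSpace (TotalSpace F A)] [∀ x, TopologicalSpace (A x)]
    [∀ x, AddCommGroup (A x)] [∀ x, Module ℝ (A x)] [FiberBundle F A] [VectorBundle ℝ F A]
    [ContMDiffVectorBundle ∞ F A (𝓡 n)]
    (L : LieAlgebroid n F A) :
    -- a source-simply-connected groupoid integrating a transitive `A` makes `A` an Atiyah algebroid
    (L.IsTransitive →
      ∀ (k : ℕ) (Γ : Type uΓ) [TopologicalSpace Γ] [ChartedSpace (EuclideanSpace ℝ (Fin k)) Γ]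
        [IsManifold (𝓡 k) ∞ Γ] (𝒢 : LieGroupoid n k M Γ), 𝒢.IsSourceSimplyConnected → L.IsAlgebroidOf 𝒢 →
      ∀ x : M, ∃ (p d : ℕ)
        (_ : ChartedSpace (EuclideanSpace ℝ (Fin p)) (𝒢.SourceFiber x))
        (_ : IsManifold (𝓡 p) ∞ (𝒢.SourceFiber x))
        (_ : ChartedSpace (EuclideanSpace ℝ (Fin d)) (𝒢.Isotropy x))
        (B : PrincipalBundle n p d M (𝒢.SourceFiber x) (𝒢.Isotropy x)),
        IsSmoothEmbedding (𝓡 p) (𝓡 k) ∞ (fun u : 𝒢.SourceFiber x => u.1) ∧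
        IsSmoothEmbedding (𝓡 d) (𝓡 k) ∞ (fun g : 𝒢.Isotropy x => g.1) ∧
        (∀ u, B.proj u = 𝒢.t u.1) ∧
        (∀ u g, B.act u g = 𝒢.sourceFiberMul u g) ∧
        L.IsAtiyahAlgebroidOf B) ∧
    -- conversely, an Atiyah algebroid is integrable, and the gauge groupoid has this Lie algebroid
    (∀ (p d : ℕ) (P : Type uP) [TopologicalSpace P] [ChartedSpace (EuclideanSpace ℝ (Fin p)) P]
        [IsManifold (𝓡 p) ∞ P]
        (G : Type uG) [TopologicalSpace G] [ChartedSpace (EuclideanSpace ℝ (Fin d)) G] [Group G]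
        (B : PrincipalBundle n p d M P G), L.IsAtiyahAlgebroidOf B →
      (∃ (k : ℕ) (_ : ChartedSpace (EuclideanSpace ℝ (Fin k)) B.Gauge)
        (_ : IsManifold (𝓡 k) ∞ B.Gauge) (𝒢 : LieGroupoid n k M B.Gauge), B.IsGaugeGroupoid 𝒢 ∧ L.IsAlgebroidOf 𝒢) ∧
      LieAlgebroid.IsIntegrable.{uM, uF, uA, uP} L) := by
  refine ⟨fun hL k Γ _ _ _ 𝒢 _ ⟨φ⟩ x => ?_, ?_⟩
  · have hT := φ.isTransitive hL
    exact ⟨_, _, 𝒢.sourceFiberChartedSpace x, 𝒢.isManifold_sourceFiber x,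
      LieGroupoid.isotropyChartedSpace hT x, LieGroupoid.sourceFiberBundle hT x,
      𝒢.isSmoothEmbedding_sourceFiber x, LieGroupoid.isSmoothEmbedding_isotropy hT x,
      fun _ => rfl, fun _ _ => rfl, ⟨φ.atiyahIso hT x⟩⟩
  · rintro p d P _ _ _ G _ _ _ B ⟨ψ⟩
    let := B.gaugeChartedSpace
    have := B.isManifold_gauge
    exact ⟨⟨n + p, B.gaugeChartedSpace, B.isManifold_gauge, B.gaugeGroupoid,
      PrincipalBundle.isGaugeGroupoid_gaugeGroupoid, ⟨ψ.isoOfGauge⟩⟩,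
      n + p, B.PathGauge, inferInstance, B.gaugeEtaleCover.chartedSpace,
      B.gaugeEtaleCover.isManifold, B.gaugeEtaleCover.lieGroupoid,
      PrincipalBundle.isSourceSimplyConnected_gaugeEtaleCover,
      ⟨B.gaugeEtaleCover.isoOfEtaleCover ψ.isoOfGauge⟩⟩
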